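/- A planar tree $T$ is a locally finite rooted plane tree, given by finite ordered sets $D_r(T)$, $r\ge 0$ (the vertices at height $r$), with $|D_0(T)|=|D_1(T)|=1$, and order preserving parent maps $D_{r}(T)\to D_{r-1}(T)$, $r\ge1$; trees are identified if they are isomorphic through order preserving bijections. Let $|T|\in\mathbb N\cup\{\infty\}$ denote the number of edges of $T$ and $h(T)$ its height (the maximal height of a vertex). Let $\mathcal T$ be the set of all planar trees, $\mathcal T_N$ the set of those with $|T|=N$, and $\mathcal T_\infty$ the set of infinite ones. Let $B_r(T)$ be the subtree of $T$ spanned by the vertices at height at most $r$, and equip $\mathcal T$ with the metric $\mathrm{dist}(T,T')=\inf\{1/r : r\ge 1,\ B_r(T)=B_r(T')\}$ and its Borel $\sigma$-algebra. For $\mu>0$ and $N\ge 1$ let $\nu^{(\mu)}_N$ be the probability measure on $\mathcal T$ that is concentrated on the finite set $\mathcal T_N$ and satisfies $\nu_N^{(\mu)}(\{T\})=e^{-\mu h(T)}/Z_N^{(\mu)}$ for $T\in\mathcal T_N$, where $Z^{(\mu)}_N=\sum_{T\in\mathcal T_N}e^{-\mu h(T)}$. A vertex of $T\in\mathcal T_\infty$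 is of infinite type if it has infinitely many descendants, and the spine $\chi(T)$ is the subtree of $T$ spanned by the vertices of infinite type. Let $\mathcal T^s=\chi(\mathcal T_\infty)$ be the set of spine trees. **Statement.** Let $\mu>0$. The measures $\nu_N^{(\mu)}$ converge weakly, as $N\to\infty$, to a unique Borel probability measure $\nu^{(\mu)}$ on $\mathcal T$. The measure $\tilde\nu^{(\mu)}$ on $\mathcal T^s$ given by $\tilde\nu^{(\mu)}(A)=\nu^{(\mu)}(\chi^{-1}(A))$ for Borel sets $A\subseteq\mathcal T^s$ (the spine measure) is a probability measure. With respect to $\tilde\nu^{(\mu)}$, the random variables $\zeta_r(T^s)=|D_{r+1}(T^s)|-|D_r(T^s)|$, $r=1,2,\dots$, on $\mathcal T^s$ are independent and identically distributed, with the Poisson distribution of mean $\mu$: $$\tilde\nu^{(\mu)}(\zeta_r=n)=e^{-\mu}\,\frac{\mu^n}{n!},\qquad n=0,1,2,\dots$$ In particular, for every $r\ge 2$, $|D_r(T^s)|-1$ is Poisson distributed with mean $(r-1)\mu$ with respect to $\tilde\nu^{(\mu)}$, that is, $$\tilde\nu^{(\mu)}(|D_r(T^s)|=R)=e^{-(r-1)\mu}\,\frac{((r-1)\mu)^{R-1}}{(R-1)!},\qquad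 R\ge 1.$$ -/

import Mathlib

/-- A planar tree, up to order preserving isomorphism.  It is locally finite, but may be infinite.

The vertices at height `r` form a finite ordered set `D_r`, listed from left to right as
`0, 1, …, gen r - 1`, so that a vertex is a pair `(r, i)` with `i < gen r`.  The vertex `(r + 1, i)`
has the parent `(r, parent r i)`.  The parent maps are order preserving, and `D_0` (the root) and
`D_1` are one-point sets.  As the only order preserving bijection between finite initial segments
of `ℕ` is the identity, two trees are isomorphic exactly if they are equal in this encoding; the
field `parent_out` fixes the values of `parent` outside the tree, which carry no information. -/
@[ext]
structure PlanarTree where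
  gen : ℕ → ℕ
  parent : ℕ → ℕ → ℕ
  gen_zero : gen 0 = 1
  gen_one : gen 1 = 1
  parent_lt : ∀ r i, i < gen (r + 1) → parent r i < gen r
  parent_mono : ∀ r i j, i ≤ j → j < gen (r + 1) → parent r i ≤ parent r j
  parent_out : ∀ r i, gen (r + 1) ≤ i → parent r i = 0

namespace PlanarTree

/-- The set of vertices. -/
def vertices (T : PlanarTree) : Set (ℕ × ℕ) := {v | v.2 < T.gen v.1}

/-- The size `|T|`, i.e. the number of edges.  Every edge joins a vertex different from the root to
its parent, so that edges are counted by their upper end points. -/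
noncomputable def size (T : PlanarTree) : ℕ∞ := {v ∈ T.vertices | 1 ≤ v.1}.encard

/-- The height of a finite tree: the maximal height of a vertex.  (Used for finite trees only.) -/
noncomputable def height (T : PlanarTree) : ℕ := sSup {r | T.gen r ≠ 0}

/-- The ball `B_r(T)` of radius `r ≥ 1` around the root: the subtree spanned by the vertices at
height at most `r`. -/
def ball (T : PlanarTree) (r : ℕ) (hr : 1 ≤ r) : PlanarTree where
  gen s := if s ≤ r then T.gen s else 0
  parent s i := if s + 1 ≤ r then T.parent s i else 0
  gen_zero := by simp [T.gen_zero]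
  gen_one := by simp [T.gen_one, hr]
  parent_lt s i h := by
    by_cases hs : s + 1 ≤ r
    · have hs' : s ≤ r := by omega
      simp only [hs, hs', if_true] at h ⊢
      exact T.parent_lt s i h
    · simp [hs] at h
  parent_mono s i j hij h := by
    by_cases hs : s + 1 ≤ r
    · simp only [hs, if_true] at h ⊢
      exact T.parent_mono s i j hij h
    · simp [hs]
  parent_out s i h := by
    by_cases hs : s + 1 ≤ r
    · simp only [hs, if_true] at h ⊢
      exact T.parent_out s i h
    · simp [hs]

theorem ball_eq_iff (T T' : PlanarTree) (r : ℕ) (hr : 1 ≤ r) :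
    T.ball r hr = T'.ball r hr ↔
      (∀ s ≤ r, T.gen s = T'.gen s) ∧ ∀ s < r, ∀ i, T.parent s i = T'.parent s i := by
  constructor
  · intro h
    have h1 := congrArg PlanarTree.gen h
    have h2 := congrArg PlanarTree.parent h
    refine ⟨fun s hs => ?_, fun s hs i => ?_⟩
    · have := congrFun h1 s
      simpa [ball, hs] using this
    · have := congrFun (congrFun h2 s) i
      simpa [ball, hs] using this
  · rintro ⟨h1, h2⟩
    ext s i
    · by_cases hs : s ≤ r
      · simp [ball, hs, h1 s hs]
      · simp [ball, hs]
    · by_cases hs : s < r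
      · simp [ball, h2 s hs i]
      · simp [ball, hs]

theorem ball_eq_of_le {T T' : PlanarTree} {r s : ℕ} (hr : 1 ≤ r) (hs : 1 ≤ s) (h : s ≤ r)
    (he : T.ball r hr = T'.ball r hr) : T.ball s hs = T'.ball s hs := by
  rw [ball_eq_iff] at he ⊢
  exact ⟨fun t ht => he.1 t (ht.trans h), fun t ht => he.2 t (ht.trans_le h)⟩

/-- The numbers `1 / r`, where `r ≥ 1` and the balls of radius `r` in the two trees agree. -/
def agreeSet (T T' : PlanarTree) : Set ℝ :=
  {x | ∃ (r : ℕ) (hr : 1 ≤ r), T.ball r hr = T'.ball r hr ∧ x = 1 / (r : ℝ)}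

theorem agreeSet_bddBelow (T T' : PlanarTree) : BddBelow (agreeSet T T') :=
  ⟨0, by rintro x ⟨r, hr, -, rfl⟩; positivity⟩

theorem agreeSet_nonempty (T T' : PlanarTree) : (agreeSet T T').Nonempty := by
  refine ⟨1 / ((1 : ℕ) : ℝ), 1, le_rfl, ?_, rfl⟩
  rw [ball_eq_iff]
  refine ⟨fun s hs => ?_, fun s hs i => ?_⟩
  · interval_cases s
    · rw [T.gen_zero, T'.gen_zero]
    · rw [T.gen_one, T'.gen_one]
  · obtain rfl : s = 0 := by omega
    have key : ∀ S : PlanarTree, S.parent 0 i = 0 := by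
      intro S
      by_cases hi : i < S.gen 1
      · have := S.parent_lt 0 i hi
        rw [S.gen_zero] at this
        omega
      · exact S.parent_out 0 i (by simpa using hi)
    rw [key, key]

theorem sInf_agreeSet_nonneg (T T' : PlanarTree) : 0 ≤ sInf (agreeSet T T') :=
  Real.sInf_nonneg (by rintro x ⟨r, hr, -, rfl⟩; positivity)

theorem exists_ball_eq_of_sInf_lt {T T' : PlanarTree} {a : ℝ} (h : sInf (agreeSet T T') < a) :
    ∃ (r : ℕ) (hr : 1 ≤ r), T.ball r hr = T'.ball r hr ∧ 1 / (r : ℝ) < a := by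
  obtain ⟨x, ⟨r, hr, he, rfl⟩, hx⟩ := exists_lt_of_csInf_lt (agreeSet_nonempty T T') h
  exact ⟨r, hr, he, hx⟩

theorem sInf_agreeSet_le {T T' : PlanarTree} {r : ℕ} (hr : 1 ≤ r)
    (he : T.ball r hr = T'.ball r hr) : sInf (agreeSet T T') ≤ 1 / (r : ℝ) :=
  csInf_le (agreeSet_bddBelow T T') ⟨r, hr, he, rfl⟩

theorem sInf_agreeSet_triangle (T T' T'' : PlanarTree) :
    sInf (agreeSet T T'') ≤ max (sInf (agreeSet T T')) (sInf (agreeSet T' T'')) := by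
  refine le_of_forall_gt fun a ha => ?_
  obtain ⟨r, hr, he, hra⟩ := exists_ball_eq_of_sInf_lt ((le_max_left _ _).trans_lt ha)
  obtain ⟨s, hs, he', hsa⟩ := exists_ball_eq_of_sInf_lt ((le_max_right _ _).trans_lt ha)
  rcases le_total r s with h | h
  · exact (sInf_agreeSet_le hr (he.trans (ball_eq_of_le hs hr h he'))).trans_lt hra
  · exact (sInf_agreeSet_le hs ((ball_eq_of_le hr hs h he).trans he')).trans_lt hsa

theorem eq_of_sInf_agreeSet {T T' : PlanarTree} (h : sInf (agreeSet T T') = 0) : T = T' := by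
  have key : ∀ n : ℕ, ∃ (r : ℕ) (hr : 1 ≤ r), T.ball r hr = T'.ball r hr ∧ n < r := by
    intro n
    have hpos : sInf (agreeSet T T') < 1 / ((n : ℝ) + 1) := by rw [h]; positivity
    obtain ⟨r, hr, he, hlt⟩ := exists_ball_eq_of_sInf_lt hpos
    refine ⟨r, hr, he, ?_⟩
    have hr0 : (0 : ℝ) < r := by exact_mod_cast hr
    have := (one_div_lt_one_div hr0 (by positivity)).1 hlt
    have h2 : n + 1 < r := by exact_mod_cast this
    omega
  ext s i
  · obtain ⟨r, hr, he, hlt⟩ := key s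
    exact ((ball_eq_iff T T' r hr).1 he).1 s hlt.le
  · obtain ⟨r, hr, he, hlt⟩ := key s
    exact ((ball_eq_iff T T' r hr).1 he).2 s hlt i

/-- The metric `dist(T, T') = inf {1 / r | r ≥ 1, B_r(T) = B_r(T')}`. -/
noncomputable instance : MetricSpace PlanarTree where
  dist T T' := sInf (agreeSet T T')
  dist_self T := by
    refine le_antisymm (le_of_forall_gt fun a ha => ?_) (sInf_agreeSet_nonneg T T)
    obtain ⟨n, hn⟩ := exists_nat_one_div_lt ha
    refine (sInf_agreeSet_le (r := n + 1) (by omega) rfl).trans_lt ?_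
    exact_mod_cast hn
  dist_comm T T' := by
    congr 1
    ext x
    constructor
    · rintro ⟨r, hr, he, rfl⟩
      exact ⟨r, hr, he.symm, rfl⟩
    · rintro ⟨r, hr, he, rfl⟩
      exact ⟨r, hr, he.symm, rfl⟩
  dist_triangle T T' T'' :=
    (sInf_agreeSet_triangle T T' T'').trans
      (max_le_add_of_nonneg (sInf_agreeSet_nonneg _ _) (sInf_agreeSet_nonneg _ _))
  eq_of_dist_eq_zero := eq_of_sInf_agreeSet

noncomputable instance : MeasurableSpace PlanarTree := borel PlanarTree

instance : BorelSpace PlanarTree := ⟨rfl⟩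

/-! ### The finite size measures and their local limit -/

open scoped BoundedContinuousFunction

/-- The partition function `Z_N = ∑ exp (-μ h(T))`, summed over the (finitely many) trees `T` with
`N` edges. -/
noncomputable def partitionFunction (μ : ℝ) (N : ℕ) : ENNReal :=
  ∑' T : {T : PlanarTree // T.size = N}, ENNReal.ofReal (Real.exp (-μ * T.1.height))

/-- The measure on the space of trees that is concentrated on the trees with `N` edges and gives
to each such tree `T` the mass `exp (-μ h(T)) / Z_N`. -/
noncomputable def finiteSizeMeasure (μ : ℝ) (N : ℕ) : MeasureTheory.Measure PlanarTree :=
  MeasureTheory.Measure.sum fun T : {T : PlanarTree // T.size = N} =>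
    (ENNReal.ofReal (Real.exp (-μ * T.1.height)) / partitionFunction μ N) •
      MeasureTheory.Measure.dirac T.1

/-- `ν` is the local limit of the finite size measures: it is a Borel probability measure, and the
finite size measures converge to it weakly as the size tends to infinity. -/
def IsLocalLimit (μ : ℝ) (ν : MeasureTheory.Measure PlanarTree) : Prop :=
  MeasureTheory.IsProbabilityMeasure ν ∧
    ∀ F : PlanarTree →ᵇ ℝ,
      Filter.Tendsto (fun N : ℕ => ∫ T, F T ∂(finiteSizeMeasure μ N)) Filter.atTop
        (nhds (∫ T, F T ∂ν))

/-! ### The spine -/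

/-- The type of infinite trees. -/
abbrev InfiniteTree : Type := {T : PlanarTree // T.size = ⊤}

/-- `T.ancestor r k j` is the position in `D_r` of the ancestor at height `r` of the vertex
`(r + k, j)`. -/
def ancestor (T : PlanarTree) (r : ℕ) : ℕ → ℕ → ℕ
  | 0, j => j
  | k + 1, j => T.ancestor r k (T.parent (r + k) j)

/-- The vertex `(r, i)` is of infinite type: it has infinitely many descendants `(r + k, j)`. -/
def InfiniteType (T : PlanarTree) (r i : ℕ) : Prop :=
  i < T.gen r ∧ {p : ℕ × ℕ | p.2 < T.gen (r + p.1) ∧ T.ancestor r p.1 p.2 = i}.Infinite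

theorem ancestor_succ' (T : PlanarTree) (r k j : ℕ) :
    T.ancestor r (k + 1) j = T.parent r (T.ancestor (r + 1) k j) := by
  induction k generalizing j with
  | zero => rfl
  | succ k ih =>
    change T.ancestor r (k + 1) (T.parent (r + (k + 1)) j) =
      T.parent r (T.ancestor (r + 1) k (T.parent (r + 1 + k) j))
    rw [ih, show r + (k + 1) = r + 1 + k by omega]

theorem InfiniteType.parent {T : PlanarTree} {r i : ℕ} (h : T.InfiniteType (r + 1) i) :
    T.InfiniteType r (T.parent r i) := by
  refine ⟨T.parent_lt r i h.1, ?_⟩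
  refine (h.2.image (f := fun p : ℕ × ℕ => (p.1 + 1, p.2)) ?_).mono ?_
  · rintro ⟨a, b⟩ - ⟨c, d⟩ - he
    simpa using he
  · rintro _ ⟨⟨k, j⟩, ⟨h1, h2⟩, rfl⟩
    refine ⟨?_, ?_⟩
    · simpa only [show r + (k + 1) = r + 1 + k by omega] using h1
    · exact (ancestor_succ' T r k j).trans (congrArg _ h2)

theorem vertices_infinite (T : InfiniteTree) : T.1.vertices.Infinite := by
  have h := T.2
  rw [size, Set.encard_eq_top_iff] at h
  exact h.mono fun v hv => hv.1

theorem ancestor_lt (T : PlanarTree) (r k j : ℕ) (h : j < T.gen (r + k)) :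
    T.ancestor r k j < T.gen r := by
  induction k generalizing j with
  | zero => exact h
  | succ k ih => exact ih _ (T.parent_lt _ _ h)

theorem infiniteType_zero (T : InfiniteTree) : T.1.InfiniteType 0 0 := by
  refine ⟨by rw [T.1.gen_zero]; omega, (vertices_infinite T).mono ?_⟩
  rintro ⟨k, j⟩ hv
  have hv' : j < T.1.gen (0 + k) := by simpa [vertices] using hv
  refine ⟨hv', ?_⟩
  have := ancestor_lt T.1 0 k j hv'
  rw [T.1.gen_zero] at this
  exact Nat.lt_one_iff.1 this

theorem infiniteType_one (T : InfiniteTree) : T.1.InfiniteType 1 0 := by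
  refine ⟨by rw [T.1.gen_one]; omega, ?_⟩
  have h := T.2
  rw [size, Set.encard_eq_top_iff] at h
  refine (h.image (f := fun v : ℕ × ℕ => (v.1 - 1, v.2)) ?_).mono ?_
  · rintro ⟨a, b⟩ ⟨-, ha⟩ ⟨c, d⟩ ⟨-, hc⟩ he
    simp only [Prod.mk.injEq] at he ha hc ⊢
    omega
  · rintro _ ⟨⟨k, j⟩, ⟨h1, h2⟩, rfl⟩
    have h2' : 1 ≤ k := h2
    have h1' : j < T.1.gen (1 + (k - 1)) := by
      rw [show 1 + (k - 1) = k by omega]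
      exact h1
    refine ⟨h1', ?_⟩
    have := ancestor_lt T.1 1 (k - 1) j h1'
    rw [T.1.gen_one] at this
    exact Nat.lt_one_iff.1 this

open Classical in
theorem nth_infiniteType {T : PlanarTree} {r j : ℕ}
    (h : j < Nat.count (T.InfiniteType r) (T.gen r)) :
    T.InfiniteType r (Nat.nth (T.InfiniteType r) j) :=
  Nat.nth_mem j fun hf => h.trans_le (Nat.count_le_card hf _)

open Classical in
/-- The spine map `χ`, which sends an infinite tree to its subtree spanned by the vertices of
infinite type.  The vertices of infinite type at height `r` are renumbered from left to right: the
`j`-th of them has the position `Nat.nth (T.InfiniteType r) j` in `D_r(T)`, and conversely a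
vertex `(r, i)` of infinite type gets the number `Nat.count (T.InfiniteType r) i` of vertices of
infinite type to the left of it. -/
noncomputable def spine (T : InfiniteTree) : PlanarTree where
  gen r := Nat.count (T.1.InfiniteType r) (T.1.gen r)
  parent r j :=
    if j < Nat.count (T.1.InfiniteType (r + 1)) (T.1.gen (r + 1)) then
      Nat.count (T.1.InfiniteType r) (T.1.parent r (Nat.nth (T.1.InfiniteType (r + 1)) j))
    else 0
  gen_zero := by
    rw [T.1.gen_zero, Nat.count_one, if_pos (infiniteType_zero T)]
  gen_one := by
    rw [T.1.gen_one, Nat.count_one, if_pos (infiniteType_one T)]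
  parent_lt r j h := by
    rw [if_pos h]
    have h' := (nth_infiniteType h).parent
    exact Nat.count_strict_mono h' h'.1
  parent_mono r i j hij h := by
    rw [if_pos h, if_pos (hij.trans_lt h)]
    refine Nat.count_monotone _ (T.1.parent_mono r _ _ ?_ (nth_infiniteType h).1)
    exact Nat.nth_le_nth' hij fun hf => h.trans_le (Nat.count_le_card hf _)
  parent_out r j h := if_neg (not_lt.2 h)

/-- The set `χ(𝒯_∞)` of spine trees. -/
abbrev SpineTree : Type := Set.range spine

/-- The measure induced by `ν` on the set of spine trees: the pushforward under the spine map of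
the restriction of `ν` to the (Borel) set of infinite trees. -/
noncomputable def spineMeasure (ν : MeasureTheory.Measure PlanarTree) :
    MeasureTheory.Measure SpineTree :=
  MeasureTheory.Measure.map (Set.rangeFactorization spine)
    (MeasureTheory.Measure.comap (Subtype.val : InfiniteTree → PlanarTree) ν)

/-- The increment `ζ_r = |D_{r+1}| - |D_r|` of the generation size of a spine tree. -/
def increment (r : ℕ) (T : SpineTree) : ℤ := (T.1.gen (r + 1) : ℤ) - (T.1.gen r : ℤ)

end PlanarTree

/-! Put q = e^{-μ}. Cutting a tree of size N at height r leaves K planted trees above the cut, so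
the mass of a cylinder under the finite size measure is q^r W(K,N')/W(1,N). Here W(K,N) =
`forestWeight` sums q^height over forests of K trees with N edges. Deleting the K root edges gives
W(K,N+K) = q Σ_J multichoose(K,J) W(J,N). Everything rests on the ratio limit W(K,N)/W(1,N) → w(K) =
`limitWeight`, together with the growth rate 4.

The ratio limit has three ingredients. (1) The series 1/(1 - bX_m), with X_m counting trees of
height at most m, are continued fractions. Their coefficients are therefore even moments of
symmetric matrices, and mixing over m keeps the resulting log-convexity. Hence consecutive ratios
converge to a growth rate L ≤ 4, the same for all b in (0,1] (`sq_branchWeight_le`,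
`exists_growth_rate`). (2) Consequently every limit point of the normalized weights is invariant
under N ↦ N+1 and solves the limiting branching equation (`exists_isBranchingSolution`). (3) The
generating function of a solution satisfies a functional equation along the Möbius map b ↦ L/(L-b).
For L < 4 this map has no real fixed point, which contradicts summability (`four_le`). For L = 4 it
is parabolic and conjugate to a translation; the solution is explicit up to a periodic factor, and
Cauchy–Schwarz forces that factor to be constant (`profile_eq_one`). So the solution is unique, and
it is w.

The limit measure is the Doob transform by w of the branching process. Its cylinder masses are the
limits of the finite ones, which gives weak convergence. Write a_s for the Poisson-type coefficient
(μ/2)^{s-1}/(s-1)! (`infiniteWeight`). In w(K) = Σ_s C(K,s) 2^{s-K} a_s each finite tree carries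
weight 1/2 and s counts the infinite ones. `measure_infiniteVertices_eq` makes this literal, by
letting the survival height tend to infinity and inverting over subsets. Vandermonde's identity then
splits off a factor Poisson(μ) for the growth of the number of infinite vertices. This factor
depends neither on the past of the tree nor on the current set of infinite vertices, so the
increments are independent and Poisson (`measure_infiniteVertices_eq_inter_card`,
`measure_biInter_infiniteIncrement`). -/

namespace PlanarTree

open Filter Topology Finset PowerSeries

/-! ### Generating series of forests of bounded height -/

/-- The negative binomial expansion of `(1 - Y) ^ (-k)`, for a series `Y` without constant term. -/
noncomputable def negBinomSeries (Y : ℝ⟦X⟧) (k : ℕ) : ℝ⟦X⟧ :=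
  PowerSeries.mk fun n => ∑ j ∈ range (n + 1), (Nat.multichoose k j : ℝ) * coeff n (Y ^ j)

theorem coeff_pow_eq_zero_of_lt {Y : ℝ⟦X⟧} (hY : constantCoeff Y = 0) {n j : ℕ} (h : n < j) :
    coeff n (Y ^ j) = 0 := by
  have h1 : (X : ℝ⟦X⟧) ∣ Y := X_dvd_iff.2 hY
  exact X_pow_dvd_iff.1 (pow_dvd_pow_of_dvd h1 j) n h

/-- Since Y^j has order at least j, the length of the truncation is irrelevant once it exceeds n. -/
theorem coeff_negBinomSeries {Y : ℝ⟦X⟧} (hY : constantCoeff Y = 0) (k : ℕ) {n M : ℕ} (h : n < M) :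
    coeff n (negBinomSeries Y k) =
      coeff n (∑ j ∈ range M, C (Nat.multichoose k j : ℝ) * Y ^ j) := by
  simp only [negBinomSeries, coeff_mk, map_sum, coeff_C_mul]
  refine sum_subset (by intro x; simp only [mem_range]; omega) fun j _ hj => ?_
  rw [coeff_pow_eq_zero_of_lt hY (by simpa using hj), mul_zero]

theorem coeff_mul_congr {A B Y : ℝ⟦X⟧} {n : ℕ} (h : ∀ i ≤ n, coeff i A = coeff i B) :
    coeff n (Y * A) = coeff n (Y * B) := by
  rw [coeff_mul, coeff_mul]
  refine sum_congr rfl fun p hp => ?_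
  rw [h p.2 (by have := mem_antidiagonal.1 hp; omega)]

/-- Pascal's rule for `multichoose` makes the truncated sums telescope. Taking one more term on the
right leaves a single remainder in Y^(n+1), which the n-th coefficient does not see. -/
theorem one_sub_mul_negBinomSeries_succ {Y : ℝ⟦X⟧} (hY : constantCoeff Y = 0) (k : ℕ) :
    (1 - Y) * negBinomSeries Y (k + 1) = negBinomSeries Y k := by
  ext n
  rw [coeff_mul_congr (B := ∑ j ∈ range (n + 1), C (Nat.multichoose (k + 1) j : ℝ) * Y ^ j)
    fun i hi => coeff_negBinomSeries hY _ (by omega), coeff_negBinomSeries hY k (M := n + 2) (by omega)]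
  have key : (1 - Y) * ∑ j ∈ range (n + 1), C (Nat.multichoose (k + 1) j : ℝ) * Y ^ j =
      ∑ j ∈ range (n + 2), C (Nat.multichoose k j : ℝ) * Y ^ j -
        C (Nat.multichoose (k + 1) (n + 1) : ℝ) * Y ^ (n + 1) := by
    induction n with
    | zero =>
      simp only [sum_range_succ, range_zero, sum_empty, Nat.multichoose_zero_right,
        Nat.multichoose_one_right]
      push_cast
      simp
      ring
    | succ n ih =>
      rw [sum_range_succ, mul_add, ih, sum_range_succ (n := n + 2),
        Nat.multichoose_succ_succ k (n + 1)]
      push_cast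
      rw [map_add]
      ring
  rw [key, map_sub, coeff_C_mul, coeff_pow_eq_zero_of_lt hY (Nat.lt_succ_self n)]
  simp

theorem negBinomSeries_zero (Y : ℝ⟦X⟧) : negBinomSeries Y 0 = 1 := by
  ext n
  rw [negBinomSeries, coeff_mk, sum_range_succ']
  simp

theorem inv_one_sub_pow {Y : ℝ⟦X⟧} (hY : constantCoeff Y = 0) (k : ℕ) :
    ((1 - Y)⁻¹) ^ k = negBinomSeries Y k := by
  have h0 : constantCoeff (1 - Y) ≠ 0 := by simp [hY]
  induction k with
  | zero => rw [negBinomSeries_zero, pow_zero]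
  | succ k ih =>
    rw [pow_succ, ih, ← one_sub_mul_negBinomSeries_succ hY k, mul_assoc, mul_comm, mul_assoc,
      PowerSeries.inv_mul_cancel _ h0, mul_one]

/-- The generating series, by number of edges, of the planar trees of height at most `m`. -/
noncomputable def heightSeries : ℕ → ℝ⟦X⟧
  | 0 => 0
  | m + 1 => X * (1 - heightSeries m)⁻¹

theorem constantCoeff_heightSeries (m : ℕ) : constantCoeff (heightSeries m) = 0 := by
  cases m <;> simp [heightSeries]

/-- The number of ordered forests of `K` planar trees of height at most `m` with `N` edges. -/
noncomputable def forestCount (m K N : ℕ) : ℝ := coeff N (heightSeries m ^ K)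

theorem forestCount_zero_left (K N : ℕ) :
    forestCount 0 K N = if K = 0 ∧ N = 0 then 1 else 0 := by
  rcases K with _ | K
  · simp [forestCount, coeff_one]
  · simp [forestCount, heightSeries]

theorem forestCount_zero_mid (m N : ℕ) : forestCount m 0 N = if N = 0 then 1 else 0 := by
  simp [forestCount, coeff_one]

/-- Deleting the K root edges leaves J planted trees, lower by one, hung in order on K vertices:
`multichoose K J` ways. -/
theorem forestCount_succ (m K N : ℕ) :
    forestCount (m + 1) K (N + K) =
      ∑ J ∈ range (N + 1), (Nat.multichoose K J : ℝ) * forestCount m J N := by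
  rw [forestCount, heightSeries, mul_pow, inv_one_sub_pow (constantCoeff_heightSeries m),
    coeff_X_pow_mul, negBinomSeries, coeff_mk]
  rfl

theorem forestCount_of_lt (m : ℕ) {K N : ℕ} (h : N < K) : forestCount m K N = 0 :=
  coeff_pow_eq_zero_of_lt (constantCoeff_heightSeries m) h

theorem forestCount_nonneg (m K N : ℕ) : 0 ≤ forestCount m K N := by
  induction m generalizing K N with
  | zero => rw [forestCount_zero_left]; split_ifs <;> norm_num
  | succ m ih =>
    rcases lt_or_ge N K with h | h
    · rw [forestCount_of_lt _ h]
    · obtain ⟨M, rfl⟩ := Nat.exists_eq_add_of_le' h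
      rw [forestCount_succ]
      exact sum_nonneg fun J _ => mul_nonneg (by positivity) (ih _ _)

theorem multichoose_succ_left (k j : ℕ) : Nat.multichoose (k + 1) j = (j + k).choose k := by
  rw [Nat.multichoose_eq, show k + 1 + j - 1 = j + k by omega, ← Nat.choose_symm_add]

theorem hasSum_multichoose_mul_pow (k : ℕ) {x : ℝ} (h0 : 0 ≤ x) (h1 : x < 1) :
    HasSum (fun j => (Nat.multichoose k j : ℝ) * x ^ j) (1 / (1 - x) ^ k) := by
  rcases k with _ | k
  · have : HasSum (fun j => (Nat.multichoose 0 j : ℝ) * x ^ j)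
        ((Nat.multichoose 0 0 : ℝ) * x ^ 0) := by
      refine hasSum_single 0 fun j hj => ?_
      obtain ⟨i, rfl⟩ := Nat.exists_eq_succ_of_ne_zero hj
      simp
    simpa using this
  · have := hasSum_choose_mul_geometric_of_norm_lt_one (𝕜 := ℝ) k (r := x)
      (by rwa [Real.norm_of_nonneg h0])
    simpa only [multichoose_succ_left] using this

/-- Coefficientwise form of X_m(1/4) ≤ 1/2, where 1/2 is the fixed point of x ↦ (1/4)/(1-x). This is
the source of the bound L ≤ 4 on the growth rate. -/
theorem forestCount_le (m K N : ℕ) : forestCount m K N ≤ 4 ^ N / 2 ^ K := by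
  induction m generalizing K N with
  | zero =>
    rw [forestCount_zero_left]
    split_ifs with h
    · simp [h.1, h.2]
    · positivity
  | succ m ih =>
    rcases lt_or_ge N K with h | h
    · rw [forestCount_of_lt _ h]; positivity
    · obtain ⟨M, rfl⟩ := Nat.exists_eq_add_of_le' h
      rw [forestCount_succ]
      have hs := hasSum_multichoose_mul_pow K (x := 1 / 2) (by norm_num) (by norm_num)
      calc ∑ J ∈ range (M + 1), (Nat.multichoose K J : ℝ) * forestCount m J M
          ≤ ∑ J ∈ range (M + 1), 4 ^ M * ((Nat.multichoose K J : ℝ) * (1 / 2) ^ J) := by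
            refine sum_le_sum fun J _ => ?_
            calc _ ≤ (Nat.multichoose K J : ℝ) * (4 ^ M / 2 ^ J) := by
                  gcongr; exact ih _ _
              _ = _ := by rw [one_div, inv_pow]; ring
        _ = 4 ^ M * ∑ J ∈ range (M + 1), ((Nat.multichoose K J : ℝ) * (1 / 2) ^ J) := by
            rw [mul_sum]
        _ ≤ 4 ^ M * (1 / (1 - 1 / 2) ^ K) := by
            gcongr
            exact sum_le_hasSum _ (fun _ _ => by positivity) hs
        _ = 4 ^ (M + K) / 2 ^ K := by
            rw [show (1 - 1 / 2 : ℝ) = 1 / 2 by norm_num, pow_add,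
              show (4 : ℝ) ^ K = 2 ^ K * 2 ^ K by rw [← mul_pow]; norm_num]
            rw [div_pow, one_pow, one_div_one_div]
            field_simp

/-! ### Weighted forest counts -/

/-- The sum of `q ^ h` over the forests of `K ≥ 1` planar trees with `N` edges, where `h` is the
height of the forest. -/
noncomputable def forestWeight (q : ℝ) (K N : ℕ) : ℝ :=
  -- A forest of height h is counted for every m ≥ h, and Σ_{m ≥ h} (1-q) q^m = q^h.
  ∑' m, (1 - q) * q ^ m * forestCount m K N

theorem hasSum_geometric_weight {q : ℝ} (hq0 : 0 < q) (hq1 : q < 1)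
    : HasSum (fun m : ℕ => (1 - q) * q ^ m) 1 := by
  have := (hasSum_geometric_of_lt_one hq0.le hq1).mul_left (1 - q)
  rwa [mul_inv_cancel₀ (by linarith)] at this

theorem summable_forestWeight {q : ℝ} (hq0 : 0 < q) (hq1 : q < 1)
    (K N : ℕ) :
    Summable fun m => (1 - q) * q ^ m * forestCount m K N := by
  refine Summable.of_nonneg_of_le (fun m => ?_) (fun m => ?_)
    ((hasSum_geometric_weight hq0 hq1).summable.mul_right (4 ^ N / 2 ^ K : ℝ))
  · exact mul_nonneg (mul_nonneg (by linarith) (by positivity)) (forestCount_nonneg _ _ _)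
  · exact mul_le_mul_of_nonneg_left (forestCount_le _ _ _)
      (mul_nonneg (by linarith) (by positivity))

theorem forestWeight_nonneg {q : ℝ} (hq0 : 0 < q) (hq1 : q < 1)
    (K N : ℕ) : 0 ≤ forestWeight q K N :=
  tsum_nonneg fun m =>
    mul_nonneg (mul_nonneg (by linarith) (by positivity)) (forestCount_nonneg _ _ _)

theorem forestWeight_zero_left {q : ℝ} (hq0 : 0 < q) (hq1 : q < 1)
    (N : ℕ) : forestWeight q 0 N = if N = 0 then 1 else 0 := by
  simp only [forestWeight, forestCount_zero_mid]
  rw [tsum_mul_right, (hasSum_geometric_weight hq0 hq1).tsum_eq, one_mul]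

theorem forestWeight_of_lt (q : ℝ) {K N : ℕ} (h : N < K) : forestWeight q K N = 0 := by
  simp [forestWeight, forestCount_of_lt _ h]

/-- The factor q comes from shifting m by one; the term m = 0 vanishes because K ≥ 1. -/
theorem forestWeight_rec {q : ℝ} (hq0 : 0 < q) (hq1 : q < 1)
    {K : ℕ} (hK : 1 ≤ K) (N : ℕ) :
    forestWeight q K (N + K) =
      q * ∑ J ∈ range (N + 1), (Nat.multichoose K J : ℝ) * forestWeight q J N := by
  rw [forestWeight, (summable_forestWeight hq0 hq1 K (N + K)).tsum_eq_zero_add,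
    forestCount_zero_left, if_neg (by omega), mul_zero, zero_add]
  simp only [forestCount_succ, forestWeight, ← tsum_mul_left]
  rw [← Summable.tsum_finsetSum fun J _ =>
    (summable_forestWeight hq0 hq1 J N).mul_left (Nat.multichoose K J : ℝ), ← tsum_mul_left]
  refine tsum_congr fun m => ?_
  rw [mul_sum, mul_sum]
  refine sum_congr rfl fun J _ => ?_
  ring

theorem forestWeight_le {q : ℝ} (hq0 : 0 < q) (hq1 : q < 1)
    (K N : ℕ) : forestWeight q K N ≤ 4 ^ N / 2 ^ K := by
  have h := (hasSum_geometric_weight hq0 hq1).mul_right (4 ^ N / 2 ^ K : ℝ)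
  rw [one_mul] at h
  exact hasSum_le (fun m => mul_le_mul_of_nonneg_left (forestCount_le _ _ _)
      (mul_nonneg (by linarith) (by positivity))) (summable_forestWeight hq0 hq1 K N).hasSum h

end PlanarTree

namespace PlanarTree

open Filter Topology Finset PowerSeries Matrix

/-! ### Moment sequences -/

/-- The moments of a vector with respect to a symmetric matrix. -/
def IsMomentSeq (s : ℕ → ℝ) : Prop :=
  ∃ (ι : Type) (_ : Fintype ι) (_ : DecidableEq ι) (B : Matrix ι ι ℝ) (v : ι → ℝ),
    B.IsSymm ∧ ∀ n, s n = v ⬝ᵥ (B ^ n *ᵥ v)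

/-- The expression is the squared norm of t B^n v + B^(n+2) v. -/
theorem IsMomentSeq.quadratic_nonneg {s : ℕ → ℝ} (h : IsMomentSeq s) (n : ℕ) (t : ℝ) :
    0 ≤ t ^ 2 * s (2 * n) + 2 * t * s (2 * n + 2) + s (2 * n + 4) := by
  obtain ⟨ι, _, _, B, v, hB, hs⟩ := h
  have key : ∀ a b, (B ^ a *ᵥ v) ⬝ᵥ (B ^ b *ᵥ v) = s (a + b) := by
    intro a b
    rw [hs, pow_add, ← mulVec_mulVec, dotProduct_mulVec v, ← mulVec_transpose, (hB.pow a).eq]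
  have : t ^ 2 * s (2 * n) + 2 * t * s (2 * n + 2) + s (2 * n + 4) =
      (t • (B ^ n *ᵥ v) + B ^ (n + 2) *ᵥ v) ⬝ᵥ (t • (B ^ n *ᵥ v) + B ^ (n + 2) *ᵥ v) := by
    simp only [add_dotProduct, dotProduct_add, smul_dotProduct, dotProduct_smul, key, smul_eq_mul]
    rw [show n + n = 2 * n by ring, show n + (n + 2) = 2 * n + 2 by ring,
      show n + 2 + n = 2 * n + 2 by ring, show n + 2 + (n + 2) = 2 * n + 4 by ring]
    ring
  rw [this]
  exact sum_nonneg fun i _ => mul_self_nonneg _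

/-- Border B by one new state joined to the old ones through √b v. Closed walks at the new state
split into excursions; one of length p + 2 has weight b s(p). This is one step of a continued
fraction. -/
theorem IsMomentSeq.renewal {s : ℕ → ℝ} (h : IsMomentSeq s) {b : ℝ} (hb : 0 ≤ b) :
    ∃ r : ℕ → ℝ, IsMomentSeq r ∧ r 0 = 1 ∧ r 1 = 0 ∧
      ∀ n, r (n + 2) = b * ∑ p ∈ antidiagonal n, s p.1 * r p.2 := by
  obtain ⟨ι, _, _, B, v, hB, hs⟩ := h
  set B' : Matrix (Unit ⊕ ι) (Unit ⊕ ι) ℝ :=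
    fromBlocks 0 (Matrix.of fun _ j => √b * v j) (Matrix.of fun i _ => √b * v i) B with hB'
  set e : Unit ⊕ ι → ℝ := Sum.elim (fun _ => 1) (fun _ => 0) with he
  have hdot : ∀ w : Unit ⊕ ι → ℝ, e ⬝ᵥ w = w (Sum.inl ()) := by
    intro w
    simp [dotProduct, he]
  set r : ℕ → ℝ := fun n => (B' ^ n *ᵥ e) (Sum.inl ()) with hr
  set t : ℕ → ι → ℝ := fun n i => (B' ^ n *ᵥ e) (Sum.inr i) with ht
  have hrec : ∀ n, B' ^ (n + 1) *ᵥ e = B' *ᵥ (B' ^ n *ᵥ e) := by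
    intro n
    rw [pow_succ', mulVec_mulVec]
  have hr1 : ∀ n, r (n + 1) = √b * (v ⬝ᵥ t n) := by
    intro n
    simp only [hr, hrec]
    simp [hB', mulVec, dotProduct, ht, mul_sum, mul_assoc]
  have ht1 : ∀ n, t (n + 1) = (√b * r n) • v + B *ᵥ t n := by
    intro n
    funext i
    simp only [ht, hrec]
    simp [hB', mulVec, dotProduct, hr]
    ring
  have ht0 : t 0 = 0 := by
    funext i
    simp [ht, he]
  have hr0 : r 0 = 1 := by simp [hr, he]
  -- Decomposition by the last visit to the new state: time p.2 is spent before it, then one step √b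
  -- v into the old block and p.1 steps of B.
  have htsum : ∀ n, t (n + 1) = √b • ∑ p ∈ antidiagonal n, r p.2 • (B ^ p.1 *ᵥ v) := by
    intro n
    induction n with
    | zero => rw [ht1, ht0]; simp [smul_smul]
    | succ n ih =>
      rw [ht1, ih, Finset.Nat.sum_antidiagonal_succ, smul_add, mulVec_smul, mulVec_sum]
      congr 1
      · simp [smul_smul]
      · simp only [mulVec_smul, mulVec_mulVec, pow_succ']
  refine ⟨r, ⟨Unit ⊕ ι, inferInstance, inferInstance, B', e, ?_, fun n => (hdot (B' ^ n *ᵥ e)).symm⟩, hr0, ?_,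
    fun n => ?_⟩
  · refine IsSymm.fromBlocks (by simp [Matrix.IsSymm]) ?_ hB
    ext i j
    simp
  · rw [hr1, ht0]
    simp
  · rw [hr1, htsum, dotProduct_smul, smul_eq_mul, ← mul_assoc, Real.mul_self_sqrt hb,
      dotProduct_sum]
    congr 1
    refine sum_congr rfl fun p _ => ?_
    rw [dotProduct_smul, ← hs, smul_eq_mul, mul_comm]

/-- The even moments of a symmetric moment sequence. -/
def IsEvenMomentSeq (u : ℕ → ℝ) : Prop :=
  ∃ s, IsMomentSeq s ∧ ∀ n, s (2 * n) = u n ∧ s (2 * n + 1) = 0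

/-- Odd moments of the old sequence vanish, so in the renewal convolution of length 2n only pairs of
even indices survive; in odd length nothing does. -/
theorem IsEvenMomentSeq.renewal {v u : ℕ → ℝ} (h : IsEvenMomentSeq v) {b : ℝ} (hb : 0 ≤ b)
    (h0 : u 0 = 1) (hu : ∀ n, u (n + 1) = b * ∑ p ∈ antidiagonal n, v p.1 * u p.2) :
    IsEvenMomentSeq u := by
  obtain ⟨s, hs, hsv⟩ := h
  obtain ⟨r, hr, hr0, hr1, hrec⟩ := hs.renewal hb
  refine ⟨r, hr, fun n => ?_⟩
  induction n using Nat.strong_induction_on with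
  | _ n ih =>
    rcases n with _ | n
    · exact ⟨by rw [h0]; exact hr0, hr1⟩
    · constructor
      · rw [show 2 * (n + 1) = 2 * n + 2 by ring, hrec, hu]
        congr 1
        symm
        refine sum_of_injOn (fun p => (2 * p.1, 2 * p.2)) ?_ ?_ ?_ ?_
        · rintro ⟨a, b⟩ - ⟨c, d⟩ - h
          simp only [Prod.mk.injEq] at h ⊢
          omega
        · rintro ⟨a, b⟩ h
          simp at h ⊢
          omega
        · rintro ⟨a, b⟩ h hn
          rw [HasAntidiagonal.mem_antidiagonal] at h
          simp only at h
          rcases Nat.even_or_odd' a with ⟨c, rfl | rfl⟩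
          · exfalso
            refine hn ⟨(c, b / 2), ?_, ?_⟩
            · simp
              omega
            · simp
              omega
          · simp [(hsv c).2]
        · rintro ⟨a, b⟩ h
          have h' := HasAntidiagonal.mem_antidiagonal.1 h
          simp only at h'
          simp only [(hsv a).1, (ih b (by omega)).1]
      · rw [show 2 * (n + 1) + 1 = (2 * n + 1) + 2 by ring, hrec, sum_eq_zero, mul_zero]
        rintro ⟨a, b⟩ h
        rw [HasAntidiagonal.mem_antidiagonal] at h
        simp only at h
        rcases Nat.even_or_odd' a with ⟨c, rfl | rfl⟩
        · rcases Nat.even_or_odd' b with ⟨d, rfl | rfl⟩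
          · omega
          · simp [(ih d (by omega)).2]
        · simp [(hsv c).2]

/-! ### Log-convexity of the forest weights -/

/-- The coefficients of `1 / (1 - b X_m)`. -/
noncomputable def geomCoeff (b : ℝ) (m n : ℕ) : ℝ := coeff n ((1 - C b * heightSeries m)⁻¹)

theorem constantCoeff_C_mul_heightSeries (b : ℝ) (m : ℕ) :
    constantCoeff (C b * heightSeries m) = 0 := by
  simp [constantCoeff_heightSeries]

theorem geomCoeff_zero (b : ℝ) (m : ℕ) : geomCoeff b m 0 = 1 := by
  rw [geomCoeff, coeff_zero_eq_constantCoeff, constantCoeff_inv]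
  simp [constantCoeff_heightSeries]

theorem geomCoeff_eq_sum (b : ℝ) (m n : ℕ) :
    geomCoeff b m n = ∑ J ∈ range (n + 1), b ^ J * forestCount m J n := by
  have := inv_one_sub_pow (constantCoeff_C_mul_heightSeries b m) 1
  rw [pow_one] at this
  rw [geomCoeff, this, negBinomSeries, coeff_mk]
  refine sum_congr rfl fun J _ => ?_
  rw [mul_pow, ← map_pow, coeff_C_mul, Nat.multichoose_one, Nat.cast_one, one_mul, forestCount]

/-- From X_{m+1} = X/(1-X_m), the series G = 1/(1 - bX_{m+1}) satisfies G = 1 + bX G/(1-X_m). This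
is exactly the renewal equation, with the old sequence taken at b = 1. -/
theorem geomCoeff_succ_succ (b : ℝ) (m n : ℕ) :
    geomCoeff b (m + 1) (n + 1) =
      b * ∑ p ∈ antidiagonal n, geomCoeff 1 m p.1 * geomCoeff b (m + 1) p.2 := by
  have h0 : constantCoeff (1 - C b * heightSeries (m + 1)) ≠ 0 := by
    simp [constantCoeff_heightSeries]
  have h1 : (1 - C b * heightSeries (m + 1))⁻¹ =
      1 + C b * (X * ((1 - C 1 * heightSeries m)⁻¹ * (1 - C b * heightSeries (m + 1))⁻¹)) := by
    have h2 := PowerSeries.mul_inv_cancel _ h0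
    rw [sub_mul, one_mul, sub_eq_iff_eq_add] at h2
    conv_lhs => rw [h2]
    rw [heightSeries, map_one, one_mul]
    ring
  rw [geomCoeff, h1, map_add, coeff_C_mul, coeff_succ_X_mul, coeff_mul, coeff_one,
    if_neg (by omega), zero_add]
  rfl

theorem isEvenMomentSeq_one : IsEvenMomentSeq (geomCoeff 1 0) := by
  have h : ∀ n, geomCoeff 1 0 n = if n = 0 then 1 else 0 := by
    intro n
    simp [geomCoeff, heightSeries, coeff_one]
  refine ⟨fun n => if n = 0 then 1 else 0, ⟨Unit, inferInstance, inferInstance, 0, fun _ => 1,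
    by simp [Matrix.IsSymm], fun n => ?_⟩, fun n => ?_⟩
  · rcases n with _ | n <;> simp
  · simp [h]

theorem isEvenMomentSeq_geomCoeff_one (m : ℕ) : IsEvenMomentSeq (geomCoeff 1 m) := by
  induction m with
  | zero => exact isEvenMomentSeq_one
  | succ m ih => exact ih.renewal zero_le_one (geomCoeff_zero _ _) (geomCoeff_succ_succ 1 m)

theorem isEvenMomentSeq_geomCoeff {b : ℝ} (hb : 0 ≤ b) (m : ℕ) :
    IsEvenMomentSeq (geomCoeff b m) := by
  rcases m with _ | m
  · convert isEvenMomentSeq_one using 1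
    funext n
    simp [geomCoeff, heightSeries]
  · exact (isEvenMomentSeq_geomCoeff_one m).renewal hb (geomCoeff_zero _ _)
      (geomCoeff_succ_succ b m)

theorem geomCoeff_quadratic_nonneg {b : ℝ} (hb : 0 ≤ b) (m n : ℕ) (t : ℝ) :
    0 ≤ t ^ 2 * geomCoeff b m n + 2 * t * geomCoeff b m (n + 1) + geomCoeff b m (n + 2) := by
  obtain ⟨s, hs, hsv⟩ := isEvenMomentSeq_geomCoeff hb m
  rw [← (hsv n).1, ← (hsv (n + 1)).1, ← (hsv (n + 2)).1]
  exact hs.quadratic_nonneg n t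

/-- The generating function of the number of trees in a forest with `N` edges. -/
noncomputable def branchWeight (q b : ℝ) (N : ℕ) : ℝ :=
  ∑ J ∈ range N, b ^ J * forestWeight q (J + 1) N

/-- Exhibits the branching weights as a positive mixture over m of even moment sequences, which
preserves the quadratic inequality. For N ≥ 1 the empty forest does not contribute, so a factor b
splits off. -/
theorem hasSum_branchWeight {q : ℝ} (hq0 : 0 < q) (hq1 : q < 1) (b : ℝ) {N : ℕ} (hN : 1 ≤ N) :
    HasSum (fun m => (1 - q) * q ^ m * geomCoeff b m N) (b * branchWeight q b N) := by
  have h : HasSum (fun m => ∑ J ∈ range (N + 1), b ^ J * ((1 - q) * q ^ m * forestCount m J N))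
      (∑ J ∈ range (N + 1), b ^ J * forestWeight q J N) :=
    hasSum_sum fun J _ => (summable_forestWeight hq0 hq1 J N).hasSum.mul_left _
  convert h using 1
  · funext m
    rw [geomCoeff_eq_sum, mul_sum]
    refine sum_congr rfl fun J _ => ?_
    ring
  · rw [sum_range_succ', forestWeight_zero_left hq0 hq1, if_neg (by omega), branchWeight, mul_sum]
    simp only [pow_succ]
    rw [mul_zero, add_zero]
    refine sum_congr rfl fun J _ => ?_
    ring

theorem branchWeight_quadratic_nonneg {q : ℝ} (hq0 : 0 < q) (hq1 : q < 1) {b : ℝ} (hb : 0 < b)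
    {N : ℕ} (hN : 1 ≤ N) (t : ℝ) :
    0 ≤ t ^ 2 * branchWeight q b N + 2 * t * branchWeight q b (N + 1) +
      branchWeight q b (N + 2) := by
  have h := ((hasSum_branchWeight hq0 hq1 b hN).mul_left (t ^ 2)).add
    ((hasSum_branchWeight hq0 hq1 b (N := N + 1) (by omega)).mul_left (2 * t)) |>.add
    (hasSum_branchWeight hq0 hq1 b (N := N + 2) (by omega))
  have h2 := h.nonneg fun m => by
    have h3 := mul_nonneg (mul_nonneg (sub_nonneg.2 hq1.le) (pow_nonneg hq0.le m))
      (geomCoeff_quadratic_nonneg hb.le m N t)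
    linarith
  have h4 : 0 ≤ b * (t ^ 2 * branchWeight q b N + 2 * t * branchWeight q b (N + 1) +
      branchWeight q b (N + 2)) := by linarith
  exact nonneg_of_mul_nonneg_right h4 hb

/-- A quadratic polynomial in t that is nowhere negative has nonpositive discriminant. -/
theorem sq_branchWeight_le {q : ℝ} (hq0 : 0 < q) (hq1 : q < 1) {b : ℝ} (hb : 0 < b)
    {N : ℕ} (hN : 1 ≤ N) :
    branchWeight q b (N + 1) ^ 2 ≤ branchWeight q b N * branchWeight q b (N + 2) := by
  have h := discrim_le_zero (a := branchWeight q b N) (b := 2 * branchWeight q b (N + 1))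
    (c := branchWeight q b (N + 2)) fun t => by
      have := branchWeight_quadratic_nonneg hq0 hq1 hb hN t
      linarith
  rw [discrim] at h
  linarith

theorem branchWeight_one {q : ℝ} (hq0 : 0 < q) (hq1 : q < 1) {N : ℕ} (hN : 1 ≤ N) :
    q * branchWeight q 1 N = forestWeight q 1 (N + 1) := by
  rw [forestWeight_rec hq0 hq1 le_rfl, sum_range_succ', forestWeight_zero_left hq0 hq1,
    if_neg (by omega), branchWeight]
  simp

end PlanarTree

namespace PlanarTree

open Filter Topology Finset

/-! ### The limiting weights -/

/-- For K ≥ 1 both sides are the multinomial coefficient (K+s+i-1)! / ((K-1)! s! i!). -/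
theorem multichoose_add_mul_choose (K s i : ℕ) :
    Nat.multichoose K (s + i) * (s + i).choose s =
      Nat.multichoose K s * Nat.multichoose (K + s) i := by
  rcases K with _ | K
  · rcases s with _ | s
    · simp
    · rw [Nat.succ_add]
      simp
  · rw [Nat.multichoose_eq, Nat.multichoose_eq, Nat.multichoose_eq,
      show K + 1 + (s + i) - 1 = K + s + i by omega, show K + 1 + s - 1 = K + s by omega,
      show K + 1 + s + i - 1 = K + s + i by omega]
    have h1 := Nat.choose_mul (n := K + s + i) (k := s + i) (s := s) (by omega)
    rw [h1, show K + s + i - s = K + i by omega, show s + i - s = i by omega]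
    have h2 := Nat.choose_mul (n := K + s + i) (k := K + s) (s := s) (by omega)
    rw [show K + s + i - s = K + i by omega, show K + s - s = K by omega,
      Nat.choose_symm_of_eq_add (show K + s + i = (K + s) + i by omega),
      Nat.choose_symm_of_eq_add (show K + i = K + i by omega)] at h2
    rw [← h2, mul_comm]

/-- Writing J = s + i with s marked trees reduces the sum to the negative binomial series of
exponent K + s at 1/2, the weight of a finite tree. -/
theorem hasSum_multichoose_mul_choose (K s : ℕ) :
    HasSum (fun J => (Nat.multichoose K J : ℝ) * (J.choose s * 2 ^ s / 2 ^ J))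
      (Nat.multichoose K s * 2 ^ (K + s)) := by
  have h := (hasSum_multichoose_mul_pow (K + s) (x := 1 / 2) (by norm_num) (by norm_num)).mul_left
    (Nat.multichoose K s : ℝ)
  rw [show (1 - 1 / 2 : ℝ) = 1 / 2 by norm_num, div_pow, one_pow, one_div_one_div] at h
  rw [← hasSum_nat_add_iff' s]
  rw [sum_eq_zero fun J hJ => by
    rw [Nat.choose_eq_zero_of_lt (mem_range.1 hJ)]; simp, sub_zero]
  convert! h using 1
  funext i
  have := multichoose_add_mul_choose K s i
  rw [add_comm i s, ← mul_assoc, ← Nat.cast_mul, ← this, pow_add]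
  push_cast
  rw [one_div, inv_pow]
  field_simp

/-- The weight of a forest with `s` infinite trees. -/
noncomputable def infiniteWeight (μ : ℝ) : ℕ → ℝ
  | 0 => 0
  | s + 1 => (μ / 2) ^ s / s.factorial

/-- The limiting weight of a forest with `K` trees. -/
noncomputable def limitWeight (μ : ℝ) (K : ℕ) : ℝ :=
  ∑ s ∈ range (K + 1), K.choose s * 2 ^ s / 2 ^ K * infiniteWeight μ s

theorem infiniteWeight_nonneg {μ : ℝ} (hμ : 0 < μ) (s : ℕ) : 0 ≤ infiniteWeight μ s := by
  cases s <;> simp only [infiniteWeight] <;> positivity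

theorem limitWeight_nonneg {μ : ℝ} (hμ : 0 < μ) (K : ℕ) : 0 ≤ limitWeight μ K :=
  sum_nonneg fun s _ => mul_nonneg (by positivity) (infiniteWeight_nonneg hμ s)

theorem limitWeight_zero (μ : ℝ) : limitWeight μ 0 = 0 := by
  simp [limitWeight, infiniteWeight]

theorem limitWeight_one (μ : ℝ) : limitWeight μ 1 = 1 := by
  simp [limitWeight, infiniteWeight, sum_range_succ]

theorem limitWeight_pos {μ : ℝ} (hμ : 0 < μ) {K : ℕ} (hK : 1 ≤ K) : 0 < limitWeight μ K := by
  refine sum_pos' (fun s _ => mul_nonneg (by positivity) (infiniteWeight_nonneg hμ s))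
    ⟨1, by simp; omega, ?_⟩
  have : (0 : ℝ) < K := by exact_mod_cast hK
  simp only [infiniteWeight, Nat.choose_one_right]
  positivity

/-- Vandermonde's identity in the form of a transition between numbers of infinite trees. -/
theorem multichoose_mul_infiniteWeight (μ : ℝ) (K s : ℕ) :
    Nat.multichoose K s * 2 ^ (K + s) * infiniteWeight μ s =
      4 ^ K * ∑ i ∈ range (s + 1), K.choose i * 2 ^ i / 2 ^ K * infiniteWeight μ i *
        (μ ^ (s - i) / (s - i).factorial) := by
  rcases s with _ | t
  · simp [infiniteWeight]
  -- Here i + 1 is the old and t + 1 the new number of infinite trees. The factor C(t,i)/t! splits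
  -- into 1/i! and 1/(t-i)!, and the powers of two turn (μ/2)^(t-i) into μ^(t-i), an unnormalized
  -- Poisson weight.
  · have hv : Nat.multichoose K (t + 1) = ∑ i ∈ range (t + 1), K.choose (i + 1) * t.choose i := by
      rw [Nat.multichoose_eq, show K + (t + 1) - 1 = K + t by omega, Nat.add_choose_eq,
        Finset.Nat.sum_antidiagonal_succ, Finset.Nat.sum_antidiagonal_eq_sum_range_succ_mk]
      simp only [Nat.choose_succ_self, mul_zero, zero_add]
      refine sum_congr rfl fun i hi => ?_
      rw [Nat.choose_symm (Nat.lt_succ_iff.1 (mem_range.1 hi))]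
    rw [sum_range_succ', hv]
    simp only [infiniteWeight, mul_zero, zero_mul, add_zero]
    push_cast
    rw [sum_mul, sum_mul, mul_sum]
    refine sum_congr rfl fun i hi => ?_
    have hi' : i ≤ t := Nat.lt_succ_iff.1 (mem_range.1 hi)
    rw [Nat.cast_choose ℝ hi',
      show (4 : ℝ) ^ K = 2 ^ K * 2 ^ K by rw [← mul_pow]; norm_num]
    obtain ⟨n, rfl⟩ := Nat.exists_eq_add_of_le hi'
    simp only [Nat.add_sub_cancel_left, div_pow, pow_add, pow_one]
    have h1 : (0 : ℝ) < (i.factorial : ℝ) := by positivity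
    have h2 : (0 : ℝ) < (n.factorial : ℝ) := by positivity
    have h3 : (0 : ℝ) < ((i + n).factorial : ℝ) := by positivity
    field_simp

theorem limitWeight_eq_tsum (μ : ℝ) (K : ℕ) :
    HasSum (fun s => K.choose s * 2 ^ s / 2 ^ K * infiniteWeight μ s) (limitWeight μ K) :=
  hasSum_sum_of_ne_finset_zero fun s hs => by
    rw [Nat.choose_eq_zero_of_lt (by simpa using hs)]; simp

theorem tsum_poisson_ofReal {μ : ℝ} (hμ : 0 < μ) :
    ∑' n : ℕ, ENNReal.ofReal (μ ^ n / n.factorial) = ENNReal.ofReal (Real.exp μ) := by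
  have h := NormedSpace.expSeries_div_hasSum_exp (𝔸 := ℝ) μ
  rw [← Real.exp_eq_exp_ℝ] at h
  rw [← ENNReal.ofReal_tsum_of_nonneg (fun n => by positivity) h.summable, h.tsum_eq]

theorem ofReal_limitWeight {μ : ℝ} (hμ : 0 < μ) (K : ℕ) :
    ENNReal.ofReal (limitWeight μ K) =
      ∑' s, ENNReal.ofReal (K.choose s * 2 ^ s / 2 ^ K * infiniteWeight μ s) := by
  rw [← ENNReal.ofReal_tsum_of_nonneg
    (fun s => mul_nonneg (by positivity) (infiniteWeight_nonneg hμ s))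
    (limitWeight_eq_tsum μ K).summable, (limitWeight_eq_tsum μ K).tsum_eq]

/-- The total weight of the forests whose trees of the next generation include `s` infinite
ones. -/
theorem tsum_multichoose_mul_choose {μ : ℝ} (hμ : 0 < μ) (K s : ℕ) :
    ∑' J, (Nat.multichoose K J : ENNReal) *
        ENNReal.ofReal (J.choose s * 2 ^ s / 2 ^ J * infiniteWeight μ s) =
      ENNReal.ofReal (Nat.multichoose K s * 2 ^ (K + s) * infiniteWeight μ s) := by
  have h := (hasSum_multichoose_mul_choose K s).mul_right (infiniteWeight μ s)
  rw [← h.tsum_eq, ENNReal.ofReal_tsum_of_nonneg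
    (fun J => mul_nonneg (by positivity) (infiniteWeight_nonneg hμ s)) h.summable]
  refine tsum_congr fun J => ?_
  rw [mul_assoc (Nat.multichoose K J : ℝ), ENNReal.ofReal_mul (Nat.cast_nonneg _),
    ENNReal.ofReal_natCast]

/-- The limit form of `forestWeight_rec`: the K edges contribute 4^K and one generation contributes
e^μ. Summing over J first and applying Vandermonde leaves a Cauchy product of w(K) with the
exponential series. Extended nonnegative reals make the exchange of sums free. -/
theorem tsum_multichoose_mul_limitWeight {μ : ℝ} (hμ : 0 < μ) (K : ℕ) :
    ∑' J, (Nat.multichoose K J : ENNReal) * ENNReal.ofReal (limitWeight μ J) =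
      ENNReal.ofReal (Real.exp μ * 4 ^ K * limitWeight μ K) := by
  simp_rw [ofReal_limitWeight hμ, ← ENNReal.tsum_mul_left]
  rw [ENNReal.tsum_comm]
  simp_rw [tsum_multichoose_mul_choose hμ, multichoose_mul_infiniteWeight]
  have h1 : ∀ s, ENNReal.ofReal (4 ^ K * ∑ i ∈ range (s + 1), K.choose i * 2 ^ i / 2 ^ K *
      infiniteWeight μ i * (μ ^ (s - i) / (s - i).factorial)) =
      ENNReal.ofReal (4 ^ K) * ∑ p ∈ antidiagonal s,
        ENNReal.ofReal (K.choose p.1 * 2 ^ p.1 / 2 ^ K * infiniteWeight μ p.1) *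
          ENNReal.ofReal (μ ^ p.2 / p.2.factorial) := by
    intro s
    rw [ENNReal.ofReal_mul (by positivity), ENNReal.ofReal_sum_of_nonneg fun i _ =>
      mul_nonneg (mul_nonneg (by positivity) (infiniteWeight_nonneg hμ i)) (by positivity),
      Finset.Nat.sum_antidiagonal_eq_sum_range_succ_mk]
    congr 1
    refine sum_congr rfl fun i _ => ?_
    rw [ENNReal.ofReal_mul (mul_nonneg (by positivity) (infiniteWeight_nonneg hμ i))]
  simp_rw [h1]
  rw [ENNReal.tsum_mul_left]
  have h2 : ∑' s, ∑ p ∈ antidiagonal s,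
        ENNReal.ofReal (K.choose p.1 * 2 ^ p.1 / 2 ^ K * infiniteWeight μ p.1) *
          ENNReal.ofReal (μ ^ p.2 / p.2.factorial) =
      ENNReal.ofReal (limitWeight μ K) * ENNReal.ofReal (Real.exp μ) := by
    rw [ofReal_limitWeight hμ, ← tsum_poisson_ofReal hμ, ← ENNReal.tsum_mul_right]
    simp_rw [← ENNReal.tsum_mul_left]
    rw [← ENNReal.tsum_prod, ← (Finset.HasAntidiagonal.sigmaAntidiagonalEquivProd (A := ℕ)).tsum_eq,
      ENNReal.tsum_sigma']
    refine tsum_congr fun s => ?_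
    rw [← Finset.tsum_subtype (antidiagonal s) fun p : ℕ × ℕ =>
      ENNReal.ofReal (K.choose p.1 * 2 ^ p.1 / 2 ^ K * infiniteWeight μ p.1) *
          ENNReal.ofReal (μ ^ p.2 / p.2.factorial)]
    rfl
  rw [h2, ← ENNReal.ofReal_mul (limitWeight_nonneg hμ K), ← ENNReal.ofReal_mul (by positivity)]
  congr 1
  ring

theorem hasSum_multichoose_mul_limitWeight {μ : ℝ} (hμ : 0 < μ) (K : ℕ) :
    HasSum (fun J => (Nat.multichoose K J : ℝ) * limitWeight μ J)
      (Real.exp μ * 4 ^ K * limitWeight μ K) := by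
  have h := tsum_multichoose_mul_limitWeight hμ K
  have h0 : ∀ J, 0 ≤ (Nat.multichoose K J : ℝ) * limitWeight μ J := fun J =>
    mul_nonneg (by positivity) (limitWeight_nonneg hμ J)
  simp_rw [← ENNReal.ofReal_natCast, ← ENNReal.ofReal_mul (Nat.cast_nonneg _)] at h
  have hs : Summable fun J => (Nat.multichoose K J : ℝ) * limitWeight μ J := by
    have h2 := ENNReal.summable_toReal (h.trans_ne ENNReal.ofReal_ne_top)
    simpa only [ENNReal.toReal_ofReal (h0 _)] using h2
  rw [← ENNReal.ofReal_tsum_of_nonneg h0 hs, ENNReal.ofReal_eq_ofReal_iff (tsum_nonneg h0)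
    (mul_nonneg (by positivity) (limitWeight_nonneg hμ K))] at h
  rw [← h]
  exact hs.hasSum

end PlanarTree

namespace PlanarTree

open Filter Topology Finset

/-! ### Uniqueness of the limiting weights -/

/-- Once the earlier coefficients vanish, the k-th is bounded by the tail M b/(1-b), which tends to
0 with b. -/
theorem eq_zero_of_hasSum_pow_mul {d : ℕ → ℝ} {M : ℝ} (hM : ∀ k, |d k| ≤ M)
    (h : ∀ b : ℝ, 0 < b → b < 1 → HasSum (fun k => b ^ k * d k) 0) (k : ℕ) : d k = 0 := by
  induction k using Nat.strong_induction_on with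
  | _ k ih =>
    have hM0 : 0 ≤ M := (abs_nonneg _).trans (hM 0)
    have hb : ∀ b : ℝ, 0 < b → b < 1 → |d k| ≤ M * (b / (1 - b)) := by
      intro b h0 h1
      have h2 := (hasSum_nat_add_iff' (k + 1)).2 (h b h0 h1)
      rw [sum_range_succ, sum_eq_zero fun i hi => by rw [ih i (mem_range.1 hi), mul_zero],
        zero_add, zero_sub] at h2
      have hg := ((hasSum_geometric_of_lt_one h0.le h1).mul_left (b ^ (k + 1))).mul_right M
      have h3 : |-(b ^ k * d k)| ≤ b ^ (k + 1) * (1 - b)⁻¹ * M := by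
        rw [← h2.tsum_eq, ← hg.tsum_eq, ← Real.norm_eq_abs]
        refine tsum_of_norm_bounded hg.summable.hasSum fun i => ?_
        rw [norm_mul, Real.norm_of_nonneg (by positivity), pow_add, mul_comm (b ^ i)]
        exact mul_le_mul_of_nonneg_left (hM _) (by positivity)
      rw [abs_neg, abs_mul, abs_of_pos (by positivity)] at h3
      have h4 : b ^ k * |d k| ≤ b ^ k * (M * (b / (1 - b))) := by
        calc _ ≤ _ := h3
          _ = _ := by rw [pow_succ]; ring
      exact le_of_mul_le_mul_left h4 (by positivity)
    have hlim : Tendsto (fun b : ℝ => M * (b / (1 - b))) (𝓝[>] 0) (𝓝 (M * (0 / (1 - 0)))) := by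
      refine tendsto_nhdsWithin_of_tendsto_nhds ?_
      refine Tendsto.const_mul M (Tendsto.div tendsto_id (tendsto_const_nhds.sub tendsto_id) ?_)
      norm_num
    have h5 : |d k| ≤ M * (0 / (1 - 0)) := by
      refine ge_of_tendsto hlim ?_
      filter_upwards [Ioo_mem_nhdsGT (show (0 : ℝ) < 1 by norm_num)] with b hb'
      exact hb b hb'.1 hb'.2
    simpa using h5

/-- The sequence `F k` of weights of `k + 1` trees solves the branching equation at the growth
rate `L`. -/
structure IsBranchingSolution (q L : ℝ) (F : ℕ → ℝ) : Prop where
  q_pos : 0 < q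
  L_pos : 0 < L
  nonneg : ∀ k, 0 ≤ F k
  zero : F 0 = 1
  hasSum : ∀ k, HasSum (fun j => ((j + k + 1).choose k : ℝ) * F j) (L ^ (k + 1) / q * F k)

namespace IsBranchingSolution

variable {q L : ℝ} {F : ℕ → ℝ}

theorem div_le (h : IsBranchingSolution q L F) (k : ℕ) : q / L ^ (k + 1) ≤ F k := by
  have h1 := le_hasSum (h.hasSum k) 0 fun j _ => mul_nonneg (by positivity) (h.nonneg j)
  have hq := h.q_pos
  have hL := h.L_pos
  rw [h.zero, mul_one] at h1
  have h2 : (1 : ℝ) ≤ ((0 + k + 1).choose k : ℝ) := by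
    exact_mod_cast Nat.choose_pos (by omega)
  have h3 := h2.trans h1
  rw [div_le_iff₀ (by positivity)]
  rw [div_mul_eq_mul_div, le_div_iff₀ hq] at h3
  linarith

/-- The term j = 0 of the equation gives F_k ≥ q/L^(k+1); so for b ≥ L the terms b^k F_k stay above
q/L. -/
theorem lt_of_summable (h : IsBranchingSolution q L F) {b : ℝ}
    (hs : Summable fun k => b ^ k * F k) : b < L := by
  by_contra! hb
  have hq := h.q_pos
  have hL := h.L_pos
  have h1 : ∀ k, q / L ≤ b ^ k * F k := by
    intro k
    calc q / L = L ^ k * (q / L ^ (k + 1)) := by rw [pow_succ]; field_simp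
      _ ≤ b ^ k * F k := mul_le_mul (pow_le_pow_left₀ hL.le hb k) (h.div_le k) (by positivity)
          (pow_nonneg (hL.le.trans hb) k)
  have h2 := ge_of_tendsto' hs.tendsto_atTop_zero h1
  have : 0 < q / L := by positivity
  linarith

/-- Substitute the equation for F_k, exchange sums and use Σ_k C(j+k+1,k) x^k = (1-x)^(-j-2) at x =
b/L. Both sides are allowed to be infinite, so the identity carries summability from b to L/(L-b).
-/
theorem tsum_eq (h : IsBranchingSolution q L F) {b : ℝ} (hb0 : 0 ≤ b) (hb : b < L) :
    ∑' k, ENNReal.ofReal (b ^ k * F k) =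
      ENNReal.ofReal (q * L / (L - b) ^ 2) *
        ∑' j, ENNReal.ofReal ((L / (L - b)) ^ j * F j) := by
  have hq := h.q_pos
  have hL := h.L_pos
  have h1 : ∀ k, ENNReal.ofReal (b ^ k * F k) =
      ∑' j, ENNReal.ofReal (b ^ k * (q / L ^ (k + 1)) * (((j + k + 1).choose k : ℝ) * F j)) := by
    intro k
    have h2 := (h.hasSum k).mul_left (b ^ k * (q / L ^ (k + 1)))
    rw [← ENNReal.ofReal_tsum_of_nonneg (fun j => mul_nonneg (by positivity)
      (mul_nonneg (by positivity) (h.nonneg j))) h2.summable, h2.tsum_eq]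
    congr 1
    field_simp
  simp_rw [h1]
  rw [ENNReal.tsum_comm, ← ENNReal.tsum_mul_left]
  refine tsum_congr fun j => ?_
  have hx0 : 0 ≤ b / L := by positivity
  have hx1 : b / L < 1 := (div_lt_one hL).2 hb
  have h3 := ((hasSum_multichoose_mul_pow (j + 2) hx0 hx1).mul_left (q / L)).mul_right (F j)
  have hLb : 0 < L - b := sub_pos.2 hb
  have h4 : ∀ k, b ^ k * (q / L ^ (k + 1)) * (((j + k + 1).choose k : ℝ) * F j) =
      q / L * ((Nat.multichoose (j + 2) k : ℝ) * (b / L) ^ k) * F j := by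
    intro k
    rw [Nat.multichoose_eq, show j + 2 + k - 1 = j + k + 1 by omega, pow_succ, div_pow]
    field_simp
  simp_rw [h4]
  rw [← ENNReal.ofReal_tsum_of_nonneg (fun k => mul_nonneg (mul_nonneg (by positivity)
    (mul_nonneg (by positivity) (pow_nonneg hx0 _))) (h.nonneg j)) h3.summable, h3.tsum_eq,
    ← ENNReal.ofReal_mul (by positivity)]
  congr 1
  rw [show 1 - b / L = (L - b) / L by field_simp, div_pow, div_pow, pow_add, pow_add]
  field_simp

theorem summable_iff (h : IsBranchingSolution q L F) {b : ℝ} (hb0 : 0 ≤ b) :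
    (Summable fun k => b ^ k * F k) ↔ ∑' k, ENNReal.ofReal (b ^ k * F k) ≠ ⊤ := by
  have h0 : ∀ k, 0 ≤ b ^ k * F k := fun k => mul_nonneg (pow_nonneg hb0 k) (h.nonneg k)
  refine ⟨fun hs => ?_, fun hs => ?_⟩
  · rw [← ENNReal.ofReal_tsum_of_nonneg h0 hs]
    exact ENNReal.ofReal_ne_top
  · simpa only [ENNReal.toReal_ofReal (h0 _)] using ENNReal.summable_toReal hs

theorem summable_step (h : IsBranchingSolution q L F) {b : ℝ} (hb0 : 0 ≤ b)
    (hs : Summable fun k => b ^ k * F k) : Summable fun k => (L / (L - b)) ^ k * F k := by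
  have hb := h.lt_of_summable hs
  have hq := h.q_pos
  have hL := h.L_pos
  have hLb : 0 < L - b := sub_pos.2 hb
  rw [h.summable_iff (by positivity)]
  rw [h.summable_iff hb0, h.tsum_eq hb0 hb] at hs
  intro htop
  rw [htop, ENNReal.mul_top (by rw [Ne, ENNReal.ofReal_eq_zero, not_le]; positivity)] at hs
  exact hs rfl

theorem summable_zero (F : ℕ → ℝ) : Summable fun k => (0 : ℝ) ^ k * F k :=
  summable_of_ne_finset_zero (s := {0}) fun k hk => by
    rw [zero_pow (by simpa using hk), zero_mul]

/-- For 0 < L < 4 the map b ↦ L/(L-b) has no real fixed point and, on 0 ≤ b < L, advances by at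
least 1 - L/4. The orbit of 0 consists of points of summability, hence stays below L, yet it must
pass L. -/
theorem four_le (h : IsBranchingSolution q L F) : 4 ≤ L := by
  by_contra! hL4
  have hL := h.L_pos
  have key : ∀ n : ℕ, ∃ b : ℝ, 0 ≤ b ∧ (Summable fun k => b ^ k * F k) ∧ n * (1 - L / 4) ≤ b := by
    intro n
    induction n with
    | zero => exact ⟨0, le_rfl, summable_zero F, by simp⟩
    | succ n ih =>
      obtain ⟨b, hb0, hs, hn⟩ := ih
      have hb := h.lt_of_summable hs
      have hLb : 0 < L - b := sub_pos.2 hb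
      refine ⟨L / (L - b), by positivity, h.summable_step hb0 hs, ?_⟩
      have h1 : b + (1 - L / 4) ≤ L / (L - b) := by
        rw [le_div_iff₀ hLb]
        nlinarith [sq_nonneg (2 * b - L)]
      push_cast
      linarith
  obtain ⟨n, hn⟩ := exists_nat_gt (L / (1 - L / 4))
  obtain ⟨b, -, hs, hb⟩ := key n
  have h1 := h.lt_of_summable hs
  rw [div_lt_iff₀ (by linarith)] at hn
  linarith

/-- For L = 4 the orbit of 0 is 2n/(n+1), increasing to the parabolic fixed point 2. -/
theorem summable_of_lt_two (h : IsBranchingSolution q 4 F) {b : ℝ} (hb : |b| < 2) :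
    Summable fun k => b ^ k * F k := by
  have key : ∀ n : ℕ, Summable fun k => (2 * n / (n + 1) : ℝ) ^ k * F k := by
    intro n
    induction n with
    | zero => simpa using summable_zero F
    | succ n ih =>
      have := h.summable_step (by positivity) ih
      have h2 : (4 : ℝ) / (4 - 2 * n / (n + 1)) = 2 * (n + 1 : ℕ) / ((n + 1 : ℕ) + 1) := by
        push_cast
        have h3 : (n : ℝ) + 1 ≠ 0 := by positivity
        have h4 : (n : ℝ) + 1 + 1 ≠ 0 := by positivity
        rw [show (4 : ℝ) - 2 * n / (n + 1) = 2 * (n + 1 + 1) / (n + 1) by field_simp; ring]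
        field_simp
        ring
      rwa [h2] at this
  obtain ⟨n, hn⟩ := exists_nat_gt (2 / (2 - |b|))
  refine Summable.of_norm_bounded (key n) fun k => ?_
  rw [norm_mul, norm_pow, Real.norm_of_nonneg (h.nonneg k), Real.norm_eq_abs]
  refine mul_le_mul_of_nonneg_right (pow_le_pow_left₀ (abs_nonneg _) ?_ k) (h.nonneg k)
  rw [div_lt_iff₀ (by linarith)] at hn
  rw [le_div_iff₀ (by positivity)]
  nlinarith

/-- Cauchy–Schwarz for the weights F_k, since z^k ≤ √(x^k) √(y^k). -/
theorem sq_tsum_le (h : IsBranchingSolution q 4 F) {x y z : ℝ} (hx0 : 0 ≤ x) (hx : x < 2)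
    (hy0 : 0 ≤ y) (hy : y < 2) (hz0 : 0 ≤ z) (hz : z ^ 2 ≤ x * y) :
    (∑' k, z ^ k * F k) ^ 2 ≤ (∑' k, x ^ k * F k) * ∑' k, y ^ k * F k := by
  have hxs := h.summable_of_lt_two (b := x) (by rwa [abs_of_nonneg hx0])
  have hys := h.summable_of_lt_two (b := y) (by rwa [abs_of_nonneg hy0])
  have hz2 : |z| < 2 := by
    rw [abs_of_nonneg hz0]
    nlinarith
  have hzs := h.summable_of_lt_two hz2
  have hd := discrim_le_zero (a := ∑' k, x ^ k * F k) (b := -2 * ∑' k, z ^ k * F k)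
    (c := ∑' k, y ^ k * F k) fun t => by
      rcases lt_or_ge t 0 with ht | ht
      · have h1 : 0 ≤ ∑' k, x ^ k * F k :=
          tsum_nonneg fun k => mul_nonneg (pow_nonneg hx0 k) (h.nonneg k)
        have h2 : 0 ≤ ∑' k, y ^ k * F k :=
          tsum_nonneg fun k => mul_nonneg (pow_nonneg hy0 k) (h.nonneg k)
        have h3 : 0 ≤ ∑' k, z ^ k * F k :=
          tsum_nonneg fun k => mul_nonneg (pow_nonneg hz0 k) (h.nonneg k)
        have h4 : 0 ≤ -t * ∑' k, z ^ k * F k := mul_nonneg (by linarith) h3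
        nlinarith [mul_nonneg (mul_self_nonneg t) h1]
      · have hs := ((hxs.hasSum.mul_left (t * t)).add (hzs.hasSum.mul_left (-2 * t))).add hys.hasSum
        have h1 := hs.nonneg fun k => by
          have h2 : z ^ k ≤ √(x ^ k) * √(y ^ k) := by
            rw [← Real.sqrt_mul (pow_nonneg hx0 k)]
            refine Real.le_sqrt_of_sq_le ?_
            rw [← mul_pow, ← pow_mul, mul_comm k 2, pow_mul]
            exact pow_le_pow_left₀ (sq_nonneg z) hz k
          have h3 : 0 ≤ t * t * x ^ k + -2 * t * z ^ k + y ^ k := by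
            have h4 := Real.mul_self_sqrt (pow_nonneg hx0 k)
            have h5 := Real.mul_self_sqrt (pow_nonneg hy0 k)
            nlinarith [sq_nonneg (t * √(x ^ k) - √(y ^ k)), mul_le_mul_of_nonneg_left h2 ht]
          have := mul_nonneg h3 (h.nonneg k)
          linarith
        linarith
  rw [discrim] at hd
  linarith

theorem continuousOn_tsum (h : IsBranchingSolution q 4 F) :
    ContinuousOn (fun b : ℝ => ∑' k, b ^ k * F k) (Set.Ioo (-2) 2) := by
  intro b hb
  have hb' : |b| < 2 := abs_lt.2 hb
  obtain ⟨ρ, hρ, hρ2⟩ := exists_between hb'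
  have hρ0 : 0 ≤ ρ := (abs_nonneg b).trans hρ.le
  have hc : ContinuousOn (fun b : ℝ => ∑' k, b ^ k * F k) (Set.Ioo (-ρ) ρ) := by
    refine _root_.continuousOn_tsum (u := fun k => ρ ^ k * F k) (fun k => by fun_prop)
      (h.summable_of_lt_two (by rwa [abs_of_nonneg hρ0])) fun k x hx => ?_
    rw [norm_mul, norm_pow, Real.norm_of_nonneg (h.nonneg k), Real.norm_eq_abs]
    exact mul_le_mul_of_nonneg_right (pow_le_pow_left₀ (abs_nonneg _) (abs_lt.2 hx).le k)
      (h.nonneg k)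
  exact (hc.continuousAt (Ioo_mem_nhds (abs_lt.1 hρ).1 (abs_lt.1 hρ).2)).continuousWithinAt

/-! ### The periodic factor and its constancy -/

/-- The generating function in the coordinate in which the branching step is a translation,
divided by the solution of the resulting functional equation. -/
noncomputable def profile (q : ℝ) (F : ℕ → ℝ) (c : ℝ) : ℝ :=
  (∑' k, (2 * c / (1 + c)) ^ k * F k) / (1 + c) ^ 2 * q ^ c

theorem coord_lt {c : ℝ} (hc : 0 ≤ c) : 2 * c / (1 + c) < 2 := by
  rw [div_lt_iff₀ (by positivity)]
  linarith

theorem coord_nonneg {c : ℝ} (hc : 0 ≤ c) : 0 ≤ 2 * c / (1 + c) := by positivity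

theorem profile_nonneg (h : IsBranchingSolution q 4 F) {c : ℝ} (hc : 0 ≤ c) :
    0 ≤ profile q F c :=
  mul_nonneg (div_nonneg (tsum_nonneg fun k => mul_nonneg (pow_nonneg (coord_nonneg hc) k)
    (h.nonneg k)) (by positivity)) (Real.rpow_nonneg h.q_pos.le c)

theorem profile_zero (h : IsBranchingSolution q 4 F) : profile q F 0 = 1 := by
  rw [profile, tsum_eq_single 0 fun k hk => by simp [hk]]
  simp [h.zero]

/-- With b = 2c/(1+c) the map b ↦ 4/(4-b) is c ↦ c+1, and the prefactor 4q/(4-b)² becomes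
q(1+c)²/(2+c)², which the normalization absorbs. -/
theorem profile_add_one (h : IsBranchingSolution q 4 F) {c : ℝ} (hc : 0 ≤ c) :
    profile q F (c + 1) = profile q F c := by
  have hq := h.q_pos
  have hb0 := coord_nonneg hc
  have hb2 := coord_lt hc
  have h1 := h.tsum_eq hb0 (by linarith)
  have h2 : (4 : ℝ) / (4 - 2 * c / (1 + c)) = 2 * (c + 1) / (1 + (c + 1)) := by
    rw [show (4 : ℝ) - 2 * c / (1 + c) = 2 * (1 + (c + 1)) / (1 + c) by field_simp; ring]
    field_simp
    ring
  have hc1 : 0 ≤ c + 1 := by linarith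
  rw [h2, ← ENNReal.ofReal_tsum_of_nonneg, ← ENNReal.ofReal_tsum_of_nonneg,
    ← ENNReal.ofReal_mul (by positivity), ENNReal.ofReal_eq_ofReal_iff] at h1
  · rw [profile, profile, h1, Real.rpow_add hq, Real.rpow_one,
      show (4 : ℝ) - 2 * c / (1 + c) = 2 * (1 + (c + 1)) / (1 + c) by field_simp; ring]
    field_simp
    ring
  · exact tsum_nonneg fun k => mul_nonneg (pow_nonneg hb0 k) (h.nonneg k)
  · exact mul_nonneg (by positivity) (tsum_nonneg fun k =>
      mul_nonneg (pow_nonneg (coord_nonneg hc1) k) (h.nonneg k))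
  · exact fun k => mul_nonneg (pow_nonneg (coord_nonneg hc1) k) (h.nonneg k)
  · exact h.summable_of_lt_two (by rw [abs_of_nonneg (coord_nonneg hc1)]; exact coord_lt hc1)
  · exact fun k => mul_nonneg (pow_nonneg hb0 k) (h.nonneg k)
  · exact h.summable_of_lt_two (by rwa [abs_of_nonneg hb0])

theorem profile_add_nat (h : IsBranchingSolution q 4 F) {c : ℝ} (hc : 0 ≤ c) (n : ℕ) :
    profile q F (c + n) = profile q F c := by
  induction n with
  | zero => simp
  | succ n ih =>
    push_cast
    rw [← add_assoc, h.profile_add_one (by positivity), ih]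

theorem continuousAt_profile (h : IsBranchingSolution q 4 F) {c : ℝ} (hc : 0 ≤ c) :
    ContinuousAt (profile q F) c := by
  have hc1 : 1 + c ≠ 0 := by positivity
  have h1 : ContinuousAt (fun c : ℝ => 2 * c / (1 + c)) c := by fun_prop (disch := assumption)
  have h2 : ContinuousAt (fun b : ℝ => ∑' k, b ^ k * F k) (2 * c / (1 + c)) :=
    h.continuousOn_tsum.continuousAt (Ioo_mem_nhds (by linarith [coord_nonneg hc]) (coord_lt hc))
  have h3 : ContinuousAt (fun c : ℝ => q ^ c) c :=
    (Real.continuousAt_const_rpow h.q_pos.ne')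
  exact ((h2.comp (f := fun c : ℝ => 2 * c / (1 + c)) h1).div (by fun_prop) (by positivity)).mul h3

theorem tsum_eq_profile (h : IsBranchingSolution q 4 F) {c : ℝ} (hc : 0 ≤ c) :
    ∑' k, (2 * c / (1 + c)) ^ k * F k = profile q F c * (1 + c) ^ 2 / q ^ c := by
  have := Real.rpow_pos_of_pos h.q_pos c
  rw [profile]
  field_simp

/-- Cauchy–Schwarz is convexity in log b, whereas convexity in c is wanted. The product of the
values of b at m ± d can fall below the square of its value at m; for d ≤ 1, moving the centre back
by 2/m repairs this. The cost is two factors that tend to 1 as m → ∞. -/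
theorem sq_profile_le_aux (h : IsBranchingSolution q 4 F) {m d : ℝ} (hm : 2 ≤ m) (hd0 : 0 ≤ d)
    (hd : d ≤ 1) :
    profile q F (m - 2 / m) ^ 2 * ((1 + m - 2 / m) / (1 + m)) ^ 4 * q ^ (4 / m) ≤
      profile q F (m - d) * profile q F (m + d) := by
  have hq := h.q_pos
  have hη : 2 / m ≤ 1 := by rw [div_le_one (by linarith)]; exact hm
  have hη0 : 0 < 2 / m := by positivity
  have hx : 0 ≤ m - d := by linarith
  have hy : 0 ≤ m + d := by linarith
  have hz : 0 ≤ m - 2 / m := by linarith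
  have hmη : m * (2 / m) = 2 := by field_simp
  set η := 2 / m with hηdef
  have hle : (2 * (m - η) / (1 + (m - η))) ^ 2 ≤
      (2 * (m - d) / (1 + (m - d))) * (2 * (m + d) / (1 + (m + d))) := by
    rw [div_pow, div_mul_div_comm, div_le_div_iff₀ (by positivity) (by positivity)]
    have hpos : 0 ≤ 2 * m * (1 - d ^ 2) := by
      have : 0 ≤ 1 - d ^ 2 := by nlinarith
      positivity
    have e1 : 0 ≤ (1 - d ^ 2) * ((1 + (m - η)) ^ 2 - (m - η) ^ 2) :=
      mul_nonneg (by nlinarith) (by nlinarith)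
    have e2 : (m - η) ^ 2 * (m ^ 2 + 2 * m) ≤ (m ^ 2 - 1) * (1 + (m - η)) ^ 2 := by
      have e3 : (m ^ 2 - 1) * (1 + (m - η)) ^ 2 - (m - η) ^ 2 * (m ^ 2 + 2 * m) =
          -2 * m - 1 + η * (2 * m ^ 2 + 2 * m + 2) - η ^ 2 * (2 * m + 1) := by ring
      have e4 : η * (2 * m ^ 2 + 2 * m + 2) = 4 * m + 4 + 2 * η := by
        linear_combination (2 * m + 2) * hmη
      have e5 : η ^ 2 * (2 * m + 1) = 4 * η + η ^ 2 := by
        linear_combination (2 * η) * hmη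
      nlinarith
    nlinarith
  have hkey := h.sq_tsum_le (coord_nonneg hx) (coord_lt hx) (coord_nonneg hy) (coord_lt hy)
    (coord_nonneg hz) hle
  rw [h.tsum_eq_profile hx, h.tsum_eq_profile hy, h.tsum_eq_profile hz] at hkey
  have hP : 0 ≤ profile q F (m - d) * profile q F (m + d) :=
    mul_nonneg (h.profile_nonneg hx) (h.profile_nonneg hy)
  have hq1 : q ^ (m - d) * q ^ (m + d) = q ^ (4 / m) * (q ^ (m - η)) ^ 2 := by
    rw [← Real.rpow_add hq, ← Real.rpow_natCast, ← Real.rpow_mul hq.le, ← Real.rpow_add hq]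
    congr 1
    rw [hηdef]
    push_cast
    ring
  have hA : 0 < q ^ (m - d) := Real.rpow_pos_of_pos hq _
  have hB : 0 < q ^ (m + d) := Real.rpow_pos_of_pos hq _
  have hC : 0 < q ^ (m - η) := Real.rpow_pos_of_pos hq _
  have hD : 0 < q ^ (4 / m) := Real.rpow_pos_of_pos hq _
  rw [div_pow, div_mul_div_comm, div_le_div_iff₀ (by positivity) (by positivity), hq1] at hkey
  have h6 : ((1 + (m - d)) * (1 + (m + d))) ^ 2 ≤ (1 + m) ^ 4 := by
    have : (1 + (m - d)) * (1 + (m + d)) ≤ (1 + m) ^ 2 := by nlinarith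
    calc _ ≤ ((1 + m) ^ 2) ^ 2 := pow_le_pow_left₀ (by positivity) this 2
      _ = _ := by ring
  have h7 : profile q F (m - η) ^ 2 * (1 + (m - η)) ^ 4 * q ^ (4 / m) ≤
      profile q F (m - d) * profile q F (m + d) * (1 + m) ^ 4 := by
    have h8 : (profile q F (m - η) ^ 2 * (1 + (m - η)) ^ 4 * q ^ (4 / m)) * (q ^ (m - η)) ^ 2 ≤
        (profile q F (m - d) * profile q F (m + d) * ((1 + (m - d)) * (1 + (m + d))) ^ 2) *
          (q ^ (m - η)) ^ 2 := by
      calc _ = (profile q F (m - η) * (1 + (m - η)) ^ 2) ^ 2 *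
            (q ^ (4 / m) * (q ^ (m - η)) ^ 2) := by ring
        _ ≤ _ := hkey
        _ = _ := by ring
    exact (le_of_mul_le_mul_right h8 (by positivity)).trans (mul_le_mul_of_nonneg_left h6 hP)
  rw [div_pow, ← mul_div_assoc, div_mul_eq_mul_div, div_le_iff₀ (by positivity)]
  rwa [show 1 + m - η = 1 + (m - η) by ring]

/-- By periodicity the approximate inequality may be used at c + n; as n → ∞ its errors disappear.
-/
theorem sq_profile_le (h : IsBranchingSolution q 4 F) {c d : ℝ} (hc : 1 ≤ c) (hd0 : 0 ≤ d)
    (hd : d ≤ 1) : profile q F c ^ 2 ≤ profile q F (c - d) * profile q F (c + d) := by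
  have hq := h.q_pos
  have hm : Tendsto (fun n : ℕ => c + n) atTop atTop :=
    tendsto_atTop_add_const_left _ _ tendsto_natCast_atTop_atTop
  have hη : Tendsto (fun n : ℕ => 2 / (c + n)) atTop (𝓝 0) := hm.const_div_atTop 2
  have hη4 : Tendsto (fun n : ℕ => 4 / (c + n)) atTop (𝓝 0) := hm.const_div_atTop 4
  have h1 : Tendsto (fun n : ℕ => profile q F (c - 2 / (c + n))) atTop (𝓝 (profile q F c)) := by
    refine (h.continuousAt_profile (by linarith)).tendsto.comp ?_
    simpa using (tendsto_const_nhds (x := c)).sub hη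
  have h2 : Tendsto (fun n : ℕ => (1 + (c + n) - 2 / (c + n)) / (1 + (c + n))) atTop (𝓝 1) := by
    have h3 : Tendsto (fun n : ℕ => 1 - 2 / (c + n) * (1 / (1 + (c + n)))) atTop
        (𝓝 (1 - 0 * 0)) :=
      tendsto_const_nhds.sub (hη.mul
        ((tendsto_atTop_add_const_left _ _ hm).const_div_atTop 1))
    rw [mul_zero, sub_zero] at h3
    refine h3.congr fun n => ?_
    have : (0 : ℝ) < 1 + (c + n) := by positivity
    field_simp
  have h3 : Tendsto (fun n : ℕ => q ^ (4 / (c + n))) atTop (𝓝 (q ^ (0 : ℝ))) :=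
    (Real.continuousAt_const_rpow hq.ne').tendsto.comp hη4
  have h4 := ((h1.pow 2).mul (h2.pow 4)).mul h3
  rw [Real.rpow_zero, one_pow, mul_one, mul_one] at h4
  refine le_of_tendsto h4 ?_
  filter_upwards [eventually_ge_atTop 1] with n hn
  have hn' : (1 : ℝ) ≤ n := by exact_mod_cast hn
  have h5 := h.sq_profile_le_aux (m := c + n) (by linarith) hd0 hd
  have hη1 : 2 / (c + n) ≤ 1 := by rw [div_le_one (by linarith)]; linarith
  rwa [show c + n - 2 / (c + n) = (c - 2 / (c + n)) + n by ring,
    h.profile_add_nat (by linarith), show c + n - d = (c - d) + n by ring,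
    h.profile_add_nat (by linarith), show c + n + d = (c + d) + n by ring,
    h.profile_add_nat (by linarith)] at h5

/-- At a maximum, profile(c)² ≤ profile(c-d) profile(c+d) forces both neighbours to attain it.
Periodicity spreads the maximum everywhere, and the value at 0 is 1. The maximum is used at x + 1 so
that c - d stays nonnegative. -/
theorem profile_eq_one (h : IsBranchingSolution q 4 F) {c : ℝ} (hc : 0 ≤ c) :
    profile q F c = 1 := by
  have hcont : ContinuousOn (profile q F) (Set.Icc 0 1) := fun x hx =>
    (h.continuousAt_profile hx.1).continuousWithinAt
  obtain ⟨x, hx, hmax⟩ := isCompact_Icc.exists_isMaxOn (Set.nonempty_Icc.2 zero_le_one) hcont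
  have hle : ∀ y, 0 ≤ y → profile q F y ≤ profile q F x := by
    intro y hy
    have h1 := h.profile_add_nat (c := y - ⌊y⌋₊) (sub_nonneg.2 (Nat.floor_le hy)) ⌊y⌋₊
    rw [sub_add_cancel] at h1
    rw [h1]
    exact hmax ⟨sub_nonneg.2 (Nat.floor_le hy), by linarith [Nat.lt_floor_add_one y]⟩
  have hpos : 0 < profile q F x := by
    have := hle 0 le_rfl
    rw [h.profile_zero] at this
    linarith
  have heq : ∀ d, 0 ≤ d → d ≤ 1 → profile q F (x + 1 + d) = profile q F x := by
    intro d hd0 hd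
    have h1 := h.sq_profile_le (c := x + 1) (by linarith [hx.1]) hd0 hd
    rw [h.profile_add_one hx.1] at h1
    have h2 := hle (x + 1 - d) (by linarith [hx.1])
    have h3 := hle (x + 1 + d) (by linarith [hx.1])
    have h4 := h.profile_nonneg (c := x + 1 + d) (by linarith [hx.1])
    nlinarith
  have hall : ∀ y, x + 1 ≤ y → profile q F y = profile q F x := by
    intro y hy
    have hy0 : 0 ≤ y - (x + 1) := by linarith
    have h1 := h.profile_add_nat (c := y - ⌊y - (x + 1)⌋₊)
      (by linarith [Nat.floor_le hy0, hx.1]) ⌊y - (x + 1)⌋₊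
    rw [sub_add_cancel] at h1
    have h2 := heq (y - ⌊y - (x + 1)⌋₊ - (x + 1)) (by linarith [Nat.floor_le hy0])
      (by linarith [Nat.lt_floor_add_one (y - (x + 1))])
    rw [h1, ← h2]
    congr 1
    ring
  have h0 := h.profile_add_nat le_rfl 2
  have h1 := h.profile_add_nat hc 2
  rw [hall _ (by push_cast; linarith [hx.2]), h.profile_zero] at h0
  rw [hall _ (by push_cast; linarith [hx.2]), h0] at h1
  exact h1.symm

theorem bddAbove (h : IsBranchingSolution q 4 F) : ∃ M, ∀ k, F k ≤ M := by
  have hs := h.summable_of_lt_two (b := 1) (by norm_num)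
  simp only [one_pow, one_mul] at hs
  exact ⟨_, fun k => hs.le_tsum k fun j _ => h.nonneg j⟩

theorem unique {F' : ℕ → ℝ} (h : IsBranchingSolution q 4 F) (h' : IsBranchingSolution q 4 F') :
    F = F' := by
  funext k
  obtain ⟨M, hM⟩ := h.bddAbove
  obtain ⟨M', hM'⟩ := h'.bddAbove
  refine sub_eq_zero.1 (eq_zero_of_hasSum_pow_mul (d := fun k => F k - F' k) (M := M + M')
    (fun k => ?_) (fun b hb0 hb1 => ?_) k)
  · rw [abs_le]
    constructor <;> linarith [h.nonneg k, h'.nonneg k, hM k, hM' k]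
  · have hb : |b| < 2 := by rw [abs_of_pos hb0]; linarith
    have h1 := (h.summable_of_lt_two hb).hasSum.sub (h'.summable_of_lt_two hb).hasSum
    -- c = b/(2-b) inverts b = 2c/(1+c).
    have hc : 0 ≤ b / (2 - b) := div_nonneg hb0.le (by linarith)
    have hbc : 2 * (b / (2 - b)) / (1 + b / (2 - b)) = b := by
      have : 2 - b ≠ 0 := by linarith
      field_simp
      ring
    have h2 := h.tsum_eq_profile hc
    have h3 := h'.tsum_eq_profile hc
    rw [h.profile_eq_one hc, hbc] at h2
    rw [h'.profile_eq_one hc, hbc] at h3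
    rw [h2, h3, sub_self] at h1
    simpa only [mul_sub] using h1

end IsBranchingSolution

theorem isBranchingSolution_limitWeight {μ : ℝ} (hμ : 0 < μ) :
    IsBranchingSolution (Real.exp (-μ)) 4 fun k => limitWeight μ (k + 1) where
  q_pos := Real.exp_pos _
  L_pos := by norm_num
  nonneg k := limitWeight_nonneg hμ _
  zero := limitWeight_one μ
  hasSum k := by
    have h := hasSum_multichoose_mul_limitWeight hμ (k + 1)
    rw [← hasSum_nat_add_iff' 1, sum_range_one, limitWeight_zero, mul_zero, sub_zero] at h
    convert! h using 1
    · funext j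
      rw [multichoose_succ_left, show j + 1 + k = j + k + 1 by ring]
    · rw [Real.exp_neg, div_inv_eq_mul]
      ring

end PlanarTree

namespace PlanarTree

open Filter Topology Finset

/-! ### Ratio limits of the weighted forest counts -/

theorem le_of_geometric_growth {x : ℕ → ℝ} (hx : ∀ n, 0 < x n) {r B M : ℝ} (hr : 0 < r)
    (hB : 0 < B) {n₀ : ℕ} (hg : ∀ n ≥ n₀, r * x n ≤ x (n + 1)) (hM : ∀ n, x n ≤ M * B ^ n) :
    r ≤ B := by
  by_contra! hlt
  have h1 : ∀ k, r ^ k * x n₀ ≤ x (n₀ + k) := by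
    intro k
    induction k with
    | zero => simp
    | succ k ih =>
      calc r ^ (k + 1) * x n₀ = r * (r ^ k * x n₀) := by ring
        _ ≤ r * x (n₀ + k) := mul_le_mul_of_nonneg_left ih hr.le
        _ ≤ _ := hg _ (by omega)
  have h2 : ∀ k, (r / B) ^ k ≤ M * B ^ n₀ / x n₀ := by
    intro k
    rw [div_pow, div_le_div_iff₀ (by positivity) (hx _)]
    calc _ ≤ _ := h1 k
      _ ≤ _ := hM _
      _ = _ := by rw [pow_add]; ring
  obtain ⟨k, hk⟩ := ((tendsto_pow_atTop_atTop_of_one_lt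
    ((one_lt_div hB).2 hlt)).eventually (eventually_gt_atTop (M * B ^ n₀ / x n₀))).exists
  exact absurd (h2 k) (not_le.2 hk)

/-- Log-convexity makes the ratios increase, and the exponential bound keeps them at most 4. -/
theorem exists_ratio_limit {x : ℕ → ℝ} (hx : ∀ n, 0 < x n)
    (hlc : ∀ n, x (n + 1) ^ 2 ≤ x n * x (n + 2)) {M : ℝ} (hM : ∀ n, x n ≤ M * 4 ^ n) :
    ∃ L : ℝ, 0 < L ∧ L ≤ 4 ∧ Tendsto (fun n => x (n + 1) / x n) atTop (𝓝 L) ∧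
      ∀ n, x (n + 1) ≤ L * x n := by
  have hmono : Monotone fun n => x (n + 1) / x n := by
    refine monotone_nat_of_le_succ fun n => ?_
    rw [div_le_div_iff₀ (hx _) (hx _), ← sq, mul_comm]
    exact hlc n
  have h4 : ∀ n, x (n + 1) / x n ≤ 4 := fun n =>
    le_of_geometric_growth hx (div_pos (hx _) (hx _)) (by norm_num) (n₀ := n)
      (fun k hk => by
        have := hmono hk
        rwa [le_div_iff₀ (hx _)] at this) hM
  have hbdd : BddAbove (Set.range fun n => x (n + 1) / x n) :=
    ⟨4, by rintro _ ⟨n, rfl⟩; exact h4 n⟩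
  refine ⟨⨆ n, x (n + 1) / x n, ?_, ciSup_le h4, tendsto_atTop_ciSup hmono hbdd, fun n => ?_⟩
  · exact (div_pos (hx 1) (hx 0)).trans_le (le_ciSup hbdd 0)
  · rw [← div_le_iff₀ (hx n)]
    exact le_ciSup hbdd n

theorem le_of_ratio_limit {x : ℕ → ℝ} (hx : ∀ n, 0 < x n) {A B M : ℝ} (hB : 0 < B)
    (hA : Tendsto (fun n => x (n + 1) / x n) atTop (𝓝 A)) (hM : ∀ n, x n ≤ M * B ^ n) :
    A ≤ B := by
  by_contra! hlt
  obtain ⟨r, hr, hrA⟩ := exists_between hlt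
  obtain ⟨n₀, hn₀⟩ := eventually_atTop.1 (hA.eventually (eventually_gt_nhds hrA))
  refine absurd (le_of_geometric_growth hx (hB.trans hr) hB (n₀ := n₀) (fun n hn => ?_) hM)
    (not_le.2 hr)
  have := (hn₀ n hn).le
  rwa [le_div_iff₀ (hx _)] at this

theorem le_mul_pow_of_ratio_le {x : ℕ → ℝ} {L : ℝ} (hL : 0 < L)
    (h : ∀ n, x (n + 1) ≤ L * x n) (n : ℕ) : x n ≤ x 0 * L ^ n := by
  induction n with
  | zero => simp
  | succ n ih =>
    calc _ ≤ _ := h n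
      _ ≤ L * (x 0 * L ^ n) := mul_le_mul_of_nonneg_left ih hL.le
      _ = _ := by ring

/-- Joining the K trees on top of one new edge gives a tree with one more edge. -/
theorem mul_sum_forestWeight_le {q : ℝ} (hq0 : 0 < q) (hq1 : q < 1) (K N : ℕ) :
    q * forestWeight q K N ≤ forestWeight q 1 (N + 1) := by
  rw [forestWeight_rec hq0 hq1 le_rfl]
  refine mul_le_mul_of_nonneg_left ?_ hq0.le
  rcases lt_or_ge N K with h | h
  · rw [forestWeight_of_lt _ h]
    exact sum_nonneg fun J _ => mul_nonneg (by positivity) (forestWeight_nonneg hq0 hq1 _ _)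
  · refine le_trans ?_ (single_le_sum (f := fun J => (Nat.multichoose 1 J : ℝ) *
      forestWeight q J N) (fun J _ => mul_nonneg (by positivity)
        (forestWeight_nonneg hq0 hq1 _ _)) (mem_range.2 (Nat.lt_succ_of_le h)))
    simp

theorem forestWeight_one_pos {q : ℝ} (hq0 : 0 < q) (hq1 : q < 1) {N : ℕ} (hN : 1 ≤ N) :
    0 < forestWeight q 1 N := by
  induction N, hN using Nat.le_induction with
  | base =>
    have := forestWeight_rec hq0 hq1 le_rfl (K := 1) 0
    rw [zero_add] at this
    rw [this]
    simpa [forestWeight_zero_left hq0 hq1] using hq0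
  | succ N _ ih => exact (mul_pos hq0 ih).trans_le (mul_sum_forestWeight_le hq0 hq1 1 N)

theorem forestWeight_one_le_branchWeight {q : ℝ} (hq0 : 0 < q) (hq1 : q < 1) {b : ℝ} (hb : 0 ≤ b)
    {N : ℕ} (hN : 1 ≤ N) : forestWeight q 1 N ≤ branchWeight q b N := by
  have := single_le_sum (f := fun J => b ^ J * forestWeight q (J + 1) N) (fun J _ =>
    mul_nonneg (pow_nonneg hb J) (forestWeight_nonneg hq0 hq1 _ _)) (mem_range.2 hN)
  simpa [branchWeight] using this

theorem mul_branchWeight_le {q : ℝ} (hq0 : 0 < q) (hq1 : q < 1) {b : ℝ} (hb : 0 ≤ b)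
    (hb1 : b ≤ 1) {N : ℕ} (hN : 1 ≤ N) : q * branchWeight q b N ≤ forestWeight q 1 (N + 1) := by
  rw [← branchWeight_one hq0 hq1 hN]
  refine mul_le_mul_of_nonneg_left (sum_le_sum fun J _ => ?_) hq0.le
  exact mul_le_mul_of_nonneg_right (pow_le_pow_left₀ hb hb1 J) (forestWeight_nonneg hq0 hq1 _ _)

/-- The generating functions of the number of trees in a forest all have the same growth rate. -/
theorem exists_growth_rate {q : ℝ} (hq0 : 0 < q) (hq1 : q < 1) :
    ∃ L : ℝ, 0 < L ∧ L ≤ 4 ∧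
      Tendsto (fun N => forestWeight q 1 (N + 1) / forestWeight q 1 N) atTop (𝓝 L) ∧
      (∀ N, 2 ≤ N → forestWeight q 1 (N + 1) ≤ L * forestWeight q 1 N) ∧
      ∀ b, 0 < b → b ≤ 1 →
        Tendsto (fun N => branchWeight q b (N + 1) / branchWeight q b N) atTop (𝓝 L) := by
  have hpos : ∀ b, 0 < b → ∀ n, 0 < branchWeight q b (n + 1) := fun b hb n =>
    (forestWeight_one_pos hq0 hq1 (by omega)).trans_le
      (forestWeight_one_le_branchWeight hq0 hq1 hb.le (by omega))
  have hlim : ∀ b, 0 < b → b ≤ 1 → ∃ L : ℝ, 0 < L ∧ L ≤ 4 ∧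
      Tendsto (fun n => branchWeight q b (n + 1 + 1) / branchWeight q b (n + 1)) atTop (𝓝 L) ∧
      ∀ n, branchWeight q b (n + 1 + 1) ≤ L * branchWeight q b (n + 1) := by
    intro b hb hb1
    refine exists_ratio_limit (x := fun n => branchWeight q b (n + 1)) (hpos b hb)
      (fun n => sq_branchWeight_le hq0 hq1 hb (by omega)) (M := 8 / q) fun n => ?_
    have h1 := mul_branchWeight_le hq0 hq1 hb.le hb1 (N := n + 1) (by omega)
    have h2 := forestWeight_le hq0 hq1 1 (n + 1 + 1)
    rw [div_mul_eq_mul_div, le_div_iff₀ hq0]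
    rw [show (4 : ℝ) ^ (n + 1 + 1) / 2 ^ 1 = 8 * 4 ^ n by rw [pow_succ, pow_succ]; ring] at h2
    linarith
  have hbase : ∀ n, forestWeight q 1 (n + 2) = q * branchWeight q 1 (n + 1) := fun n =>
    (branchWeight_one hq0 hq1 (by omega)).symm
  obtain ⟨L, hL0, hL4, hL, hLle⟩ := hlim 1 one_pos le_rfl
  refine ⟨L, hL0, hL4, ?_, fun N hN => ?_, fun b hb hb1 => ?_⟩
  · rw [← tendsto_add_atTop_iff_nat 2]
    refine hL.congr fun n => ?_
    rw [show n + 2 + 1 = (n + 1) + 2 by ring, hbase, hbase, mul_div_mul_left _ _ hq0.ne']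
  · obtain ⟨n, rfl⟩ := Nat.exists_eq_add_of_le' hN
    rw [show n + 2 + 1 = (n + 1) + 2 by ring, hbase, hbase]
    have := mul_le_mul_of_nonneg_left (hLle n) hq0.le
    linarith
  · obtain ⟨A, hA0, -, hA, hAle⟩ := hlim b hb hb1
    -- The branching weight increases with b.
    have h1 : A ≤ L := by
      refine le_of_ratio_limit (hpos b hb) hL0 hA (M := branchWeight q 1 1) fun n => ?_
      refine le_trans ?_ (le_mul_pow_of_ratio_le
        (x := fun n => branchWeight q 1 (n + 1)) hL0 hLle n)
      refine sum_le_sum fun J _ => ?_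
      exact mul_le_mul_of_nonneg_right (pow_le_pow_left₀ hb.le hb1 J)
        (forestWeight_nonneg hq0 hq1 _ _)
    -- The single trees already contribute `forestWeight q 1` to every branching weight, and this is
    -- q times the branching weight for b = 1 at one edge less.
    have h2 : L ≤ A := by
      refine le_of_ratio_limit (hpos 1 one_pos) hA0 hL (M := branchWeight q b 1 * A / q)
        fun n => ?_
      have h3 := forestWeight_one_le_branchWeight hq0 hq1 hb.le (N := n + 2) (by omega)
      rw [hbase] at h3
      have h4 := le_mul_pow_of_ratio_le (x := fun n => branchWeight q b (n + 1)) hA0 hAle (n + 1)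
      rw [div_mul_eq_mul_div, le_div_iff₀ hq0]
      calc _ = q * branchWeight q 1 (n + 1) := mul_comm _ _
        _ ≤ _ := h3
        _ ≤ _ := h4
        _ = _ := by rw [pow_succ]; ring
    rw [← tendsto_add_atTop_iff_nat 1, ← le_antisymm h1 h2]
    exact hA

/-- The normalized weight of the forests of `K` trees with `N` edges. -/
noncomputable def forestRatio (q : ℝ) (K N : ℕ) : ℝ := forestWeight q K N / forestWeight q 1 N

theorem forestRatio_nonneg {q : ℝ} (hq0 : 0 < q) (hq1 : q < 1) (K N : ℕ) :
    0 ≤ forestRatio q K N :=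
  div_nonneg (forestWeight_nonneg hq0 hq1 _ _) (forestWeight_nonneg hq0 hq1 _ _)

theorem hasSum_forestRatio {q : ℝ} (hq0 : 0 < q) (hq1 : q < 1) (k : ℕ) {N : ℕ} (hN : 1 ≤ N) :
    HasSum (fun j => ((j + k + 1).choose k : ℝ) * forestRatio q (j + 1) N)
      (forestWeight q (k + 1) (N + (k + 1)) / (q * forestWeight q 1 N)) := by
  rw [forestWeight_rec hq0 hq1 (by omega), mul_div_mul_left _ _ hq0.ne', sum_range_succ',
    forestWeight_zero_left hq0 hq1, if_neg (by omega), mul_zero, add_zero, sum_div]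
  have h : ∀ j, ((j + k + 1).choose k : ℝ) * forestRatio q (j + 1) N =
      (Nat.multichoose (k + 1) (j + 1) : ℝ) * forestWeight q (j + 1) N / forestWeight q 1 N := by
    intro j
    rw [multichoose_succ_left, show j + 1 + k = j + k + 1 by ring, forestRatio, mul_div_assoc]
  simp_rw [h]
  exact hasSum_sum_of_ne_finset_zero fun j hj => by
    rw [forestWeight_of_lt _ (by simpa using hj)]
    simp

theorem forestRatio_one {q : ℝ} (hq0 : 0 < q) (hq1 : q < 1) {N : ℕ} (hN : 1 ≤ N) :
    forestRatio q 1 N = 1 := div_self (forestWeight_one_pos hq0 hq1 hN).ne'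

theorem hasSum_pow_mul_forestRatio {q : ℝ} (b : ℝ) (N : ℕ) :
    HasSum (fun j => b ^ j * forestRatio q (j + 1) N)
      (branchWeight q b N / forestWeight q 1 N) := by
  rw [branchWeight, sum_div]
  simp_rw [mul_div_assoc]
  exact hasSum_sum_of_ne_finset_zero fun j hj => by
    rw [forestRatio, forestWeight_of_lt _ (by simp at hj; omega)]
    simp

theorem choose_mul_succ_mul_succ (j k : ℕ) :
    (j + k + 1).choose k * ((j + k + 2) * (j + k + 3)) =
      (j + k + 3).choose (k + 2) * ((k + 1) * (k + 2)) := by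
  have h1 := Nat.add_one_mul_choose_eq (j + k + 1) k
  have h2 := Nat.add_one_mul_choose_eq (j + k + 2) (k + 1)
  calc _ = (j + k + 3) * ((j + k + 1 + 1) * (j + k + 1).choose k) := by ring
    _ = ((j + k + 2 + 1) * (j + k + 2).choose (k + 1)) * (k + 1) := by rw [h1]; ring
    _ = _ := by rw [h2]; ring

/-- Uniform bounds for the normalized weights. -/
theorem choose_mul_forestRatio_le {q L : ℝ} (hq0 : 0 < q) (hq1 : q < 1) (hL : 0 < L)
    (hle : ∀ N, 2 ≤ N → forestWeight q 1 (N + 1) ≤ L * forestWeight q 1 N) {N : ℕ} (hN : 2 ≤ N)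
    (j k : ℕ) : ((j + k + 1).choose k : ℝ) * forestRatio q (j + 1) N ≤ L ^ (k + 2) / q ^ 2 := by
  have h1 := le_hasSum (hasSum_forestRatio hq0 hq1 k (N := N) (by omega)) j fun i _ =>
    mul_nonneg (by positivity) (forestRatio_nonneg hq0 hq1 _ _)
  refine h1.trans ?_
  have h2 := mul_sum_forestWeight_le hq0 hq1 (k + 1) (N + (k + 1))
  have h3 : ∀ i, forestWeight q 1 (N + i) ≤ L ^ i * forestWeight q 1 N := by
    intro i
    induction i with
    | zero => simp
    | succ i ih =>
      calc _ ≤ _ := hle (N + i) (by omega)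
        _ ≤ L * (L ^ i * forestWeight q 1 N) := mul_le_mul_of_nonneg_left ih hL.le
        _ = _ := by ring
  have h4 := h3 (k + 2)
  have hp := forestWeight_one_pos hq0 hq1 (N := N) (by omega)
  rw [div_le_div_iff₀ (by positivity) (by positivity)]
  rw [show N + (k + 1) + 1 = N + (k + 2) by ring] at h2
  nlinarith

theorem forestRatio_le {q L : ℝ} (hq0 : 0 < q) (hq1 : q < 1) (hL : 0 < L)
    (hle : ∀ N, 2 ≤ N → forestWeight q 1 (N + 1) ≤ L * forestWeight q 1 N) {N : ℕ} (hN : 2 ≤ N)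
    (j : ℕ) : forestRatio q (j + 1) N ≤ L ^ 2 / q ^ 2 := by
  simpa using choose_mul_forestRatio_le hq0 hq1 hL hle hN j 0

/-- The uniform bound for k + 2 in place of k gains two powers of j, hence a summable majorant for
passing to the limit in the branching equation. -/
theorem choose_mul_forestRatio_le_sq {q L : ℝ} (hq0 : 0 < q) (hq1 : q < 1) (hL : 0 < L)
    (hle : ∀ N, 2 ≤ N → forestWeight q 1 (N + 1) ≤ L * forestWeight q 1 N) {N : ℕ} (hN : 2 ≤ N)
    (j k : ℕ) : ((j + k + 1).choose k : ℝ) * forestRatio q (j + 1) N ≤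
      L ^ (k + 4) / q ^ 2 * ((k + 1) * (k + 2)) * (1 / ((j + 1 : ℕ) : ℝ) ^ 2) := by
  have h1 := choose_mul_forestRatio_le hq0 hq1 hL hle hN j (k + 2)
  have h2 : ((j + k + 1).choose k : ℝ) * ((j + k + 2) * (j + k + 3)) =
      ((j + k + 3).choose (k + 2) : ℝ) * ((k + 1) * (k + 2)) := by
    exact_mod_cast choose_mul_succ_mul_succ j k
  have h0 := forestRatio_nonneg hq0 hq1 (j + 1) N
  have h3 : ((j + k + 1).choose k : ℝ) * ((j + 1 : ℕ) : ℝ) ^ 2 ≤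
      ((j + k + 3).choose (k + 2) : ℝ) * ((k + 1) * (k + 2)) := by
    rw [← h2]
    refine mul_le_mul_of_nonneg_left ?_ (by positivity)
    push_cast
    nlinarith [(Nat.cast_nonneg j : (0 : ℝ) ≤ j), (Nat.cast_nonneg k : (0 : ℝ) ≤ k)]
  rw [mul_one_div, le_div_iff₀ (by positivity)]
  calc _ = ((j + k + 1).choose k : ℝ) * ((j + 1 : ℕ) : ℝ) ^ 2 * forestRatio q (j + 1) N := by ring
    _ ≤ ((j + k + 3).choose (k + 2) : ℝ) * ((k + 1) * (k + 2)) * forestRatio q (j + 1) N :=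
      mul_le_mul_of_nonneg_right h3 h0
    _ = ((j + (k + 2) + 1).choose (k + 2) : ℝ) * forestRatio q (j + 1) N *
        ((k + 1) * (k + 2)) := by rw [show j + (k + 2) + 1 = j + k + 3 by ring]; ring
    _ ≤ _ := mul_le_mul_of_nonneg_right h1 (by positivity)

/-! ### Limit points of the normalized weights -/

theorem exists_tendsto_ultrafilter (U : Ultrafilter ℕ) {x : ℕ → ℝ} {M : ℝ}
    (h : ∀ᶠ n in (U : Filter ℕ), 0 ≤ x n ∧ x n ≤ M) :
    ∃ l, 0 ≤ l ∧ l ≤ M ∧ Tendsto x U (𝓝 l) := by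
  obtain ⟨l, hl, hlU⟩ := isCompact_Icc (a := (0 : ℝ)) (b := M) |>.ultrafilter_le_nhds (U.map x)
    (by rw [Ultrafilter.coe_map, le_principal_iff]; exact h)
  exact ⟨l, hl.1, hl.2, hlU⟩

/-- Along an ultrafilter let f and g be the limits at N and at N + 1. Branching weights and
single-tree weights share the growth rate L, so Σ b^j f_j = Σ b^j g_j for all b in (0,1), whence f =
g. -/
theorem tendsto_forestRatio_succ_sub {q L : ℝ} (hq0 : 0 < q) (hq1 : q < 1) (hL : 0 < L)
    (hlim : Tendsto (fun N => forestWeight q 1 (N + 1) / forestWeight q 1 N) atTop (𝓝 L))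
    (hle : ∀ N, 2 ≤ N → forestWeight q 1 (N + 1) ≤ L * forestWeight q 1 N)
    (hb : ∀ b, 0 < b → b ≤ 1 →
        Tendsto (fun N => branchWeight q b (N + 1) / branchWeight q b N) atTop (𝓝 L)) (j : ℕ) :
    Tendsto (fun N => forestRatio q (j + 1) (N + 1) - forestRatio q (j + 1) N) atTop (𝓝 0) := by
  rw [tendsto_iff_ultrafilter]
  intro U hU
  set M := L ^ 2 / q ^ 2 with hM
  have hb0 : ∀ j, ∀ᶠ N in (U : Filter ℕ), 0 ≤ forestRatio q (j + 1) N ∧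
      forestRatio q (j + 1) N ≤ M := fun j => hU <| by
    filter_upwards [eventually_ge_atTop 2] with N hN
    exact ⟨forestRatio_nonneg hq0 hq1 _ _, forestRatio_le hq0 hq1 hL hle hN j⟩
  have hb1 : ∀ j, ∀ᶠ N in (U : Filter ℕ), 0 ≤ forestRatio q (j + 1) (N + 1) ∧
      forestRatio q (j + 1) (N + 1) ≤ M := fun j => hU <| by
    filter_upwards [eventually_ge_atTop 2] with N hN
    exact ⟨forestRatio_nonneg hq0 hq1 _ _, forestRatio_le hq0 hq1 hL hle (by omega) j⟩
  choose f hf0 hfM hf using fun j => exists_tendsto_ultrafilter U (hb0 j)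
  choose g hg0 hgM hg using fun j => exists_tendsto_ultrafilter U (hb1 j)
  have key : ∀ j, g j - f j = 0 := by
    refine eq_zero_of_hasSum_pow_mul (M := M) (fun j => ?_) fun b hb0 hb1 => ?_
    · rw [abs_le]
      constructor <;> linarith [hf0 j, hfM j, hg0 j, hgM j]
    · have hsum : Summable fun j => b ^ j * M :=
        (summable_geometric_of_lt_one hb0.le hb1).mul_right M
      have hF : Tendsto (fun N => branchWeight q b N / forestWeight q 1 N) U
          (𝓝 (∑' j, b ^ j * f j)) := by
        simp_rw [← fun N => (hasSum_pow_mul_forestRatio (q := q) b N).tsum_eq]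
        refine tendsto_tsum_of_dominated_convergence hsum (fun j => (hf j).const_mul _) (hU ?_)
        filter_upwards [eventually_ge_atTop 2] with N hN j
        rw [Real.norm_of_nonneg (mul_nonneg (by positivity) (forestRatio_nonneg hq0 hq1 _ _))]
        exact mul_le_mul_of_nonneg_left (forestRatio_le hq0 hq1 hL hle hN j) (by positivity)
      have hG : Tendsto (fun N => branchWeight q b (N + 1) / forestWeight q 1 (N + 1)) U
          (𝓝 (∑' j, b ^ j * g j)) := by
        simp_rw [← fun N => (hasSum_pow_mul_forestRatio (q := q) b N).tsum_eq]
        refine tendsto_tsum_of_dominated_convergence hsum (fun j => (hg j).const_mul _) (hU ?_)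
        filter_upwards [eventually_ge_atTop 2] with N hN j
        rw [Real.norm_of_nonneg (mul_nonneg (by positivity) (forestRatio_nonneg hq0 hq1 _ _))]
        exact mul_le_mul_of_nonneg_left (forestRatio_le hq0 hq1 hL hle (by omega) j)
          (by positivity)
      have hG' : Tendsto (fun N => branchWeight q b (N + 1) / forestWeight q 1 (N + 1)) U
          (𝓝 (L / L * ∑' j, b ^ j * f j)) := by
        have h1 := (((hb b hb0 hb1.le).mono_left hU).div (hlim.mono_left hU) hL.ne').mul hF
        refine h1.congr' (hU ?_)
        filter_upwards [eventually_ge_atTop 1] with N hN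
        have h2 := forestWeight_one_pos hq0 hq1 hN
        have h3 := forestWeight_one_pos hq0 hq1 (N := N + 1) (by omega)
        have h4 := h2.trans_le (forestWeight_one_le_branchWeight hq0 hq1 hb0.le hN)
        simp only [Pi.div_apply]
        field_simp
      rw [div_self hL.ne', one_mul] at hG'
      have h5 := tendsto_nhds_unique hG hG'
      have hsf : Summable fun j => b ^ j * f j := Summable.of_nonneg_of_le
        (fun j => mul_nonneg (by positivity) (hf0 j))
        (fun j => mul_le_mul_of_nonneg_left (hfM j) (by positivity)) hsum
      have hsg : Summable fun j => b ^ j * g j := Summable.of_nonneg_of_le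
        (fun j => mul_nonneg (by positivity) (hg0 j))
        (fun j => mul_le_mul_of_nonneg_left (hgM j) (by positivity)) hsum
      have h6 := hsg.hasSum.sub hsf.hasSum
      rw [h5, sub_self] at h6
      simpa only [mul_sub] using h6
  simpa only [key j] using (hg j).sub (hf j)

theorem tendsto_ratio_add {x : ℕ → ℝ} {L : ℝ} (hx : ∀ n, 1 ≤ n → 0 < x n)
    (h : Tendsto (fun n => x (n + 1) / x n) atTop (𝓝 L)) (k : ℕ) :
    Tendsto (fun n => x (n + k) / x n) atTop (𝓝 (L ^ k)) := by
  induction k with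
  | zero =>
    refine tendsto_const_nhds.congr' ?_
    filter_upwards [eventually_ge_atTop 1] with n hn
    rw [pow_zero, add_zero, div_self (hx n hn).ne']
  | succ k ih =>
    have h1 := ((tendsto_add_atTop_iff_nat k).2 h).mul ih
    rw [pow_succ']
    refine h1.congr' ?_
    filter_upwards [eventually_ge_atTop 1] with n hn
    have h2 := hx n hn
    have h3 := hx (n + k) (by omega)
    rw [← add_assoc]
    field_simp

/-- The recursion relates size N to size N + k + 1. Asymptotic shift invariance removes the
difference at the cost of the factor L^(k+1), and dominated convergence handles the sum over j. -/
theorem exists_isBranchingSolution {q L : ℝ} (hq0 : 0 < q) (hq1 : q < 1) (hL : 0 < L)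
    (hlim : Tendsto (fun N => forestWeight q 1 (N + 1) / forestWeight q 1 N) atTop (𝓝 L))
    (hle : ∀ N, 2 ≤ N → forestWeight q 1 (N + 1) ≤ L * forestWeight q 1 N)
    (hb : ∀ b, 0 < b → b ≤ 1 →
        Tendsto (fun N => branchWeight q b (N + 1) / branchWeight q b N) atTop (𝓝 L))
    {U : Ultrafilter ℕ} (hU : (U : Filter ℕ) ≤ atTop) :
    ∃ F, IsBranchingSolution q L F ∧ ∀ j, Tendsto (forestRatio q (j + 1)) U (𝓝 (F j)) := by
  have hb0 : ∀ j, ∀ᶠ N in (U : Filter ℕ), 0 ≤ forestRatio q (j + 1) N ∧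
      forestRatio q (j + 1) N ≤ L ^ 2 / q ^ 2 := fun j => hU <| by
    filter_upwards [eventually_ge_atTop 2] with N hN
    exact ⟨forestRatio_nonneg hq0 hq1 _ _, forestRatio_le hq0 hq1 hL hle hN j⟩
  choose F hF0 hFM hF using fun j => exists_tendsto_ultrafilter U (hb0 j)
  refine ⟨F, ⟨hq0, hL, hF0, ?_, fun k => ?_⟩, hF⟩
  · refine tendsto_nhds_unique (hF 0) (tendsto_const_nhds.congr' (hU ?_))
    filter_upwards [eventually_ge_atTop 1] with N hN
    exact (forestRatio_one hq0 hq1 hN).symm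
  · set B : ℕ → ℝ := fun j =>
      L ^ (k + 4) / q ^ 2 * ((k + 1) * (k + 2)) * (1 / ((j + 1 : ℕ) : ℝ) ^ 2) with hB
    have hBs : Summable B :=
      ((summable_nat_add_iff 1).2 (Real.summable_one_div_nat_pow.2 one_lt_two)).mul_left _
    have hFB : ∀ j, ((j + k + 1).choose k : ℝ) * F j ≤ B j := fun j =>
      le_of_tendsto ((hF j).const_mul _) (hU <| by
        filter_upwards [eventually_ge_atTop 2] with N hN
        exact choose_mul_forestRatio_le_sq hq0 hq1 hL hle hN j k)
    have hs : Summable fun j => ((j + k + 1).choose k : ℝ) * F j :=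
      Summable.of_nonneg_of_le (fun j => mul_nonneg (by positivity) (hF0 j)) hFB hBs
    have h1 : Tendsto (fun N => ∑' j, ((j + k + 1).choose k : ℝ) * forestRatio q (j + 1) N) U
        (𝓝 (∑' j, ((j + k + 1).choose k : ℝ) * F j)) := by
      refine tendsto_tsum_of_dominated_convergence hBs (fun j => (hF j).const_mul _) (hU ?_)
      filter_upwards [eventually_ge_atTop 2] with N hN j
      rw [Real.norm_of_nonneg (mul_nonneg (by positivity) (forestRatio_nonneg hq0 hq1 _ _))]
      exact choose_mul_forestRatio_le_sq hq0 hq1 hL hle hN j k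
    have hshift : ∀ i, Tendsto (fun N => forestRatio q (k + 1) (N + i)) U (𝓝 (F k)) := by
      intro i
      induction i with
      | zero => exact hF k
      | succ i ih =>
        have h2 := (tendsto_add_atTop_iff_nat i).2
          (tendsto_forestRatio_succ_sub hq0 hq1 hL hlim hle hb k)
        have h3 := ih.add (h2.mono_left hU)
        rw [add_zero] at h3
        refine h3.congr fun N => ?_
        rw [add_sub_cancel, add_assoc]
    have h2 : Tendsto (fun N => ∑' j, ((j + k + 1).choose k : ℝ) * forestRatio q (j + 1) N) U
        (𝓝 (L ^ (k + 1) / q * F k)) := by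
      have h3 := ((tendsto_ratio_add (fun n hn => forestWeight_one_pos hq0 hq1 hn) hlim
        (k + 1)).mono_left hU).div_const q |>.mul (hshift (k + 1))
      refine h3.congr' (hU ?_)
      filter_upwards [eventually_ge_atTop 1] with N hN
      rw [(hasSum_forestRatio hq0 hq1 k hN).tsum_eq, forestRatio]
      have h4 := forestWeight_one_pos hq0 hq1 hN
      have h5 := forestWeight_one_pos hq0 hq1 (N := N + (k + 1)) (by omega)
      field_simp
    rw [← tendsto_nhds_unique h1 h2]
    exact hs.hasSum

theorem exp_neg_lt_one {μ : ℝ} (hμ : 0 < μ) : Real.exp (-μ) < 1 := by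
  rw [Real.exp_lt_one_iff]
  linarith

theorem tendsto_forestWeight_ratio_and {μ : ℝ} (hμ : 0 < μ) :
    Tendsto (fun N => forestWeight (Real.exp (-μ)) 1 (N + 1) / forestWeight (Real.exp (-μ)) 1 N)
      atTop (𝓝 4) ∧
    ∀ K, Tendsto (forestRatio (Real.exp (-μ)) K) atTop (𝓝 (limitWeight μ K)) := by
  have hq0 := Real.exp_pos (-μ)
  have hq1 := exp_neg_lt_one hμ
  obtain ⟨L, hL0, hL4, hlim, hle, hb⟩ := exists_growth_rate hq0 hq1
  -- One limit point suffices to exclude L < 4.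
  obtain rfl : L = 4 := by
    obtain ⟨F, hF, -⟩ := exists_isBranchingSolution hq0 hq1 hL0 hlim hle hb
      (Ultrafilter.of_le atTop)
    exact le_antisymm hL4 hF.four_le
  refine ⟨hlim, fun K => ?_⟩
  rcases K with _ | K
  · rw [limitWeight_zero]
    refine tendsto_const_nhds.congr' ?_
    filter_upwards [eventually_ge_atTop 1] with N hN
    rw [forestRatio, forestWeight_zero_left hq0 hq1, if_neg (by omega), zero_div]
  · rw [tendsto_iff_ultrafilter]
    intro U hU
    obtain ⟨F, hF, hFlim⟩ := exists_isBranchingSolution hq0 hq1 hL0 hlim hle hb hU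
    have := hFlim K
    rwa [hF.unique (isBranchingSolution_limitWeight hμ)] at this

/-- The weights of the forests of `K` trees, relative to those of the trees, for sizes that differ
by a fixed number. -/
theorem tendsto_forestWeight_div {μ : ℝ} (hμ : 0 < μ) (K a c : ℕ) :
    Tendsto (fun N => forestWeight (Real.exp (-μ)) K (N + a) /
      forestWeight (Real.exp (-μ)) 1 (N + c)) atTop (𝓝 (limitWeight μ K * 4 ^ a / 4 ^ c)) := by
  have hq0 := Real.exp_pos (-μ)
  have hq1 := exp_neg_lt_one hμ
  obtain ⟨h1, h2⟩ := tendsto_forestWeight_ratio_and hμ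
  have h3 := tendsto_ratio_add (fun n hn => forestWeight_one_pos hq0 hq1 hn) h1
  have h4 := (((tendsto_add_atTop_iff_nat a).2 (h2 K)).mul (h3 a)).div (h3 c) (by positivity)
  refine h4.congr' ?_
  filter_upwards [eventually_ge_atTop 1] with N hN
  have h5 := forestWeight_one_pos hq0 hq1 hN
  have h6 := forestWeight_one_pos hq0 hq1 (N := N + a) (by omega)
  have h7 := forestWeight_one_pos hq0 hq1 (N := N + c) (by omega)
  simp only [forestRatio, Pi.div_apply]
  field_simp

end PlanarTree

namespace PlanarTree

open Filter Topology Finset MeasureTheory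

/-! ### Trees as sequences of multisets of parents -/

theorem gen_eq_zero_of_le (T : PlanarTree) {r s : ℕ} (h : r ≤ s) (hr : T.gen r = 0) :
    T.gen s = 0 := by
  induction s, h using Nat.le_induction with
  | base => exact hr
  | succ s _ ih =>
    by_contra h0
    have := T.parent_lt s 0 (Nat.pos_of_ne_zero h0)
    omega

/-- The parents, with multiplicities, of the vertices at height `r + 1`. -/
def parents (T : PlanarTree) (r : ℕ) : Multiset ℕ := (Multiset.range (T.gen (r + 1))).map (T.parent r)

theorem card_parents (T : PlanarTree) (r : ℕ) : (T.parents r).card = T.gen (r + 1) := by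
  simp [parents]

theorem lt_of_mem_parents {T : PlanarTree} {r x : ℕ} (h : x ∈ T.parents r) : x < T.gen r := by
  obtain ⟨i, hi, rfl⟩ := Multiset.mem_map.1 h
  exact T.parent_lt r i (Multiset.mem_range.1 hi)

theorem parents_zero (T : PlanarTree) : T.parents 0 = {0} := by
  have h := T.card_parents 0
  rw [T.gen_one, Multiset.card_eq_one] at h
  obtain ⟨a, ha⟩ := h
  have h1 : a < T.gen 0 := lt_of_mem_parents (r := 0) (by rw [ha]; exact Multiset.mem_singleton_self a)
  rw [T.gen_zero, Nat.lt_one_iff] at h1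
  rw [ha, h1]

/-- A monotone parent map is recovered from its multiset of values by sorting. A generation above K
vertices is thus a multiset on K elements, which is the origin of the `multichoose` counts. -/
theorem sort_parents (T : PlanarTree) (r : ℕ) :
    (T.parents r).sort = (List.range (T.gen (r + 1))).map (T.parent r) := by
  have hs : ((List.range (T.gen (r + 1))).map (T.parent r)).Pairwise (· ≤ ·) := by
    rw [List.pairwise_map]
    refine List.pairwise_lt_range.imp_of_mem fun {a b} ha hb hab => ?_
    exact T.parent_mono r a b hab.le (List.mem_range.1 hb)
  have h := Multiset.coe_sort (r := (· ≤ ·)) ((List.range (T.gen (r + 1))).map (T.parent r))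
  rw [List.mergeSort_of_pairwise (by simpa using hs)] at h
  exact h

theorem parent_eq_getD (T : PlanarTree) (r i : ℕ) : T.parent r i = ((T.parents r).sort).getD i 0 := by
  rw [sort_parents]
  rcases lt_or_ge i (T.gen (r + 1)) with h | h
  · rw [List.getD_eq_getElem _ _ (by simpa using h)]
    simp
  · rw [List.getD_eq_default _ _ (by simpa using h), T.parent_out r i h]

theorem ext_parents {S T : PlanarTree} (h : ∀ r, S.parents r = T.parents r) : S = T := by
  ext r i
  · rcases r with _ | r
    · rw [S.gen_zero, T.gen_zero]
    · rw [← card_parents, ← card_parents, h]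
  · rw [parent_eq_getD, parent_eq_getD, h]

/-- The first `r` multisets of parents of a tree. -/
def history (T : PlanarTree) (r : ℕ) : List (Multiset ℕ) := (List.range r).map T.parents

theorem history_eq_iff {S T : PlanarTree} {r : ℕ} :
    T.history r = S.history r ↔ ∀ s < r, T.parents s = S.parents s := by
  simp [history, List.map_inj_left]

theorem ball_eq_iff_history {S T : PlanarTree} {r : ℕ} (hr : 1 ≤ r) :
    T.ball r hr = S.ball r hr ↔ T.history r = S.history r := by
  rw [ball_eq_iff, history_eq_iff]
  constructor
  · rintro ⟨h1, h2⟩ s hs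
    rw [parents, parents, h1 (s + 1) hs]
    exact Multiset.map_congr rfl fun i _ => h2 s hs i
  · intro h
    refine ⟨fun s hs => ?_, fun s hs i => ?_⟩
    · rcases s with _ | s
      · rw [S.gen_zero, T.gen_zero]
      · rw [← card_parents, ← card_parents, h s hs]
    · rw [parent_eq_getD, parent_eq_getD, h s hs]

/-- The restriction of a sequence of multisets to the possible parents. -/
def admissible (M : ℕ → Multiset ℕ) : ℕ → Multiset ℕ
  | 0 => {0}
  | s + 1 => (M (s + 1)).filter (· < (admissible M s).card)

/-- The tree with the given multisets of parents. -/
def ofParents (M : ℕ → Multiset ℕ) : PlanarTree where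
  gen
    | 0 => 1
    | s + 1 => (admissible M s).card
  parent s i := ((admissible M s).sort).getD i 0
  gen_zero := rfl
  gen_one := by simp [admissible]
  parent_lt s i h := by
    have hi : i < ((admissible M s).sort).length := by simpa using h
    rw [List.getD_eq_getElem _ _ hi]
    have hm : ((admissible M s).sort)[i] ∈ admissible M s :=
      (Multiset.mem_sort (· ≤ ·)).1 (List.getElem_mem hi)
    rcases s with _ | s
    · have : ((admissible M 0).sort)[i] = 0 := by simp [admissible]
      rw [this]
      exact Nat.zero_lt_one
    · exact (Multiset.mem_filter.1 hm).2
  parent_mono s i j hij h := by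
    have hj : j < ((admissible M s).sort).length := by simpa using h
    rw [List.getD_eq_getElem _ _ hj, List.getD_eq_getElem _ _ (hij.trans_lt hj)]
    exact (Multiset.pairwise_sort _ (· ≤ ·)).rel_get_of_le (a := ⟨i, hij.trans_lt hj⟩) (b := ⟨j, hj⟩) hij
  parent_out s i h := List.getD_eq_default _ _ (by simpa using h)

theorem parents_ofParents (M : ℕ → Multiset ℕ) (s : ℕ) :
    (ofParents M).parents s = admissible M s := by
  have h : (List.range (admissible M s).card).map (fun i => ((admissible M s).sort).getD i 0) =
      (admissible M s).sort := by
    refine List.ext_getElem (by simp) fun i h1 h2 => ?_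
    rw [List.getElem_map, List.getElem_range, List.getD_eq_getElem _ _ h2]
  calc (ofParents M).parents s
      = ((List.range (admissible M s).card).map
          (fun i => ((admissible M s).sort).getD i 0) : Multiset ℕ) := rfl
    _ = _ := by rw [h, Multiset.sort_eq]

theorem admissible_eq_of_forall {M : ℕ → Multiset ℕ} (h0 : M 0 = {0}) {n : ℕ}
    (h : ∀ s < n, ∀ x ∈ M (s + 1), x < (M s).card) {s : ℕ} (hs : s ≤ n) :
    admissible M s = M s := by
  induction s with
  | zero => exact h0.symm
  | succ s ih =>
    rw [admissible, ih (by omega), Multiset.filter_eq_self]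
    exact h s hs

/-- The tree obtained from the first `r` generations of `S` by adding a generation with the given
parents. -/
def extend (S : PlanarTree) (r : ℕ) (m : Multiset ℕ) : PlanarTree :=
  ofParents fun s => if s < r then S.parents s else if s = r then m else 0

theorem parents_extend (S : PlanarTree) {r : ℕ} (hr : 1 ≤ r) {m : Multiset ℕ}
    (hm : ∀ x ∈ m, x < S.gen r) (s : ℕ) :
    (S.extend r m).parents s = if s < r then S.parents s else if s = r then m else 0 := by
  rw [extend, parents_ofParents]
  refine admissible_eq_of_forall (n := s) ?_ (fun t _ x hx => ?_) le_rfl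
  · rw [if_pos (by omega), parents_zero]
  · rcases lt_trichotomy (t + 1) r with h | h | h
    · rw [if_pos h] at hx
      rw [if_pos (by omega), card_parents]
      exact lt_of_mem_parents hx
    · rw [if_neg (by omega), if_pos h] at hx
      rw [if_pos (by omega), card_parents, h]
      exact hm x hx
    · rw [if_neg (by omega), if_neg (by omega)] at hx
      simp at hx

/-- The set of trees that agree with `S` in the first `r` generations. -/
def cyl (S : PlanarTree) (r : ℕ) : Set PlanarTree := {T | T.history r = S.history r}

theorem mem_cyl {S T : PlanarTree} {r : ℕ} :
    T ∈ cyl S r ↔ ∀ s < r, T.parents s = S.parents s := history_eq_iff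

theorem mem_cyl_self (S : PlanarTree) (r : ℕ) : S ∈ cyl S r := rfl

theorem gen_eq_of_mem_cyl {S T : PlanarTree} {r s : ℕ} (h : T ∈ cyl S r) (hs : s ≤ r) :
    T.gen s = S.gen s := by
  rcases s with _ | s
  · rw [S.gen_zero, T.gen_zero]
  · rw [← card_parents, ← card_parents, mem_cyl.1 h s hs]

theorem parent_eq_of_mem_cyl {S T : PlanarTree} {r s : ℕ} (h : T ∈ cyl S r) (hs : s < r) :
    T.parent s = S.parent s := by
  funext i
  rw [parent_eq_getD, parent_eq_getD, mem_cyl.1 h s hs]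

theorem cyl_one (S : PlanarTree) : cyl S 1 = Set.univ := by
  ext T
  simp [mem_cyl, parents_zero]

/-- The extension of the first `r` generations of `S` indexed by a multiset of vertices at
height `r`. -/
def extendFin (S : PlanarTree) (r : ℕ) (m : Multiset (Fin (S.gen r))) : PlanarTree :=
  S.extend r (m.map Fin.val)

theorem parents_extendFin (S : PlanarTree) {r : ℕ} (hr : 1 ≤ r) (m : Multiset (Fin (S.gen r)))
    (s : ℕ) : (S.extendFin r m).parents s =
      if s < r then S.parents s else if s = r then m.map Fin.val else 0 :=
  parents_extend S hr (fun x hx => by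
    obtain ⟨i, -, rfl⟩ := Multiset.mem_map.1 hx
    exact i.2) s

theorem mem_cyl_extendFin {S T : PlanarTree} {r : ℕ} (hr : 1 ≤ r) {m : Multiset (Fin (S.gen r))} :
    T ∈ cyl (S.extendFin r m) (r + 1) ↔ T ∈ cyl S r ∧ T.parents r = m.map Fin.val := by
  simp only [mem_cyl, parents_extendFin S hr]
  constructor
  · intro h
    refine ⟨fun s hs => ?_, ?_⟩
    · rw [h s (by omega), if_pos hs]
    · rw [h r (by omega), if_neg (by omega), if_pos rfl]
  · rintro ⟨h1, h2⟩ s hs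
    rcases Nat.lt_succ_iff_lt_or_eq.1 hs with h | rfl
    · rw [if_pos h, h1 s h]
    · rw [if_neg (by omega), if_pos rfl, h2]

theorem extendFin_mem_cyl (S : PlanarTree) {r : ℕ} (hr : 1 ≤ r) (m : Multiset (Fin (S.gen r))) :
    S.extendFin r m ∈ cyl S r := ((mem_cyl_extendFin hr).1 (mem_cyl_self _ _)).1

theorem parents_extendFin_self (S : PlanarTree) {r : ℕ} (hr : 1 ≤ r)
    (m : Multiset (Fin (S.gen r))) : (S.extendFin r m).parents r = m.map Fin.val :=
  ((mem_cyl_extendFin hr).1 (mem_cyl_self _ _)).2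

theorem gen_extendFin (S : PlanarTree) {r : ℕ} (hr : 1 ≤ r) (m : Multiset (Fin (S.gen r))) :
    (S.extendFin r m).gen (r + 1) = m.card := by
  rw [← card_parents, parents_extendFin_self S hr, Multiset.card_map]

theorem cyl_eq_iUnion (S : PlanarTree) {r : ℕ} (hr : 1 ≤ r) :
    cyl S r = ⋃ m : Multiset (Fin (S.gen r)), cyl (S.extendFin r m) (r + 1) := by
  ext T
  rw [Set.mem_iUnion]
  constructor
  · intro h
    have hlt : ∀ x ∈ T.parents r, x < S.gen r := fun x hx => by
      rw [← gen_eq_of_mem_cyl h le_rfl]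
      exact lt_of_mem_parents hx
    refine ⟨(T.parents r).pmap (fun x hx => (⟨x, hx⟩ : Fin (S.gen r))) hlt,
      (mem_cyl_extendFin hr).2 ⟨h, ?_⟩⟩
    rw [Multiset.map_pmap, Multiset.pmap_eq_map, Multiset.map_id']
  · rintro ⟨m, h⟩
    exact ((mem_cyl_extendFin hr).1 h).1

theorem pairwise_disjoint_cyl_extendFin (S : PlanarTree) {r : ℕ} (hr : 1 ≤ r) :
    Pairwise (Function.onFun Disjoint
      fun m : Multiset (Fin (S.gen r)) => cyl (S.extendFin r m) (r + 1)) := by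
  intro m m' hne
  refine Set.disjoint_left.2 fun T h h' => hne ?_
  have h1 := ((mem_cyl_extendFin hr).1 h).2
  have h2 := ((mem_cyl_extendFin hr).1 h').2
  exact Multiset.map_injective Fin.val_injective (h1.symm.trans h2)

/-! ### Topology and measurability -/

instance : Countable (Multiset ℕ) := Quotient.countable

theorem isOpen_cyl (S : PlanarTree) (r : ℕ) : IsOpen (cyl S r) := by
  rw [Metric.isOpen_iff]
  intro T hT
  refine ⟨1 / ((r + 1 : ℕ) : ℝ), by positivity, fun T' hT' => ?_⟩
  obtain ⟨r', hr', he, hlt⟩ := exists_ball_eq_of_sInf_lt (Metric.mem_ball.1 hT')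
  have h1 := (one_div_lt_one_div (by exact_mod_cast hr') (by positivity)).1 hlt
  have h2 : r + 1 < r' := by exact_mod_cast h1
  rw [ball_eq_iff_history, history_eq_iff] at he
  exact mem_cyl.2 fun s hs => (he s (by omega)).trans (mem_cyl.1 hT s hs)

theorem exists_cyl_subset {U : Set PlanarTree} (hU : IsOpen U) {T : PlanarTree} (hT : T ∈ U) :
    ∃ r, cyl T r ⊆ U := by
  obtain ⟨ε, hε, hsub⟩ := Metric.isOpen_iff.1 hU T hT
  obtain ⟨n, hn⟩ := exists_nat_one_div_lt hε
  refine ⟨n + 1, fun T' hT' => hsub (Metric.mem_ball.2 ?_)⟩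
  refine (sInf_agreeSet_le (r := n + 1) (by omega) ?_).trans_lt (by exact_mod_cast hn)
  exact (ball_eq_iff_history _).2 hT'

theorem measurableSet_cyl (S : PlanarTree) (r : ℕ) : MeasurableSet (cyl S r) :=
  (isOpen_cyl S r).measurableSet

theorem isOpen_of_history {A : Set PlanarTree} {r : ℕ}
    (h : ∀ T T' : PlanarTree, T'.history r = T.history r → T ∈ A → T' ∈ A) : IsOpen A := by
  have : A = ⋃ T ∈ A, cyl T r := by
    ext T
    simp only [Set.mem_iUnion, exists_prop]
    exact ⟨fun hT => ⟨T, hT, rfl⟩, fun ⟨S, hS, hT⟩ => h S T hT hS⟩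
  rw [this]
  exact isOpen_biUnion fun T _ => isOpen_cyl T r

theorem measurableSet_of_history {A : Set PlanarTree} {r : ℕ}
    (h : ∀ T T' : PlanarTree, T'.history r = T.history r → T ∈ A → T' ∈ A) : MeasurableSet A :=
  (isOpen_of_history h).measurableSet

/-- The cylinder of the trees with a given history. -/
def histCyl (l : List (Multiset ℕ)) : Set PlanarTree := {T | T.history l.length = l}

theorem length_history (T : PlanarTree) (r : ℕ) : (T.history r).length = r := by simp [history]

theorem histCyl_history (T : PlanarTree) (r : ℕ) : histCyl (T.history r) = cyl T r := by
  rw [histCyl, length_history, cyl]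

theorem isOpen_eq_iUnion {U : Set PlanarTree} (hU : IsOpen U) :
    U = ⋃ l ∈ {l : List (Multiset ℕ) | histCyl l ⊆ U}, histCyl l := by
  refine Set.Subset.antisymm (fun T hT => ?_) (Set.iUnion₂_subset fun l hl => hl)
  obtain ⟨r, hr⟩ := exists_cyl_subset hU hT
  rw [← histCyl_history] at hr
  exact Set.mem_biUnion hr (by rw [histCyl_history]; exact mem_cyl_self T r)

/-- A map to the space of trees is measurable if the multisets of parents are. -/
theorem measurable_of_parents {α : Type*} [MeasurableSpace α] {f : α → PlanarTree}
    (h : ∀ r m, MeasurableSet {a | (f a).parents r = m}) : Measurable f := by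
  refine measurable_of_isOpen fun U hU => ?_
  rw [isOpen_eq_iUnion hU, Set.preimage_iUnion₂]
  refine MeasurableSet.biUnion (Set.to_countable _) fun l _ => ?_
  have : f ⁻¹' histCyl l = ⋂ s : Fin l.length, {a | (f a).parents s = l[s]} := by
    ext a
    simp only [Set.mem_preimage, histCyl, Set.mem_ofPred_eq, Set.mem_iInter, history]
    rw [List.ext_getElem_iff]
    simp [Fin.forall_iff]
  rw [this]
  exact MeasurableSet.iInter fun s => h _ _

/-! ### Sums over multisets -/

theorem tsum_multiset_card {α : Type*} [Fintype α] (φ : ℕ → ENNReal) :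
    ∑' m : Multiset α, φ m.card = ∑' J, (Nat.multichoose (Fintype.card α) J : ENNReal) * φ J := by
  classical
  rw [← (Equiv.sigmaFiberEquiv (Multiset.card : Multiset α → ℕ)).tsum_eq, ENNReal.tsum_sigma']
  refine tsum_congr fun J => ?_
  have h : ∀ m : {m : Multiset α // m.card = J},
      φ (Equiv.sigmaFiberEquiv Multiset.card ⟨J, m⟩).card = φ J := by
    rintro ⟨m, rfl⟩
    rfl
  simp_rw [h]
  have e : (∑' _ : {m : Multiset α // m.card = J}, φ J) = ∑' _ : Sym α J, φ J := rfl
  rw [e, tsum_fintype, sum_const, Finset.card_univ, Sym.card_sym_eq_multichoose, nsmul_eq_mul]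

/-- A multiset is a free pair of its part inside p and its part outside. Below, p will single out
the children of a given set of vertices. -/
theorem tsum_multiset_countP {α : Type*} [Fintype α] (p : α → Prop) [DecidablePred p]
    (φ : ℕ → ℕ → ENNReal) :
    ∑' m : Multiset α, φ (m.countP p) (m.countP fun x => ¬ p x) =
      ∑' J, (Nat.multichoose (Fintype.card {x // p x}) J : ENNReal) *
        ∑' J', (Nat.multichoose (Fintype.card {x // ¬ p x}) J' : ENNReal) * φ J J' := by
  have hfil : ∀ (a : Multiset {x // p x}) (b : Multiset {x // ¬ p x}),
      (a.map Subtype.val + b.map Subtype.val).filter p = a.map Subtype.val ∧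
      (a.map Subtype.val + b.map Subtype.val).filter (fun x => ¬ p x) = b.map Subtype.val := by
    intro a b
    have ha : ∀ x ∈ a.map Subtype.val, p x := fun x hx => by
      obtain ⟨y, -, rfl⟩ := Multiset.mem_map.1 hx
      exact y.2
    have hb : ∀ x ∈ b.map Subtype.val, ¬ p x := fun x hx => by
      obtain ⟨y, -, rfl⟩ := Multiset.mem_map.1 hx
      exact y.2
    constructor
    · rw [Multiset.filter_add, Multiset.filter_eq_self.2 ha, Multiset.filter_eq_nil.2 hb, add_zero]
    · rw [Multiset.filter_add, Multiset.filter_eq_self.2 hb,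
        Multiset.filter_eq_nil.2 fun x hx => not_not.2 (ha x hx), zero_add]
  have hbij : Function.Bijective fun ab : Multiset {x // p x} × Multiset {x // ¬ p x} =>
      ab.1.map Subtype.val + ab.2.map Subtype.val := by
    constructor
    · rintro ⟨a, b⟩ ⟨a', b'⟩ h
      simp only at h
      refine Prod.ext (Multiset.map_injective Subtype.val_injective ?_)
        (Multiset.map_injective Subtype.val_injective ?_)
      · rw [← (hfil a b).1, h, (hfil a' b').1]
      · rw [← (hfil a b).2, h, (hfil a' b').2]
    · intro m
      refine ⟨((m.filter p).pmap Subtype.mk fun x hx => (Multiset.mem_filter.1 hx).2,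
        (m.filter fun x => ¬ p x).pmap Subtype.mk fun x hx => (Multiset.mem_filter.1 hx).2), ?_⟩
      simp only [Multiset.map_pmap, Multiset.pmap_eq_map, Multiset.map_id']
      exact Multiset.filter_add_not p m
  rw [← (Equiv.ofBijective _ hbij).tsum_eq, ENNReal.tsum_prod']
  have h : ∀ (a : Multiset {x // p x}) (b : Multiset {x // ¬ p x}),
      φ ((Equiv.ofBijective _ hbij (a, b)).countP p)
        ((Equiv.ofBijective _ hbij (a, b)).countP fun x => ¬ p x) = φ a.card b.card := by
    intro a b
    rw [Equiv.ofBijective_apply, Multiset.countP_eq_card_filter, Multiset.countP_eq_card_filter,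
      (hfil a b).1, (hfil a b).2, Multiset.card_map, Multiset.card_map]
  simp_rw [h]
  have h2 : ∀ J : ℕ, ∑' b : Multiset {x // ¬ p x}, φ J b.card =
      ∑' J', (Nat.multichoose (Fintype.card {x // ¬ p x}) J' : ENNReal) * φ J J' := fun J =>
    tsum_multiset_card (φ J)
  simp_rw [h2]
  exact tsum_multiset_card fun J =>
    ∑' J', (Nat.multichoose (Fintype.card {x // ¬ p x}) J' : ENNReal) * φ J J'

end PlanarTree

namespace PlanarTree

open Filter Topology Finset MeasureTheory

/-! ### The finite size measures of cylinders -/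

/-- The number of edges between the first `r` generations. -/
def sizeUpTo (T : PlanarTree) (r : ℕ) : ℕ := ∑ s ∈ range r, T.gen (s + 1)

theorem sizeUpTo_succ (T : PlanarTree) (r : ℕ) :
    T.sizeUpTo (r + 1) = T.sizeUpTo r + T.gen (r + 1) := sum_range_succ _ _

theorem sizeUpTo_congr {S T : PlanarTree} {r : ℕ} (h : T ∈ cyl S r) :
    T.sizeUpTo r = S.sizeUpTo r :=
  sum_congr rfl fun _ hs => gen_eq_of_mem_cyl h (mem_range.1 hs)

theorem encard_vertices_le (T : PlanarTree) (r : ℕ) :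
    {v ∈ T.vertices | 1 ≤ v.1 ∧ v.1 ≤ r}.encard = T.sizeUpTo r := by
  have h : {v ∈ T.vertices | 1 ≤ v.1 ∧ v.1 ≤ r} =
      ↑(((range r).sigma fun s => range (T.gen (s + 1))).image
        fun x : (_ : ℕ) × ℕ => (x.1 + 1, x.2)) := by
    ext ⟨s, i⟩
    simp only [vertices, Set.mem_ofPred_eq, coe_image, Set.mem_image, mem_coe, mem_sigma, mem_range,
      Sigma.exists, Prod.mk.injEq]
    constructor
    · rintro ⟨h1, h2, h3⟩
      refine ⟨s - 1, i, ⟨by omega, ?_⟩, by omega, rfl⟩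
      rwa [Nat.sub_add_cancel h2]
    · rintro ⟨s, i, ⟨h1, h2⟩, rfl, rfl⟩
      exact ⟨h2, by omega, by omega⟩
  rw [h, Set.encard_coe_eq_coe_finsetCard, card_image_of_injective, card_sigma]
  · simp [sizeUpTo]
  · rintro ⟨a, b⟩ ⟨c, d⟩ h
    simp only [Prod.mk.injEq, Nat.add_right_cancel_iff] at h
    obtain ⟨rfl, rfl⟩ := h
    rfl

theorem sizeUpTo_le_size (T : PlanarTree) (r : ℕ) : (T.sizeUpTo r : ℕ∞) ≤ T.size := by
  rw [← encard_vertices_le]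
  exact Set.encard_le_encard fun v hv => ⟨hv.1, hv.2.1⟩

theorem size_eq_sizeUpTo {T : PlanarTree} {r : ℕ} (h : T.gen (r + 1) = 0) :
    T.size = T.sizeUpTo r := by
  rw [← encard_vertices_le, size]
  congr 1
  ext v
  constructor
  · rintro ⟨h1, h2⟩
    refine ⟨h1, h2, ?_⟩
    by_contra hv
    have := gen_eq_zero_of_le T (show r + 1 ≤ v.1 by omega) h
    simp [vertices, this] at h1
  · rintro ⟨h1, h2, -⟩
    exact ⟨h1, h2⟩

theorem size_eq_top_iff (T : PlanarTree) : T.size = ⊤ ↔ ∀ r, T.gen r ≠ 0 := by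
  constructor
  · intro h r hr
    rw [size_eq_sizeUpTo (T.gen_eq_zero_of_le (Nat.le_succ r) hr)] at h
    exact ENat.natCast_ne_top _ h
  · intro h
    refine ENat.eq_top_iff_forall_ge.2 fun n => le_trans ?_ (T.sizeUpTo_le_size n)
    have : n ≤ T.sizeUpTo n := by
      calc n = ∑ _ ∈ range n, 1 := by simp
        _ ≤ _ := sum_le_sum fun s _ => Nat.pos_of_ne_zero (h (s + 1))
    exact_mod_cast this

theorem height_eq {T : PlanarTree} {r : ℕ} (hr : T.gen r ≠ 0) (h : T.gen (r + 1) = 0) :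
    T.height = r := by
  refine IsGreatest.csSup_eq ⟨hr, fun s hs => ?_⟩
  by_contra! hrs
  exact hs (T.gen_eq_zero_of_le hrs h)

theorem cyl_eq_singleton {S : PlanarTree} {r : ℕ} (h : S.gen r = 0) : cyl S r = {S} := by
  ext T
  refine ⟨fun hT => ext_parents fun s => ?_, fun hT => by rw [hT]; exact mem_cyl_self S r⟩
  rcases lt_or_ge s r with hs | hs
  · exact mem_cyl.1 hT s hs
  · have h1 : T.gen r = 0 := by rw [gen_eq_of_mem_cyl hT le_rfl, h]
    have h2 := T.gen_eq_zero_of_le (show r ≤ s + 1 by omega) h1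
    have h3 := S.gen_eq_zero_of_le (show r ≤ s + 1 by omega) h
    rw [← card_parents, Multiset.card_eq_zero] at h2 h3
    rw [h2, h3]

theorem measure_inter_cyl (lam : Measure PlanarTree) {A : Set PlanarTree} (hA : MeasurableSet A)
    (S : PlanarTree) {r : ℕ} (hr : 1 ≤ r) :
    lam (A ∩ cyl S r) =
      ∑' m : Multiset (Fin (S.gen r)), lam (A ∩ cyl (S.extendFin r m) (r + 1)) := by
  have : Countable (Multiset (Fin (S.gen r))) := Quotient.countable
  conv_lhs => rw [cyl_eq_iUnion S hr, Set.inter_iUnion]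
  refine measure_iUnion (fun m m' h => ?_) fun m => hA.inter (measurableSet_cyl _ _)
  exact (pairwise_disjoint_cyl_extendFin S hr h).mono Set.inter_subset_right Set.inter_subset_right

theorem measure_cyl (lam : Measure PlanarTree) (S : PlanarTree) {r : ℕ} (hr : 1 ≤ r) :
    lam (cyl S r) =
      ∑' m : Multiset (Fin (S.gen r)), lam (cyl (S.extendFin r m) (r + 1)) := by
  simpa using measure_inter_cyl lam MeasurableSet.univ S hr

/-- The trees with `N` edges, weighted by `exp (-μ h)`. -/
noncomputable def sizeMeasure (μ : ℝ) (N : ℕ) : Measure PlanarTree :=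
  Measure.sum fun T : {T : PlanarTree // T.size = N} =>
    ENNReal.ofReal (Real.exp (-μ * T.1.height)) • Measure.dirac T.1

theorem sizeMeasure_apply (μ : ℝ) (N : ℕ) {A : Set PlanarTree} (hA : MeasurableSet A) :
    sizeMeasure μ N A = ∑' T : {T : PlanarTree // T.size = N},
      ENNReal.ofReal (Real.exp (-μ * T.1.height)) * A.indicator 1 T.1 := by
  rw [sizeMeasure, Measure.sum_apply _ hA]
  simp [Measure.dirac_apply' _ hA]

theorem partitionFunction_eq (μ : ℝ) (N : ℕ) : partitionFunction μ N = sizeMeasure μ N Set.univ := by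
  rw [sizeMeasure_apply _ _ MeasurableSet.univ, partitionFunction]
  simp

theorem finiteSizeMeasure_apply (μ : ℝ) (N : ℕ) {A : Set PlanarTree} (hA : MeasurableSet A) :
    finiteSizeMeasure μ N A = sizeMeasure μ N A / partitionFunction μ N := by
  rw [finiteSizeMeasure, Measure.sum_apply _ hA, sizeMeasure_apply _ _ hA, div_eq_mul_inv,
    ← ENNReal.tsum_mul_right]
  refine tsum_congr fun T => ?_
  rw [Measure.smul_apply, Measure.dirac_apply' _ hA, smul_eq_mul, div_eq_mul_inv]
  ring

theorem sizeMeasure_eq_zero (μ : ℝ) (N : ℕ) {A : Set PlanarTree} (hA : MeasurableSet A)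
    (h : ∀ T ∈ A, T.size ≠ N) : sizeMeasure μ N A = 0 := by
  rw [sizeMeasure_apply _ _ hA, ENNReal.tsum_eq_zero]
  rintro ⟨T, hT⟩
  rw [Set.indicator_of_notMem (fun hA => h T hA hT), mul_zero]

theorem sizeMeasure_singleton (μ : ℝ) (N : ℕ) {T : PlanarTree} (hT : T.size = N)
    (hm : MeasurableSet {T}) :
    sizeMeasure μ N {T} = ENNReal.ofReal (Real.exp (-μ * T.height)) := by
  rw [sizeMeasure_apply _ _ hm, tsum_eq_single ⟨T, hT⟩]
  · simp
  · rintro ⟨T', hT'⟩ hne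
    rw [Set.indicator_of_notMem, mul_zero]
    intro h
    exact hne (Subtype.ext h)

theorem sizeMeasure_cyl_of_lt (μ : ℝ) {N : ℕ} {S : PlanarTree} {r : ℕ} (h : N < S.sizeUpTo r) :
    sizeMeasure μ N (cyl S r) = 0 := by
  refine sizeMeasure_eq_zero μ N (measurableSet_cyl S r) fun T hT hs => ?_
  have h1 := T.sizeUpTo_le_size r
  rw [hs, sizeUpTo_congr hT] at h1
  have h2 : S.sizeUpTo r ≤ N := by exact_mod_cast h1
  omega

/-- The part above height r is a forest of K = `S.gen (r + 1)` planted trees whose root edges end at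
height r + 1. It has M + K edges, and the tree has height r plus that of the forest. Splitting the
cylinder by the next generation reproduces `forestWeight_rec`. -/
theorem sizeMeasure_cyl {μ : ℝ} (hμ : 0 < μ) (N : ℕ) (M : ℕ) (S : PlanarTree) (r : ℕ)
    (hK : S.gen (r + 1) ≠ 0) (hM : S.sizeUpTo (r + 1) + M = N) :
    sizeMeasure μ N (cyl S (r + 1)) = ENNReal.ofReal (Real.exp (-μ) ^ r *
      forestWeight (Real.exp (-μ)) (S.gen (r + 1)) (M + S.gen (r + 1))) := by
  have hq0 := Real.exp_pos (-μ)
  have hq1 := exp_neg_lt_one hμ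
  induction M using Nat.strong_induction_on generalizing S r with
  | _ M ih =>
    rw [measure_cyl _ S (by omega)]
    have hterm : ∀ m : Multiset (Fin (S.gen (r + 1))),
        sizeMeasure μ N (cyl (S.extendFin (r + 1) m) (r + 1 + 1)) =
          ENNReal.ofReal (Real.exp (-μ) ^ (r + 1) * forestWeight (Real.exp (-μ)) m.card M) := by
      intro m
      have hg := gen_extendFin S (show 1 ≤ r + 1 by omega) m
      have hs : (S.extendFin (r + 1) m).sizeUpTo (r + 1 + 1) = S.sizeUpTo (r + 1) + m.card := by
        rw [sizeUpTo_succ, hg, sizeUpTo_congr (extendFin_mem_cyl S (by omega) m)]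
      -- With an empty next generation the tree ends at height exactly r + 1, which fits the size N
      -- only if M = 0.
      rcases Nat.eq_zero_or_pos m.card with h0 | hpos
      · rw [h0] at hg hs
        have h1 : (S.extendFin (r + 1) m).gen (r + 1) ≠ 0 := by
          rwa [gen_eq_of_mem_cyl (extendFin_mem_cyl S (by omega) m) le_rfl]
        have h2 := size_eq_sizeUpTo hg
        rw [h0, forestWeight_zero_left hq0 hq1]
        have hc := measurableSet_cyl (S.extendFin (r + 1) m) (r + 1 + 1)
        rw [cyl_eq_singleton hg] at hc ⊢
        rw [sizeUpTo_succ, hg, add_zero, add_zero] at hs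
        rw [hs] at h2
        rcases Nat.eq_zero_or_pos M with hM0 | hM0
        · rw [sizeMeasure_singleton μ N (by rw [h2, ← hM, hM0, add_zero]) hc, height_eq h1 hg,
            if_pos hM0, mul_one, ← Real.exp_nat_mul]
          congr 2
          ring
        · rw [if_neg (by omega), mul_zero, ENNReal.ofReal_zero]
          refine sizeMeasure_eq_zero μ N hc fun T hT hTs => ?_
          rw [Set.mem_singleton_iff.1 hT, h2] at hTs
          have : S.sizeUpTo (r + 1) = N := by exact_mod_cast hTs
          omega
      · rcases lt_or_ge M m.card with h | h
        · rw [forestWeight_of_lt _ h, mul_zero, ENNReal.ofReal_zero]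
          exact sizeMeasure_cyl_of_lt μ (by omega)
        · rw [ih (M - m.card) (by omega) (S.extendFin (r + 1) m) (r + 1) (by omega) (by omega), hg,
            Nat.sub_add_cancel h]
    simp_rw [hterm]
    rw [tsum_multiset_card fun J =>
      ENNReal.ofReal (Real.exp (-μ) ^ (r + 1) * forestWeight (Real.exp (-μ)) J M), Fintype.card_fin,
      forestWeight_rec hq0 hq1 (Nat.pos_of_ne_zero hK), tsum_eq_sum (s := range (M + 1))]
    · rw [← mul_assoc, ← pow_succ, mul_sum, ENNReal.ofReal_sum_of_nonneg]
      · refine sum_congr rfl fun J _ => ?_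
        rw [← ENNReal.ofReal_natCast, ← ENNReal.ofReal_mul (Nat.cast_nonneg _)]
        congr 1
        ring
      · exact fun J _ => mul_nonneg (by positivity)
          (mul_nonneg (by positivity) (forestWeight_nonneg hq0 hq1 _ _))
    · intro J hJ
      rw [forestWeight_of_lt _ (by simpa using hJ)]
      simp

instance : Nonempty PlanarTree := ⟨ofParents fun _ => 0⟩

theorem partitionFunction_eq_forestWeight {μ : ℝ} (hμ : 0 < μ) {N : ℕ} (hN : 1 ≤ N) :
    partitionFunction μ N = ENNReal.ofReal (forestWeight (Real.exp (-μ)) 1 N) := by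
  obtain ⟨S⟩ := (inferInstance : Nonempty PlanarTree)
  rw [partitionFunction_eq, ← cyl_one S, sizeMeasure_cyl hμ N (N - 1) S 0 (by rw [S.gen_one]; simp)
    (by simp [sizeUpTo, S.gen_one]; omega), S.gen_one, pow_zero, one_mul, Nat.sub_add_cancel hN]

theorem isProbabilityMeasure_finiteSizeMeasure {μ : ℝ} (hμ : 0 < μ) {N : ℕ} (hN : 1 ≤ N) :
    IsProbabilityMeasure (finiteSizeMeasure μ N) := by
  constructor
  rw [finiteSizeMeasure_apply _ _ MeasurableSet.univ, ← partitionFunction_eq,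
    partitionFunction_eq_forestWeight hμ hN]
  refine ENNReal.div_self ?_ ENNReal.ofReal_ne_top
  rw [Ne, ENNReal.ofReal_eq_zero, not_le]
  exact forestWeight_one_pos (Real.exp_pos _) (exp_neg_lt_one hμ) hN

/-- The limiting mass of a cylinder. -/
noncomputable def cylWeight (μ : ℝ) (S : PlanarTree) (r : ℕ) : ℝ :=
  Real.exp (-μ) ^ r * limitWeight μ (S.gen (r + 1)) / 4 ^ S.sizeUpTo r

theorem tendsto_finiteSizeMeasure_cyl {μ : ℝ} (hμ : 0 < μ) (S : PlanarTree) (r : ℕ) :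
    Tendsto (fun N => finiteSizeMeasure μ N (cyl S (r + 1))) atTop
      (𝓝 (ENNReal.ofReal (cylWeight μ S r))) := by
  rcases Nat.eq_zero_or_pos (S.gen (r + 1)) with h0 | hpos
  -- Such a cylinder consists of one finite tree, which carries no mass for large N.
  · rw [cylWeight, h0, limitWeight_zero, mul_zero, zero_div, ENNReal.ofReal_zero]
    refine tendsto_const_nhds.congr' ?_
    filter_upwards [eventually_gt_atTop (S.sizeUpTo r)] with N hN
    rw [finiteSizeMeasure_apply _ _ (measurableSet_cyl _ _), sizeMeasure_eq_zero, ENNReal.zero_div]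
    · exact measurableSet_cyl _ _
    · intro T hT hs
      rw [cyl_eq_singleton h0] at hT
      rw [Set.mem_singleton_iff.1 hT, size_eq_sizeUpTo h0] at hs
      have : S.sizeUpTo r = N := by exact_mod_cast hs
      omega
  · have hq0 := Real.exp_pos (-μ)
    have hq1 := exp_neg_lt_one hμ
    have h1 := (tendsto_forestWeight_div hμ (S.gen (r + 1)) (S.gen (r + 1))
      (S.sizeUpTo (r + 1))).const_mul (Real.exp (-μ) ^ r)
    have h2 := ENNReal.tendsto_ofReal h1
    rw [← tendsto_add_atTop_iff_nat (S.sizeUpTo (r + 1))]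
    have h3 : Real.exp (-μ) ^ r * (limitWeight μ (S.gen (r + 1)) * 4 ^ S.gen (r + 1) /
        4 ^ S.sizeUpTo (r + 1)) = cylWeight μ S r := by
      rw [cylWeight, sizeUpTo_succ, pow_add]
      field_simp
    rw [h3] at h2
    refine h2.congr fun M => ?_
    have hN : 1 ≤ M + S.sizeUpTo (r + 1) := by
      rw [sizeUpTo_succ]
      omega
    have h4 := forestWeight_one_pos hq0 hq1 hN
    rw [finiteSizeMeasure_apply _ _ (measurableSet_cyl _ _),
      sizeMeasure_cyl hμ (M + S.sizeUpTo (r + 1)) M S r hpos.ne' (add_comm _ _),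
      partitionFunction_eq_forestWeight hμ hN,
      ← ENNReal.ofReal_div_of_pos h4, mul_div_assoc]

end PlanarTree

namespace PlanarTree

open Filter Topology Finset MeasureTheory ProbabilityTheory

/-! ### Construction of the limit -/

instance : MeasurableSpace (Multiset ℕ) := ⊤

instance : DiscreteMeasurableSpace (Multiset ℕ) := ⟨fun _ => trivial⟩

/-- The law of the next generation above `K` vertices. -/
noncomputable def stepMeasure (μ : ℝ) (K : ℕ) : Measure (Multiset ℕ) :=
  if K = 0 then Measure.dirac 0 else
    Measure.sum fun m : Multiset (Fin K) =>
      ENNReal.ofReal (Real.exp (-μ) * limitWeight μ m.card / (4 ^ K * limitWeight μ K)) •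
        Measure.dirac (m.map Fin.val)

/-- The eigenvalue equation for w is precisely the normalization of this Doob transform; the case K
= 0 is a convention. -/
theorem isProbabilityMeasure_stepMeasure {μ : ℝ} (hμ : 0 < μ) (K : ℕ) :
    IsProbabilityMeasure (stepMeasure μ K) := by
  rw [stepMeasure]
  split_ifs with h
  · infer_instance
  · constructor
    have hK := limitWeight_pos hμ (Nat.pos_of_ne_zero h)
    rw [Measure.sum_apply _ MeasurableSet.univ]
    simp only [Measure.smul_apply, measure_univ, smul_eq_mul, mul_one]
    rw [tsum_multiset_card fun J =>
      ENNReal.ofReal (Real.exp (-μ) * limitWeight μ J / (4 ^ K * limitWeight μ K)), Fintype.card_fin]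
    have h1 : ∀ J, (Nat.multichoose K J : ENNReal) *
        ENNReal.ofReal (Real.exp (-μ) * limitWeight μ J / (4 ^ K * limitWeight μ K)) =
        (Nat.multichoose K J : ENNReal) * ENNReal.ofReal (limitWeight μ J) *
          ENNReal.ofReal (Real.exp (-μ) / (4 ^ K * limitWeight μ K)) := by
      intro J
      rw [mul_assoc, ← ENNReal.ofReal_mul (limitWeight_nonneg hμ J)]
      congr 2
      ring
    simp_rw [h1]
    rw [ENNReal.tsum_mul_right, tsum_multichoose_mul_limitWeight hμ,
      ← ENNReal.ofReal_mul (by positivity), ← ENNReal.ofReal_one, Real.exp_neg]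
    congr 1
    field_simp

theorem stepMeasure_singleton {μ : ℝ} {K : ℕ} (hK : K ≠ 0) (m : Multiset (Fin K)) :
    stepMeasure μ K {m.map Fin.val} =
      ENNReal.ofReal (Real.exp (-μ) * limitWeight μ m.card / (4 ^ K * limitWeight μ K)) := by
  rw [stepMeasure, if_neg hK, Measure.sum_apply _ (MeasurableSet.singleton _),
    tsum_eq_single m]
  · simp
  · intro m' hne
    have : m'.map Fin.val ≠ m.map Fin.val := fun h =>
      hne (Multiset.map_injective Fin.val_injective h)
    simp [this]

theorem stepMeasure_of_exists_le {μ : ℝ} {K : ℕ} {m : Multiset ℕ} (hm : ∃ x ∈ m, K ≤ x) :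
    stepMeasure μ K {m} = 0 := by
  obtain ⟨x, hx, hKx⟩ := hm
  rw [stepMeasure]
  split_ifs with h
  · have : (0 : Multiset ℕ) ≠ m := fun h0 => by
      rw [← h0] at hx
      simp at hx
    simp [this]
  · rw [Measure.sum_apply _ (MeasurableSet.singleton _), ENNReal.tsum_eq_zero]
    intro m'
    have : m'.map Fin.val ≠ m := fun h0 => by
      rw [← h0] at hx
      obtain ⟨i, -, rfl⟩ := Multiset.mem_map.1 hx
      exact absurd i.2 (not_lt.2 hKx)
    simp [this]

/-- The transition kernels of the generations. -/
noncomputable def stepKernel (μ : ℝ) (n : ℕ) : Kernel ((i : Iic n) → Multiset ℕ) (Multiset ℕ) :=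
  Kernel.ofFunOfCountable fun x => stepMeasure μ (x ⟨n, mem_Iic.2 le_rfl⟩).card

theorem stepKernel_apply (μ : ℝ) (n : ℕ) (x : (i : Iic n) → Multiset ℕ) :
    stepKernel μ n x = stepMeasure μ (x ⟨n, mem_Iic.2 le_rfl⟩).card := rfl

/-- Ionescu–Tulcea applied to the step kernels, started from the single vertex at height 1. -/
theorem exists_measure_generations {μ : ℝ} (hμ : 0 < μ) :
    ∃ P : Measure (ℕ → Multiset ℕ), IsProbabilityMeasure P ∧ (∀ᵐ M ∂P, M 0 = {0}) ∧
      ∀ (n : ℕ) (y : ℕ → Multiset ℕ), P {M | ∀ s ≤ n + 1, M s = y s} =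
        P {M | ∀ s ≤ n, M s = y s} * stepMeasure μ (y n).card {y (n + 1)} := by
  have hmarkov : ∀ n, IsMarkovKernel (stepKernel μ n) := fun n =>
    ⟨fun x => by rw [stepKernel_apply]; exact isProbabilityMeasure_stepMeasure hμ _⟩
  set x₀ : (i : Iic 0) → Multiset ℕ := fun _ => {0} with hx₀
  have hset : ∀ (n : ℕ) (y : ℕ → Multiset ℕ), {M : ℕ → Multiset ℕ | ∀ s ≤ n, M s = y s} =
      Preorder.frestrictLe (π := fun _ => Multiset ℕ) n ⁻¹'
        {Preorder.frestrictLe (π := fun _ => Multiset ℕ) n y} := by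
    intro n y
    ext M
    simp [funext_iff]
  refine ⟨Kernel.traj (X := fun _ => Multiset ℕ) (stepKernel μ) 0 x₀, inferInstance, ?_,
    fun n y => ?_⟩
  · have h := Kernel.traj_map_frestrictLe_apply (X := fun _ => Multiset ℕ) (κ := stepKernel μ) 0 0 x₀
    rw [Kernel.partialTraj_self, Kernel.id_apply] at h
    have h1 : Kernel.traj (X := fun _ => Multiset ℕ) (stepKernel μ) 0 x₀
        (Preorder.frestrictLe (π := fun _ => Multiset ℕ) 0 ⁻¹' {x₀})ᶜ = 0 := by
      rw [← Set.preimage_compl, ← Measure.map_apply (Preorder.measurable_frestrictLe 0)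
        (MeasurableSet.singleton _).compl, h]
      simp
    rw [ae_iff]
    refine measure_mono_null (fun M hM => ?_) h1
    refine fun hM' => hM ?_
    have h2 := congrFun (Set.mem_singleton_iff.1 hM') ⟨0, mem_Iic.2 le_rfl⟩
    simpa using h2
  · have h := Kernel.partialTraj_compProd_eq_map_traj (X := fun _ => Multiset ℕ)
      (κ := stepKernel μ) (Nat.zero_le n) (x₀ := x₀)
    have h1 : {M : ℕ → Multiset ℕ | ∀ s ≤ n + 1, M s = y s} =
        (fun x : ℕ → Multiset ℕ => (Preorder.frestrictLe (π := fun _ => Multiset ℕ) n x, x (n + 1))) ⁻¹'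
          ({Preorder.frestrictLe (π := fun _ => Multiset ℕ) n y} ×ˢ {y (n + 1)}) := by
      ext M
      simp only [Set.mem_ofPred_eq, Set.mem_preimage, Set.mem_prod, Set.mem_singleton_iff]
      constructor
      · intro hM
        exact ⟨by ext1 i; exact hM i.1 ((mem_Iic.1 i.2).trans (Nat.le_succ n)), hM _ le_rfl⟩
      · rintro ⟨hM1, hM2⟩ s hs
        rcases Nat.lt_or_ge n s with h | h
        · obtain rfl : s = n + 1 := by omega
          exact hM2
        · exact congrFun hM1 ⟨s, mem_Iic.2 h⟩
    rw [h1, ← Measure.map_apply (by fun_prop) ((MeasurableSet.singleton _).prod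
      (MeasurableSet.singleton _)), ← h, Measure.compProd_apply_prod (MeasurableSet.singleton _)
      (MeasurableSet.singleton _), Measure.restrict_singleton, lintegral_smul_measure,
      lintegral_dirac, hset n y, ← Kernel.traj_map_frestrictLe_apply,
      Measure.map_apply (Preorder.measurable_frestrictLe n) (MeasurableSet.singleton _),
      stepKernel_apply, smul_eq_mul]
    rfl

theorem measurable_admissible (s : ℕ) :
    Measurable fun M : ℕ → Multiset ℕ => admissible M s := by
  induction s with
  | zero => exact measurable_const
  | succ s ih =>
    have h1 : Measurable fun M : ℕ → Multiset ℕ => (M (s + 1), admissible M s) :=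
      (measurable_pi_apply (s + 1)).prodMk ih
    exact (Measurable.of_discrete (f := fun p : Multiset ℕ × Multiset ℕ =>
      p.1.filter (· < p.2.card))).comp h1

theorem measurable_ofParents : Measurable ofParents :=
  measurable_of_parents fun r m => by
    simp_rw [parents_ofParents]
    exact measurable_admissible r (MeasurableSet.singleton m)

theorem cylWeight_zero (μ : ℝ) (S : PlanarTree) : cylWeight μ S 0 = 1 := by
  simp [cylWeight, S.gen_one, limitWeight_one, sizeUpTo]

theorem cylWeight_nonneg {μ : ℝ} (hμ : 0 < μ) (S : PlanarTree) (r : ℕ) : 0 ≤ cylWeight μ S r :=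
  div_nonneg (mul_nonneg (by positivity) (limitWeight_nonneg hμ _)) (by positivity)

/-- There is a probability measure which gives to every cylinder its limiting mass. -/
theorem exists_measure_cyl {μ : ℝ} (hμ : 0 < μ) :
    ∃ ν : Measure PlanarTree, IsProbabilityMeasure ν ∧
      ∀ S r, ν (cyl S (r + 1)) = ENNReal.ofReal (cylWeight μ S r) := by
  obtain ⟨P, hP, h0, hstep⟩ := exists_measure_generations hμ
  refine ⟨P.map ofParents, Measure.isProbabilityMeasure_map measurable_ofParents.aemeasurable,
    fun S r => ?_⟩
  -- Sequences with an impossible parent are covered by countably many cylinders, each null because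
  -- the last step has probability 0.
  have hadm : ∀ s, ∀ᵐ M ∂P, ∀ x ∈ M (s + 1), x < (M s).card := by
    intro s
    have h1 : {M : ℕ → Multiset ℕ | ¬ ∀ x ∈ M (s + 1), x < (M s).card} ⊆
        ⋃ y ∈ {y : Iic (s + 1) → Multiset ℕ | ∃ x ∈ y ⟨s + 1, mem_Iic.2 le_rfl⟩,
            (y ⟨s, mem_Iic.2 (Nat.le_succ s)⟩).card ≤ x},
          {M : ℕ → Multiset ℕ | ∀ t ≤ s + 1,
            M t = (fun t => if h : t ≤ s + 1 then y ⟨t, mem_Iic.2 h⟩ else 0) t} := by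
      intro M hM
      simp only [Set.mem_ofPred_eq, not_forall, not_lt] at hM
      obtain ⟨x, hx, hle⟩ := hM
      refine Set.mem_biUnion (x := fun i : Iic (s + 1) => M i.1) ⟨x, hx, hle⟩ fun t ht => ?_
      simp [ht]
    refine measure_mono_null h1 ((measure_biUnion_null_iff (Set.to_countable _)).2 fun y hy => ?_)
    rw [hstep s, stepMeasure_of_exists_le, mul_zero]
    simpa using hy
  have hall : ∀ᵐ M ∂P, ∀ s, admissible M s = M s := by
    filter_upwards [h0, ae_all_iff.2 hadm] with M hM0 hM s
    exact admissible_eq_of_forall hM0 (n := s) (fun t _ => hM t) le_rfl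
  have h2 : (P.map ofParents) (cyl S (r + 1)) = P {M | ∀ s ≤ r, M s = S.parents s} := by
    rw [Measure.map_apply measurable_ofParents (measurableSet_cyl _ _)]
    refine measure_congr ?_
    filter_upwards [hall] with M hM
    refine propext ?_
    change ofParents M ∈ cyl S (r + 1) ↔ ∀ s ≤ r, M s = S.parents s
    rw [mem_cyl]
    simp_rw [parents_ofParents, hM, Nat.lt_succ_iff]
  rw [h2]
  induction r with
  | zero =>
    rw [cylWeight_zero, ENNReal.ofReal_one, ← measure_univ (μ := P)]
    refine measure_congr ?_
    filter_upwards [h0] with M hM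
    refine propext ?_
    change (∀ s ≤ 0, M s = S.parents s) ↔ True
    simp [parents_zero, hM]
  | succ r ih =>
    rw [hstep, ih, card_parents]
    · rcases Nat.eq_zero_or_pos (S.gen (r + 1)) with hK | hK
      · have hK' := S.gen_eq_zero_of_le (Nat.le_succ (r + 1)) hK
        simp only [cylWeight, hK, Nat.succ_eq_add_one] at hK' ⊢
        simp [hK', limitWeight_zero]
      · have hlt : ∀ x ∈ S.parents (r + 1), x < S.gen (r + 1) := fun x hx => lt_of_mem_parents hx
        set m := (S.parents (r + 1)).pmap (fun x hx => (⟨x, hx⟩ : Fin (S.gen (r + 1)))) hlt with hm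
        have hm1 : m.map Fin.val = S.parents (r + 1) := by
          rw [hm, Multiset.map_pmap, Multiset.pmap_eq_map, Multiset.map_id']
        have hm2 : m.card = S.gen (r + 1 + 1) := by rw [hm, Multiset.card_pmap, card_parents]
        rw [← hm1, stepMeasure_singleton hK.ne', ← ENNReal.ofReal_mul (cylWeight_nonneg hμ S r), hm2]
        congr 1
        have hf := limitWeight_pos hμ hK
        rw [cylWeight, cylWeight, sizeUpTo_succ]
        field_simp
        rw [pow_add]
        ring
    · rw [Measure.map_apply measurable_ofParents (measurableSet_cyl _ _)]
      refine measure_congr ?_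
      filter_upwards [hall] with M hM
      refine propext ?_
      change ofParents M ∈ cyl S (r + 1) ↔ ∀ s ≤ r, M s = S.parents s
      rw [mem_cyl]
      simp_rw [parents_ofParents, hM, Nat.lt_succ_iff]

/-! ### From cylinder masses to weak convergence -/

/-- An open set is an increasing union of countable disjoint unions of cylinders of equal depth.
Finite subunions converge in mass and exhaust the mass of ν, so tightness is not needed for the
portmanteau criterion. -/
theorem le_liminf_of_isOpen {ν : Measure PlanarTree} {νs : ℕ → Measure PlanarTree}
    (h : ∀ S r, Tendsto (fun N => νs N (cyl S (r + 1))) atTop (𝓝 (ν (cyl S (r + 1)))))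
    {U : Set PlanarTree} (hU : IsOpen U) : ν U ≤ liminf (fun N => νs N U) atTop := by
  set A : ℕ → Set PlanarTree := fun r => {T | cyl T (r + 1) ⊆ U} with hA
  have hAU : U = ⋃ r, A r := by
    refine Set.Subset.antisymm (fun T hT => ?_) (Set.iUnion_subset fun r T hT => hT (mem_cyl_self T _))
    obtain ⟨r, hr⟩ := exists_cyl_subset hU hT
    refine Set.mem_iUnion.2 ⟨r, fun T' hT' => hr (mem_cyl.2 fun s hs => ?_)⟩
    exact mem_cyl.1 hT' s (by omega)
  have hmono : Monotone A := monotone_nat_of_le_succ fun r T hT T' hT' =>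
    hT (mem_cyl.2 fun s hs => mem_cyl.1 hT' s (by omega))
  conv_lhs => rw [hAU]
  rw [hmono.measure_iUnion]
  refine iSup_le fun r => ?_
  set D : Set (List (Multiset ℕ)) := (fun T : PlanarTree => T.history (r + 1)) '' A r with hD
  choose S hS hSl using fun l : D => l.2
  have hAr : A r = ⋃ l : D, cyl (S l) (r + 1) := by
    refine Set.Subset.antisymm (fun T hT => Set.mem_iUnion.2 ⟨⟨_, T, hT, rfl⟩, ?_⟩)
      (Set.iUnion_subset fun l T hT => ?_)
    · exact (hSl ⟨_, T, hT, rfl⟩).symm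
    · intro T' hT'
      exact hS l (Eq.trans (show T'.history (r + 1) = T.history (r + 1) from hT') hT)
  have hdisj : Pairwise (Function.onFun Disjoint fun l : D => cyl (S l) (r + 1)) := by
    intro l l' hne
    refine Set.disjoint_left.2 fun T h1 h2 => hne (Subtype.ext ?_)
    rw [← hSl l, ← hSl l']
    exact Eq.trans (Eq.symm h1) h2
  rw [hAr, measure_iUnion hdisj fun l => measurableSet_cyl _ _, ENNReal.tsum_eq_iSup_sum]
  refine iSup_le fun F => ?_
  have h1 : Tendsto (fun N => ∑ l ∈ F, νs N (cyl (S l) (r + 1))) atTop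
      (𝓝 (∑ l ∈ F, ν (cyl (S l) (r + 1)))) := tendsto_finsetSum F fun l _ => h (S l) r
  rw [← h1.liminf_eq]
  refine liminf_le_liminf (Eventually.of_forall fun N => ?_)
  rw [← measure_biUnion_finset (fun l _ l' _ hne => hdisj hne) fun l _ => measurableSet_cyl _ _]
  exact measure_mono (Set.iUnion₂_subset fun l _ => hS l)

theorem isLocalLimit_of_cyl {μ : ℝ} (hμ : 0 < μ) {ν : Measure PlanarTree} [IsProbabilityMeasure ν]
    (h : ∀ S r, ν (cyl S (r + 1)) = ENNReal.ofReal (cylWeight μ S r)) : IsLocalLimit μ ν := by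
  refine ⟨inferInstance, fun F => ?_⟩
  -- There is no tree with 0 edges, so only sizes N ≥ 1 give probability measures.
  rw [← tendsto_add_atTop_iff_nat 1]
  have hp : ∀ N, IsProbabilityMeasure (finiteSizeMeasure μ (N + 1)) := fun N =>
    isProbabilityMeasure_finiteSizeMeasure hμ (by omega)
  let νs : ℕ → ProbabilityMeasure PlanarTree := fun N => ⟨finiteSizeMeasure μ (N + 1), hp N⟩
  let ν₀ : ProbabilityMeasure PlanarTree := ⟨ν, inferInstance⟩
  have h1 : Tendsto νs atTop (𝓝 ν₀) := by
    refine tendsto_of_forall_isOpen_le_liminf_nat' fun U hU => ?_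
    refine le_liminf_of_isOpen (ν := ν) (fun S r => ?_) hU
    rw [h]
    exact (tendsto_add_atTop_iff_nat 1).2 (tendsto_finiteSizeMeasure_cyl hμ S r)
  exact (ProbabilityMeasure.tendsto_iff_forall_integral_tendsto.1 h1) F

theorem IsLocalLimit.unique {μ : ℝ} {ν ν' : Measure PlanarTree} (h : IsLocalLimit μ ν)
    (h' : IsLocalLimit μ ν') : ν = ν' := by
  have := h.1
  have := h'.1
  exact ext_of_forall_integral_eq_of_IsFiniteMeasure fun F =>
    tendsto_nhds_unique (h.2 F) (h'.2 F)

theorem existsUnique_isLocalLimit {μ : ℝ} (hμ : 0 < μ) : ∃! ν, IsLocalLimit μ ν := by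
  obtain ⟨ν, hν, h⟩ := exists_measure_cyl hμ
  exact ⟨ν, isLocalLimit_of_cyl hμ h, fun ν' h' => h'.unique (isLocalLimit_of_cyl hμ h)⟩

theorem IsLocalLimit.measure_cyl {μ : ℝ} (hμ : 0 < μ) {ν : Measure PlanarTree}
    (h : IsLocalLimit μ ν) (S : PlanarTree) (r : ℕ) :
    ν (cyl S (r + 1)) = ENNReal.ofReal (cylWeight μ S r) := by
  obtain ⟨ν', hν', h'⟩ := exists_measure_cyl hμ
  rw [h.unique (isLocalLimit_of_cyl hμ h'), h']

end PlanarTree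

namespace PlanarTree

open Filter Topology Finset MeasureTheory ProbabilityTheory

/-! ### Vertices of infinite type -/

/-- The vertex `(r, i)` has a descendant at height `r + n`. -/
def Reaches (T : PlanarTree) (r n i : ℕ) : Prop := ∃ j < T.gen (r + n), T.ancestor r n j = i

theorem Reaches.lt {T : PlanarTree} {r n i : ℕ} (h : T.Reaches r n i) : i < T.gen r := by
  obtain ⟨j, hj, rfl⟩ := h
  exact ancestor_lt T r n j hj

theorem reaches_zero {T : PlanarTree} {r i : ℕ} : T.Reaches r 0 i ↔ i < T.gen r :=
  ⟨Reaches.lt, fun h => ⟨i, h, rfl⟩⟩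

theorem reaches_succ {T : PlanarTree} {r n i : ℕ} :
    T.Reaches r (n + 1) i ↔ ∃ j, T.Reaches (r + 1) n j ∧ T.parent r j = i := by
  constructor
  · rintro ⟨k, hk, rfl⟩
    exact ⟨_, ⟨k, by rwa [add_assoc, add_comm 1 n], rfl⟩, (ancestor_succ' T r n k).symm⟩
  · rintro ⟨_, ⟨k, hk, rfl⟩, rfl⟩
    exact ⟨k, by rwa [add_assoc, add_comm 1 n] at hk, ancestor_succ' T r n k⟩

theorem Reaches.mono {T : PlanarTree} {r n m i : ℕ} (hnm : n ≤ m) (h : T.Reaches r m i) :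
    T.Reaches r n i := by
  induction m, hnm using Nat.le_induction with
  | base => exact h
  | succ m _ ih =>
    obtain ⟨j, hj, rfl⟩ := h
    exact ih ⟨T.parent (r + m) j, T.parent_lt _ _ hj, rfl⟩

theorem infiniteType_iff {T : PlanarTree} {r i : ℕ} :
    T.InfiniteType r i ↔ ∀ n, T.Reaches r n i := by
  constructor
  · intro h n
    by_contra hn
    refine h.2 (((Set.finite_Iio n).biUnion fun k _ =>
      (Set.finite_Iio (T.gen (r + k))).image (Prod.mk k)).subset ?_)
    rintro ⟨k, j⟩ ⟨h1, h2⟩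
    refine Set.mem_biUnion (x := k) ?_ ⟨j, h1, rfl⟩
    by_contra hk
    exact hn (Reaches.mono (not_lt.1 hk) ⟨j, h1, h2⟩)
  · intro h
    refine ⟨(h 0).lt, ?_⟩
    choose j hj hij using h
    exact Set.infinite_of_injective_forall_mem (f := fun n => (n, j n))
      (fun a b hab => (Prod.mk.inj hab).1) fun n => ⟨hj n, hij n⟩

/-- Each vertex of finite type fails to reach some height; as generations are finite, one height
works for all. This is the compactness in König's lemma, and it yields an infinite child of every
infinite vertex. -/
theorem exists_forall_reaches (T : PlanarTree) (r : ℕ) :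
    ∃ n, ∀ i, T.Reaches r n i → T.InfiniteType r i := by
  have h : ∀ i, ∃ n, T.Reaches r n i → T.InfiniteType r i := by
    intro i
    by_contra! h
    exact (h 0).2 (infiniteType_iff.2 fun n => (h n).1)
  choose n hn using h
  refine ⟨(range (T.gen r)).sup n, fun i hi => hn i (hi.mono ?_)⟩
  exact le_sup (f := n) (mem_range.2 hi.lt)

theorem infiniteType_iff_exists_child {T : PlanarTree} {r i : ℕ} :
    T.InfiniteType r i ↔ ∃ j, T.InfiniteType (r + 1) j ∧ T.parent r j = i := by
  constructor
  · intro h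
    obtain ⟨n, hn⟩ := T.exists_forall_reaches (r + 1)
    obtain ⟨j, hj, rfl⟩ := reaches_succ.1 (infiniteType_iff.1 h (n + 1))
    exact ⟨j, hn j hj, rfl⟩
  · rintro ⟨j, hj, rfl⟩
    exact hj.parent

open Classical in
/-- The vertices of infinite type at height `r`. -/
noncomputable def infiniteVertices (T : PlanarTree) (r : ℕ) : Finset ℕ :=
  (range (T.gen r)).filter (T.InfiniteType r)

theorem mem_infiniteVertices {T : PlanarTree} {r i : ℕ} :
    i ∈ T.infiniteVertices r ↔ T.InfiniteType r i := by
  simp only [infiniteVertices, mem_filter, mem_range, and_iff_right_iff_imp]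
  exact fun h => h.1

theorem infiniteVertices_subset_range (T : PlanarTree) (r : ℕ) :
    T.infiniteVertices r ⊆ range (T.gen r) := fun _ hi =>
  mem_range.2 (mem_infiniteVertices.1 hi).1

theorem infiniteVertices_eq_image (T : PlanarTree) (r : ℕ) :
    T.infiniteVertices r = (T.infiniteVertices (r + 1)).image (T.parent r) := by
  ext i
  simp only [mem_infiniteVertices, mem_image]
  exact infiniteType_iff_exists_child

theorem gen_spine (T : InfiniteTree) (r : ℕ) :
    (spine T).gen r = (T.1.infiniteVertices r).card := by
  classical
  change Nat.count _ _ = _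
  rw [Nat.count_eq_card_filter_range, infiniteVertices]

/-- The children of the vertices in `I` at height `r`. -/
def children (T : PlanarTree) (r : ℕ) (I : Finset ℕ) : Finset ℕ :=
  (range (T.gen (r + 1))).filter fun j => T.parent r j ∈ I

theorem card_children (T : PlanarTree) (r : ℕ) (I : Finset ℕ) :
    (T.children r I).card = (T.parents r).countP (· ∈ I) := by
  rw [parents, Multiset.countP_map]
  rfl

theorem infiniteVertices_subset_iff {T : PlanarTree} {r : ℕ} {I : Finset ℕ} :
    T.infiniteVertices r ⊆ I ↔ T.infiniteVertices (r + 1) ⊆ T.children r I := by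
  rw [T.infiniteVertices_eq_image r, image_subset_iff]
  refine ⟨fun h j hj => ?_, fun h j hj => (mem_filter.1 (h hj)).2⟩
  exact mem_filter.2 ⟨T.infiniteVertices_subset_range _ hj, h j hj⟩

/-- The trees in which all vertices at height `r` with descendants at height `r + n` are in `I`. -/
def reachSet (r n : ℕ) (I : Finset ℕ) : Set PlanarTree := {T | ∀ i, T.Reaches r n i → i ∈ I}

theorem monotone_reachSet (r : ℕ) (I : Finset ℕ) : Monotone fun n => reachSet r n I :=
  fun _ _ hnm _ hT i hi => hT i (hi.mono hnm)

/-- Replacing I by its children moves the condition up one generation and lowers n by one, which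
permits induction on n. -/
theorem mem_reachSet_succ {T : PlanarTree} {r n : ℕ} {I : Finset ℕ} :
    T ∈ reachSet r (n + 1) I ↔ T ∈ reachSet (r + 1) n (T.children r I) := by
  constructor
  · intro h j hj
    exact mem_filter.2 ⟨mem_range.2 hj.lt, h _ (reaches_succ.2 ⟨j, hj, rfl⟩)⟩
  · intro h i hi
    obtain ⟨j, hj, rfl⟩ := reaches_succ.1 hi
    exact (mem_filter.1 (h j hj)).2

theorem iUnion_reachSet (r : ℕ) (I : Finset ℕ) :
    ⋃ n, reachSet r n I = {T | T.infiniteVertices r ⊆ I} := by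
  ext T
  simp only [Set.mem_iUnion, Set.mem_ofPred_eq]
  constructor
  · rintro ⟨n, hn⟩ i hi
    exact hn i (infiniteType_iff.1 (mem_infiniteVertices.1 hi) n)
  · intro h
    obtain ⟨n, hn⟩ := T.exists_forall_reaches r
    exact ⟨n, fun i hi => h (mem_infiniteVertices.2 (hn i hi))⟩

theorem children_eq_of_mem_cyl {S T : PlanarTree} {r : ℕ} (h : T ∈ cyl S (r + 1)) (I : Finset ℕ) :
    T.children r I = S.children r I := by
  rw [children, children, gen_eq_of_mem_cyl h le_rfl, parent_eq_of_mem_cyl h (Nat.lt_succ_self r)]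

/-- The infinite vertices of a generation are the parents of those in the next, so the top
generation determines all lower ones. Past increments are therefore functions of the history and of
the present infinite set. -/
theorem infiniteVertices_eq_of_mem_cyl {S T : PlanarTree} {r : ℕ} (h : T ∈ cyl S r)
    (hr : T.infiniteVertices r = S.infiniteVertices r) {s : ℕ} (hs : s ≤ r) :
    T.infiniteVertices s = S.infiniteVertices s := by
  induction hs using Nat.decreasingInduction with
  | self => exact hr
  | of_succ s hs ih =>
    rw [T.infiniteVertices_eq_image, S.infiniteVertices_eq_image, ih, parent_eq_of_mem_cyl h hs]

theorem ancestor_eq_of_mem_cyl {S T : PlanarTree} {r n : ℕ} (h : T ∈ cyl S (r + n)) (j : ℕ) :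
    T.ancestor r n j = S.ancestor r n j := by
  induction n generalizing j with
  | zero => rfl
  | succ n ih =>
    rw [ancestor, ancestor, parent_eq_of_mem_cyl h (by omega)]
    exact ih (mem_cyl.2 fun s hs => mem_cyl.1 h s (by omega)) _

theorem measurableSet_reaches (r n i : ℕ) : MeasurableSet {T : PlanarTree | T.Reaches r n i} := by
  refine measurableSet_of_history (r := r + n) fun T T' h => ?_
  have hT : T' ∈ cyl T (r + n) := h
  rintro ⟨j, hj, hij⟩
  exact ⟨j, by rwa [gen_eq_of_mem_cyl hT le_rfl], by rwa [ancestor_eq_of_mem_cyl hT]⟩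

theorem measurableSet_reachSet (r n : ℕ) (I : Finset ℕ) : MeasurableSet (reachSet r n I) := by
  have : reachSet r n I = ⋂ i, {T : PlanarTree | T.Reaches r n i → i ∈ I} := by
    ext T
    simp [reachSet]
  rw [this]
  refine MeasurableSet.iInter fun i => ?_
  by_cases hi : i ∈ I
  · simp [hi]
  · simp only [hi, imp_false]
    exact (measurableSet_reaches r n i).compl

theorem measurableSet_infiniteType (r i : ℕ) :
    MeasurableSet {T : PlanarTree | T.InfiniteType r i} := by
  simp_rw [infiniteType_iff, Set.ofPred_forall]
  exact MeasurableSet.iInter fun n => measurableSet_reaches r n i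

theorem measurableSet_infiniteVertices (r : ℕ) (I : Finset ℕ) :
    MeasurableSet {T : PlanarTree | T.infiniteVertices r = I} := by
  simp_rw [Finset.ext_iff, mem_infiniteVertices, Set.ofPred_forall]
  refine MeasurableSet.iInter fun i => ?_
  by_cases hi : i ∈ I
  · simpa [hi] using measurableSet_infiniteType r i
  · simp only [hi, iff_false]
    exact (measurableSet_infiniteType r i).compl

theorem measurableSet_of_infiniteVertices (r : ℕ) (p : Finset ℕ → Prop) :
    MeasurableSet {T : PlanarTree | p (T.infiniteVertices r)} := by
  have : {T : PlanarTree | p (T.infiniteVertices r)} =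
      ⋃ I ∈ {I | p I}, {T : PlanarTree | T.infiniteVertices r = I} := by
    ext T
    simp
  rw [this]
  exact MeasurableSet.biUnion (Set.to_countable _) fun I _ => measurableSet_infiniteVertices r I

end PlanarTree

namespace PlanarTree

open Filter Topology Finset MeasureTheory ProbabilityTheory

/-! ### The joint law of a tree and of its vertices of infinite type -/

theorem card_subtype_val_mem {K : ℕ} {I : Finset ℕ} (hI : I ⊆ range K) :
    Fintype.card {x : Fin K // x.1 ∈ I} = I.card := by
  rw [Fintype.card_subtype, ← card_map Fin.valEmbedding]
  congr 1
  ext i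
  simp only [Finset.mem_map, mem_filter, mem_univ, true_and, Fin.valEmbedding_apply]
  constructor
  · rintro ⟨x, hx, rfl⟩
    exact hx
  · exact fun hi => ⟨⟨i, mem_range.1 (hI hi)⟩, hi, rfl⟩

theorem card_subtype_val_notMem {K : ℕ} {I : Finset ℕ} (hI : I ⊆ range K) :
    Fintype.card {x : Fin K // ¬ x.1 ∈ I} = K - I.card := by
  rw [Fintype.card_subtype_compl, card_subtype_val_mem hI, Fintype.card_fin]

theorem tsum_multichoose_mul_pow {x : ℝ} (h0 : 0 ≤ x) (h1 : x < 1) (K : ℕ) :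
    ∑' J, (Nat.multichoose K J : ENNReal) * ENNReal.ofReal (x ^ J) =
      ENNReal.ofReal ((1 / (1 - x)) ^ K) := by
  have h := hasSum_multichoose_mul_pow K h0 h1
  have h2 : ((1 / (1 - x)) ^ K) = ∑' J, (Nat.multichoose K J : ℝ) * x ^ J := by
    rw [h.tsum_eq]
    simp
  rw [h2, ENNReal.ofReal_tsum_of_nonneg (fun J => by positivity) h.summable]
  refine tsum_congr fun J => ?_
  rw [ENNReal.ofReal_mul (by positivity), ENNReal.ofReal_natCast]

/-- The sum over the possible sets of children of `K` vertices, where the children of the vertices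
in `I` are weighted by `g` and those of the other vertices by a power of `x`. -/
theorem tsum_multiset_fin {K : ℕ} {I : Finset ℕ} (hI : I ⊆ range K) {c x G : ℝ} {g : ℕ → ℝ}
    (hc : 0 ≤ c) (h0 : 0 ≤ x) (h1 : x < 1)
    (hG : ∑' J, (Nat.multichoose I.card J : ENNReal) * ENNReal.ofReal (g J) = ENNReal.ofReal G) :
    ∑' m : Multiset (Fin K), ENNReal.ofReal
        (c * (x ^ (m.countP fun i => ¬ i.1 ∈ I) * g (m.countP fun i => i.1 ∈ I))) =
      ENNReal.ofReal (c * ((1 / (1 - x)) ^ (K - I.card) * G)) := by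
  have hx : 0 ≤ (1 / (1 - x)) ^ (K - I.card) := by
    have : 0 < 1 - x := by linarith
    positivity
  rw [tsum_multiset_countP (fun i : Fin K => i.1 ∈ I) fun J J' =>
    ENNReal.ofReal (c * (x ^ J' * g J)), card_subtype_val_mem hI, card_subtype_val_notMem hI,
    ENNReal.ofReal_mul hc, ENNReal.ofReal_mul hx, ← hG, ← tsum_multichoose_mul_pow h0 h1,
    ← ENNReal.tsum_mul_left, ← ENNReal.tsum_mul_left]
  refine tsum_congr fun J => ?_
  rw [← ENNReal.tsum_mul_right, ← ENNReal.tsum_mul_left, ← ENNReal.tsum_mul_left]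
  refine tsum_congr fun J' => ?_
  rw [ENNReal.ofReal_mul hc, ENNReal.ofReal_mul (by positivity)]
  ring

/-- The probability that a critical geometric Galton-Watson tree has height less than `n`. -/
noncomputable def extinction (n : ℕ) : ℝ := n / (2 * (n + 1))

theorem extinction_nonneg (n : ℕ) : 0 ≤ extinction n := by
  rw [extinction]
  positivity

theorem extinction_lt_one (n : ℕ) : extinction n < 1 := by
  rw [extinction, div_lt_one (by positivity)]
  have : (0 : ℝ) ≤ n := n.cast_nonneg
  linarith

/-- These are the iterates of x ↦ (1/4)/(1-x) from 0: the weights, at 1/4 per edge, of single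
planted trees of bounded height. They increase to the fixed point 1/2. -/
theorem extinction_succ (n : ℕ) : extinction (n + 1) = 1 / (1 - extinction n) / 4 := by
  have h : (0 : ℝ) ≤ n := n.cast_nonneg
  have h1 : 1 - extinction n = (n + 2) / (2 * (n + 1)) := by
    rw [extinction]
    field_simp
    ring
  rw [h1, extinction]
  push_cast
  field_simp
  ring

theorem tendsto_extinction : Tendsto extinction atTop (𝓝 (1 / 2)) := by
  have h := (tendsto_natCast_div_add_atTop (1 : ℝ)).div_const 2
  refine h.congr fun n => ?_
  rw [extinction]
  field_simp

/-- The weight of the first `r + 1` generations of a tree. -/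
noncomputable def historyWeight (μ : ℝ) (S : PlanarTree) (r : ℕ) : ℝ :=
  Real.exp (-μ) ^ r / 4 ^ S.sizeUpTo r

theorem historyWeight_nonneg (μ : ℝ) (S : PlanarTree) (r : ℕ) : 0 ≤ historyWeight μ S r := by
  rw [historyWeight]
  positivity

theorem cylWeight_eq (μ : ℝ) (S : PlanarTree) (r : ℕ) :
    cylWeight μ S r = historyWeight μ S r * limitWeight μ (S.gen (r + 1)) := by
  rw [cylWeight, historyWeight]
  ring

theorem historyWeight_extendFin (μ : ℝ) (S : PlanarTree) (r : ℕ)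
    (m : Multiset (Fin (S.gen (r + 1)))) :
    historyWeight μ (S.extendFin (r + 1) m) (r + 1) =
      historyWeight μ S r * (Real.exp (-μ) / 4 ^ S.gen (r + 1)) := by
  rw [historyWeight, sizeUpTo_congr (S.extendFin_mem_cyl (Nat.le_add_left 1 r) m), sizeUpTo_succ,
    historyWeight, pow_succ, pow_add]
  field_simp

theorem card_children_extendFin (S : PlanarTree) (r : ℕ) (m : Multiset (Fin (S.gen (r + 1))))
    (I : Finset ℕ) : ((S.extendFin (r + 1) m).children (r + 1) I).card =
      m.countP fun i => i.1 ∈ I := by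
  rw [card_children, parents_extendFin_self S (Nat.le_add_left 1 r), Multiset.countP_map,
    Multiset.countP_eq_card_filter]

theorem children_subset_range (S : PlanarTree) (r : ℕ) (I : Finset ℕ) :
    S.children r I ⊆ range (S.gen (r + 1)) := filter_subset _ _

theorem card_sub_countP {α : Type*} (m : Multiset α) (p : α → Prop) [DecidablePred p] :
    m.card - m.countP p = m.countP fun x => ¬ p x := by
  rw [Multiset.card_eq_countP_add_countP p m, Nat.add_sub_cancel_left]

theorem measure_inter_cyl_congr {ν : Measure PlanarTree} {A : Set PlanarTree}
    (hA : MeasurableSet A) (S : PlanarTree) {r : ℕ} (hr : 1 ≤ r)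
    (B : Multiset (Fin (S.gen r)) → Set PlanarTree)
    (hB : ∀ m, ∀ T ∈ cyl (S.extendFin r m) (r + 1), T ∈ A ↔ T ∈ B m) :
    ν (A ∩ cyl S r) = ∑' m, ν (B m ∩ cyl (S.extendFin r m) (r + 1)) := by
  rw [measure_inter_cyl ν hA S hr]
  refine tsum_congr fun m => congrArg ν ?_
  ext T
  exact and_congr_left (hB m T)

section

variable {μ : ℝ} {ν : Measure PlanarTree}

/-- Induction on n through the next generation. The children of I are summed by the eigenvalue
equation for w; every vertex outside I contributes one step of the extinction recursion. -/
theorem measure_reachSet_inter_cyl (hμ : 0 < μ)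
    (hν : ∀ S r, ν (cyl S (r + 1)) = ENNReal.ofReal (cylWeight μ S r)) (n : ℕ) (S : PlanarTree)
    (r : ℕ) {I : Finset ℕ} (hI : I ⊆ range (S.gen (r + 1))) :
    ν (reachSet (r + 1) n I ∩ cyl S (r + 1)) = ENNReal.ofReal (historyWeight μ S r *
      (extinction n ^ (S.gen (r + 1) - I.card) * limitWeight μ I.card)) := by
  induction n generalizing S r I with
  | zero =>
    -- For n = 0 every vertex reaches its own height, so I must be the whole generation; this agrees
    -- with 0^(K-|I|).
    have h0 : extinction 0 = 0 := by simp [extinction]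
    rw [h0]
    rcases hI.eq_or_ssubset with rfl | hlt
    · have : reachSet (r + 1) 0 (range (S.gen (r + 1))) ∩ cyl S (r + 1) = cyl S (r + 1) := by
        refine Set.inter_eq_right.2 fun T hT i hi => ?_
        rw [mem_range, ← gen_eq_of_mem_cyl hT le_rfl]
        exact hi.lt
      rw [this, hν, cylWeight_eq]
      simp
    · have hcard := card_lt_card hlt
      rw [card_range] at hcard
      have : reachSet (r + 1) 0 I ∩ cyl S (r + 1) = ∅ := by
        refine Set.eq_empty_of_forall_notMem fun T hT => ?_
        obtain ⟨i, hi, hiI⟩ := exists_of_ssubset hlt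
        refine hiI (hT.1 i (reaches_zero.2 ?_))
        rw [gen_eq_of_mem_cyl hT.2 le_rfl]
        exact mem_range.1 hi
      rw [this, zero_pow (by omega)]
      simp
  | succ n ih =>
    rw [measure_inter_cyl_congr (measurableSet_reachSet _ _ _) S (Nat.le_add_left 1 r)
      (fun m => reachSet (r + 1 + 1) n ((S.extendFin (r + 1) m).children (r + 1) I))
      fun m T hT => by rw [mem_reachSet_succ, children_eq_of_mem_cyl hT]]
    have h1 : ∀ m, ν (reachSet (r + 1 + 1) n ((S.extendFin (r + 1) m).children (r + 1) I) ∩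
        cyl (S.extendFin (r + 1) m) (r + 1 + 1)) =
        ENNReal.ofReal (historyWeight μ S r * (Real.exp (-μ) / 4 ^ S.gen (r + 1)) *
          (extinction n ^ (m.countP fun i => ¬ i.1 ∈ I) *
            limitWeight μ (m.countP fun i => i.1 ∈ I))) := by
      intro m
      rw [ih _ _ (children_subset_range _ _ _), historyWeight_extendFin, card_children_extendFin,
        gen_extendFin S (Nat.le_add_left 1 r), card_sub_countP]
    simp_rw [h1]
    rw [tsum_multiset_fin hI (mul_nonneg (historyWeight_nonneg μ S r) (by positivity))
      (extinction_nonneg n) (extinction_lt_one n)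
      (tsum_multichoose_mul_limitWeight hμ I.card), extinction_succ, Real.exp_neg]
    congr 1
    have hle : I.card ≤ S.gen (r + 1) := by simpa using card_le_card hI
    obtain ⟨d, hd⟩ := Nat.exists_eq_add_of_le hle
    rw [hd, Nat.add_sub_cancel_left, pow_add]
    have := Real.exp_pos μ
    generalize 1 / (1 - extinction n) = y
    rw [div_pow]
    field_simp

theorem measure_infiniteVertices_subset (hμ : 0 < μ)
    (hν : ∀ S r, ν (cyl S (r + 1)) = ENNReal.ofReal (cylWeight μ S r)) (S : PlanarTree)
    (r : ℕ) {I : Finset ℕ} (hI : I ⊆ range (S.gen (r + 1))) :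
    ν ({T | T.infiniteVertices (r + 1) ⊆ I} ∩ cyl S (r + 1)) = ENNReal.ofReal (historyWeight μ S r *
      ((1 / 2) ^ (S.gen (r + 1) - I.card) * limitWeight μ I.card)) := by
  have h1 : Tendsto (fun n => ν (reachSet (r + 1) n I ∩ cyl S (r + 1))) atTop
      (𝓝 (ν ({T | T.infiniteVertices (r + 1) ⊆ I} ∩ cyl S (r + 1)))) := by
    rw [← iUnion_reachSet, Set.iUnion_inter]
    exact tendsto_measure_iUnion_atTop fun n m hnm =>
      Set.inter_subset_inter_left _ (monotone_reachSet (r + 1) I hnm)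
  refine tendsto_nhds_unique h1 ?_
  simp_rw [measure_reachSet_inter_cyl hμ hν _ S r hI]
  exact ENNReal.tendsto_ofReal (((tendsto_extinction.pow _).mul_const _).const_mul _)

/-- Möbius inversion over subsets by strong induction, which avoids subtraction; finiteness of g
permits cancellation. -/
theorem eq_of_sum_powerset_eq {α : Type*} [DecidableEq α] {U : Finset α} {f g : Finset α → ENNReal}
    (hg : ∀ I, g I ≠ ⊤) (h : ∀ I ⊆ U, ∑ J ∈ I.powerset, f J = ∑ J ∈ I.powerset, g J)
    {I : Finset α} (hI : I ⊆ U) : f I = g I := by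
  induction I using Finset.strongInduction with
  | H I ih =>
    have h1 := h I hI
    have h2 : I.powerset = insert I I.ssubsets := by
      ext J
      rw [mem_insert, mem_powerset, mem_ssubsets, subset_iff_ssubset_or_eq, or_comm]
    have h3 : I ∉ I.ssubsets := fun hI => (mem_ssubsets.1 hI).ne rfl
    rw [h2, sum_insert h3, sum_insert h3, sum_congr rfl fun J hJ =>
      ih J (mem_ssubsets.1 hJ) ((mem_ssubsets.1 hJ).subset.trans hI)] at h1
    exact (ENNReal.add_left_inj (ENNReal.sum_ne_top.2 fun J _ => hg J)).1 h1

theorem measure_infiniteVertices_subset_eq_sum (ν : Measure PlanarTree) (r : ℕ) (I : Finset ℕ)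
    {A : Set PlanarTree} (hA : MeasurableSet A) :
    ν ({T | T.infiniteVertices r ⊆ I} ∩ A) =
      ∑ J ∈ I.powerset, ν ({T | T.infiniteVertices r = J} ∩ A) := by
  rw [← measure_biUnion_finset]
  · congr 1
    ext T
    simp
  · refine fun J _ J' _ hne => Set.disjoint_left.2 fun T hT hT' => hne ?_
    exact (Eq.symm hT.1).trans hT'.1
  · exact fun J _ => (measurableSet_infiniteVertices r J).inter hA

theorem sum_powerset_card (I : Finset ℕ) (φ : ℕ → ENNReal) :
    ∑ J ∈ I.powerset, φ J.card = ∑ s ∈ range (I.card + 1), (I.card.choose s : ENNReal) * φ s := by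
  rw [sum_powerset_apply_card]
  simp

/-- The weight of the first `r + 1` generations of a tree with a given set of vertices of infinite
type. -/
noncomputable def spineWeight (μ : ℝ) (S : PlanarTree) (r s : ℕ) : ℝ :=
  historyWeight μ S r * (2 ^ s / 2 ^ S.gen (r + 1) * infiniteWeight μ s)

theorem spineWeight_nonneg (hμ : 0 < μ) (S : PlanarTree) (r s : ℕ) : 0 ≤ spineWeight μ S r s :=
  mul_nonneg (historyWeight_nonneg μ S r)
    (mul_nonneg (by positivity) (infiniteWeight_nonneg hμ s))

theorem half_pow_sub {K k : ℕ} (h : k ≤ K) : ((1 : ℝ) / 2) ^ (K - k) = 2 ^ k / 2 ^ K := by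
  obtain ⟨d, rfl⟩ := Nat.exists_eq_add_of_le h
  rw [Nat.add_sub_cancel_left, pow_add, one_div, inv_pow]
  field_simp

/-- Summed over the subsets of I, the claimed masses give the defining sum of w(|I|) times
(1/2)^(K-|I|), the mass already found for inclusion in I. -/
theorem measure_infiniteVertices_eq (hμ : 0 < μ)
    (hν : ∀ S r, ν (cyl S (r + 1)) = ENNReal.ofReal (cylWeight μ S r)) (S : PlanarTree)
    (r : ℕ) {I : Finset ℕ} (hI : I ⊆ range (S.gen (r + 1))) :
    ν ({T | T.infiniteVertices (r + 1) = I} ∩ cyl S (r + 1)) =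
      ENNReal.ofReal (spineWeight μ S r I.card) := by
  refine eq_of_sum_powerset_eq (f := fun I =>
    ν ({T | T.infiniteVertices (r + 1) = I} ∩ cyl S (r + 1)))
    (g := fun I => ENNReal.ofReal (spineWeight μ S r I.card))
    (fun _ => ENNReal.ofReal_ne_top) (fun I hI => ?_) hI
  have hle : I.card ≤ S.gen (r + 1) := by simpa using card_le_card hI
  rw [← measure_infiniteVertices_subset_eq_sum ν (r + 1) I (measurableSet_cyl _ _),
    measure_infiniteVertices_subset hμ hν S r hI,
    sum_powerset_card I fun s => ENNReal.ofReal (spineWeight μ S r s), half_pow_sub hle]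
  simp_rw [← ENNReal.ofReal_natCast, ← ENNReal.ofReal_mul (Nat.cast_nonneg _)]
  rw [← ENNReal.ofReal_sum_of_nonneg fun s _ =>
    mul_nonneg (Nat.cast_nonneg _) (spineWeight_nonneg hμ S r s)]
  congr 1
  rw [limitWeight, mul_sum, mul_sum]
  refine sum_congr rfl fun s _ => ?_
  rw [spineWeight]
  field_simp

/-! ### The Poisson transition between infinite generations -/

/-- The Poisson weights, as a function on the integers. -/
noncomputable def poissonWeight (μ : ℝ) (z : ℤ) : ℝ :=
  if 0 ≤ z then Real.exp (-μ) * (μ ^ z.toNat / z.toNat.factorial) else 0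

theorem poissonWeight_nonneg (hμ : 0 < μ) (z : ℤ) : 0 ≤ poissonWeight μ z := by
  rw [poissonWeight]
  split_ifs <;> positivity

theorem poissonWeight_sub {i s : ℕ} (h : i ≤ s) : poissonWeight μ ((s : ℤ) - i) =
    Real.exp (-μ) * (μ ^ (s - i) / (s - i).factorial) := by
  rw [poissonWeight, if_pos (by omega), show ((s : ℤ) - i).toNat = s - i by omega]

theorem poissonWeight_sub_of_lt {i s : ℕ} (h : s < i) : poissonWeight μ ((s : ℤ) - i) = 0 := by
  rw [poissonWeight, if_neg (by omega)]

/-- Sum over the next generation: its infinite set may be any s-subset of the children of I, each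
with the same mass. Children outside I have weight 1/2, so each vertex outside I contributes
1/(1-1/2) = 2. -/
theorem measure_card_infiniteVertices_eq (hμ : 0 < μ)
    (hν : ∀ S r, ν (cyl S (r + 1)) = ENNReal.ofReal (cylWeight μ S r)) (S : PlanarTree)
    (r s : ℕ) {I : Finset ℕ} (hI : I ⊆ range (S.gen (r + 1))) :
    ν (({T | T.infiniteVertices (r + 1) ⊆ I} ∩ {T | (T.infiniteVertices (r + 2)).card = s}) ∩
      cyl S (r + 1)) =
      ENNReal.ofReal (historyWeight μ S r * (Real.exp (-μ) / 4 ^ S.gen (r + 1)) *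
        (2 ^ (S.gen (r + 1) - I.card) *
          (Nat.multichoose I.card s * 2 ^ (I.card + s) * infiniteWeight μ s))) := by
  have hmeas : MeasurableSet ({T : PlanarTree | T.infiniteVertices (r + 1) ⊆ I} ∩
      {T | (T.infiniteVertices (r + 2)).card = s}) :=
    (measurableSet_of_infiniteVertices (r + 1) (· ⊆ I)).inter
      (measurableSet_of_infiniteVertices (r + 2) (·.card = s))
  rw [measure_inter_cyl_congr hmeas S (Nat.le_add_left 1 r)
    (fun m => {T | T.infiniteVertices (r + 2) ⊆ (S.extendFin (r + 1) m).children (r + 1) I} ∩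
      {T | (T.infiniteVertices (r + 2)).card = s})
    fun m T hT => and_congr_left fun _ => by
      change T.infiniteVertices (r + 1) ⊆ I ↔ T.infiniteVertices (r + 2) ⊆ _
      rw [infiniteVertices_subset_iff, children_eq_of_mem_cyl hT]]
  have h1 : ∀ m, ν (({T | T.infiniteVertices (r + 2) ⊆ (S.extendFin (r + 1) m).children (r + 1) I} ∩
      {T | (T.infiniteVertices (r + 2)).card = s}) ∩ cyl (S.extendFin (r + 1) m) (r + 1 + 1)) =
      ENNReal.ofReal (historyWeight μ S r * (Real.exp (-μ) / 4 ^ S.gen (r + 1)) *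
        ((1 / 2) ^ (m.countP fun i => ¬ i.1 ∈ I) *
          ((m.countP fun i => i.1 ∈ I).choose s * 2 ^ s / 2 ^ (m.countP fun i => i.1 ∈ I) *
            infiniteWeight μ s))) := by
    intro m
    set S' := S.extendFin (r + 1) m with hS'
    have hk : (S'.children (r + 1) I).card = m.countP fun i => i.1 ∈ I :=
      card_children_extendFin S r m I
    have hK : S'.gen (r + 1 + 1) = m.card := gen_extendFin S (Nat.le_add_left 1 r) m
    rw [Set.inter_assoc, measure_infiniteVertices_subset_eq_sum ν (r + 2) _
      ((measurableSet_of_infiniteVertices (r + 2) (·.card = s)).inter (measurableSet_cyl _ _))]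
    have h2 : ∀ J ∈ (S'.children (r + 1) I).powerset,
        ν ({T | T.infiniteVertices (r + 2) = J} ∩ ({T | (T.infiniteVertices (r + 2)).card = s} ∩
          cyl S' (r + 1 + 1))) =
        if J.card = s then ENNReal.ofReal (spineWeight μ S' (r + 1) s) else 0 := by
      intro J hJ
      split_ifs with hs
      · rw [← hs, ← measure_infiniteVertices_eq hμ hν S' (r + 1)
          ((mem_powerset.1 hJ).trans (children_subset_range _ _ _))]
        congr 1
        ext T
        simp only [Set.mem_inter_iff, Set.mem_ofPred_eq]
        constructor
        · exact fun h => ⟨h.1, h.2.2⟩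
        · exact fun h => ⟨h.1, by rw [h.1], h.2⟩
      · refine measure_mono_null (fun T hT => ?_) measure_empty
        refine hs ?_
        rw [← hT.2.1, ← hT.1]
    rw [sum_congr rfl h2, ← sum_filter, sum_const, ← powersetCard_eq_filter, card_powersetCard,
      nsmul_eq_mul, ← ENNReal.ofReal_natCast, ← ENNReal.ofReal_mul (Nat.cast_nonneg _), hk,
      spineWeight, historyWeight_extendFin, hK, ← card_sub_countP,
      half_pow_sub (Multiset.countP_le_card _ _)]
    congr 1
    field_simp
  simp_rw [h1]
  rw [tsum_multiset_fin hI (mul_nonneg (historyWeight_nonneg μ S r) (by positivity))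
    (by norm_num) (by norm_num)
    (g := fun J => (J.choose s * 2 ^ s / 2 ^ J * infiniteWeight μ s))
    (tsum_multichoose_mul_choose hμ I.card s)]
  norm_num

/-- The decisive factorization: inversion over subsets combined with
`multichoose_mul_infiniteWeight`. The second factor depends only on s - |I|, not on S. -/
theorem measure_infiniteVertices_eq_inter_card (hμ : 0 < μ)
    (hν : ∀ S r, ν (cyl S (r + 1)) = ENNReal.ofReal (cylWeight μ S r)) (S : PlanarTree)
    (r s : ℕ) {I : Finset ℕ} (hI : I ⊆ range (S.gen (r + 1))) :
    ν ({T | T.infiniteVertices (r + 1) = I} ∩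
      ({T | (T.infiniteVertices (r + 2)).card = s} ∩ cyl S (r + 1))) =
      ENNReal.ofReal (spineWeight μ S r I.card * poissonWeight μ ((s : ℤ) - I.card)) := by
  refine eq_of_sum_powerset_eq (f := fun I => ν ({T | T.infiniteVertices (r + 1) = I} ∩
      ({T | (T.infiniteVertices (r + 2)).card = s} ∩ cyl S (r + 1))))
    (g := fun I => ENNReal.ofReal (spineWeight μ S r I.card * poissonWeight μ ((s : ℤ) - I.card)))
    (fun _ => ENNReal.ofReal_ne_top) (fun I hI => ?_) hI
  have hle : I.card ≤ S.gen (r + 1) := by simpa using card_le_card hI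
  rw [← measure_infiniteVertices_subset_eq_sum ν (r + 1) I
      ((measurableSet_of_infiniteVertices (r + 2) (·.card = s)).inter (measurableSet_cyl _ _)),
    ← Set.inter_assoc, measure_card_infiniteVertices_eq hμ hν S r s hI,
    sum_powerset_card I fun i =>
      ENNReal.ofReal (spineWeight μ S r i * poissonWeight μ ((s : ℤ) - i)),
    multichoose_mul_infiniteWeight]
  simp_rw [← ENNReal.ofReal_natCast, ← ENNReal.ofReal_mul (Nat.cast_nonneg _)]
  rw [← ENNReal.ofReal_sum_of_nonneg fun i _ => mul_nonneg (Nat.cast_nonneg _)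
    (mul_nonneg (spineWeight_nonneg hμ S r i) (poissonWeight_nonneg hμ _))]
  congr 1
  -- The sum over subsets runs to |I|, Vandermonde's to s. Terms beyond either bound vanish, by the
  -- binomial coefficient or by the Poisson weight at negative arguments.
  have h1 : ∀ φ : ℕ → ℝ, (∀ i, I.card < i → φ i = 0) → (∀ i, s < i → φ i = 0) →
      ∑ i ∈ range (I.card + 1), φ i = ∑ i ∈ range (s + 1), φ i := by
    intro φ hφ1 hφ2
    rw [sum_subset (range_mono (Nat.le_max_left (I.card + 1) (s + 1))),
      sum_subset (range_mono (Nat.le_max_right (I.card + 1) (s + 1)))]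
    · exact fun i _ hi => hφ2 i (by simpa using hi)
    · exact fun i _ hi => hφ1 i (by simpa using hi)
  rw [h1]
  · rw [mul_sum, mul_sum, mul_sum]
    refine sum_congr rfl fun i hi => ?_
    rw [poissonWeight_sub (Nat.lt_succ_iff.1 (mem_range.1 hi)), spineWeight]
    obtain ⟨d, hd⟩ := Nat.exists_eq_add_of_le hle
    have h4 : ∀ n : ℕ, (4 : ℝ) ^ n = 2 ^ n * 2 ^ n := fun n => by rw [← mul_pow]; norm_num
    rw [hd, Nat.add_sub_cancel_left, h4, h4, pow_add]
    field_simp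
  · intro i hi
    rw [Nat.choose_eq_zero_of_lt hi]
    simp
  · intro i hi
    rw [poissonWeight_sub_of_lt hi]
    simp

end

end PlanarTree

namespace PlanarTree

open Filter Topology Finset MeasureTheory ProbabilityTheory

/-! ### The spine measure -/

theorem eq_biUnion_fibres {α γ : Type*} (X : α → γ) {A : Set α}
    (hA : ∀ S T, X T = X S → S ∈ A → T ∈ A) : A = ⋃ x ∈ X '' A, X ⁻¹' {x} := by
  ext T
  simp only [Set.mem_image, Set.iUnion_exists, Set.biUnion_and', Set.iUnion_iUnion_eq_right,
    Set.mem_iUnion, Set.mem_preimage, Set.mem_singleton_iff, exists_prop]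
  exact ⟨fun hT => ⟨T, hT, rfl⟩, fun ⟨S, hS, hT⟩ => hA S T hT hS⟩

theorem measurableSet_of_fibres {α γ : Type*} [MeasurableSpace α] [Countable γ] (X : α → γ)
    (hX : ∀ x, MeasurableSet (X ⁻¹' {x})) {A : Set α} (hA : ∀ S T, X T = X S → S ∈ A → T ∈ A) :
    MeasurableSet A := by
  rw [eq_biUnion_fibres X hA]
  exact MeasurableSet.biUnion (Set.to_countable _) fun x _ => hX x

/-- A is a countable disjoint union of fibres of X, on each of which B has the same conditional
probability p. -/
theorem measure_inter_of_fibres {α γ : Type*} [MeasurableSpace α] [Countable γ] (ν : Measure α)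
    (X : α → γ) (hX : ∀ x, MeasurableSet (X ⁻¹' {x})) {A B : Set α} (hB : MeasurableSet B)
    (hA : ∀ S T, X T = X S → S ∈ A → T ∈ A) {p : ENNReal}
    (h : ∀ S, ν (X ⁻¹' {X S} ∩ B) = ν (X ⁻¹' {X S}) * p) : ν (A ∩ B) = ν A * p := by
  have hdisj : (X '' A).PairwiseDisjoint fun x => X ⁻¹' {x} := by
    intro x _ y _ hxy
    exact Set.disjoint_left.2 fun T hx hy => hxy (Eq.trans (Eq.symm hx) hy)
  have h1 : A ∩ B = ⋃ x ∈ X '' A, X ⁻¹' {x} ∩ B := by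
    conv_lhs => rw [eq_biUnion_fibres X hA]
    rw [Set.iUnion₂_inter]
  conv_rhs => rw [eq_biUnion_fibres X hA]
  rw [h1, measure_biUnion (Set.to_countable _) hdisj fun x _ => hX x,
    measure_biUnion (Set.to_countable _)
      (fun x hx y hy hxy => (hdisj hx hy hxy).mono Set.inter_subset_left Set.inter_subset_left)
      fun x _ => (hX x).inter hB, ← ENNReal.tsum_mul_right]
  refine tsum_congr fun x => ?_
  obtain ⟨_, S, -, rfl⟩ := x
  exact h S

/-- The increment of the number of vertices of infinite type. -/
noncomputable def infiniteIncrement (r : ℕ) (T : PlanarTree) : ℤ :=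
  ((T.infiniteVertices (r + 1)).card : ℤ) - (T.infiniteVertices r).card

/-- The first generations of a tree together with the vertices of infinite type among the last
of them. -/
noncomputable def spineHistory (r : ℕ) (T : PlanarTree) : List (Multiset ℕ) × Finset ℕ :=
  (T.history r, T.infiniteVertices r)

theorem preimage_spineHistory (r : ℕ) (S : PlanarTree) :
    spineHistory r ⁻¹' {spineHistory r S} =
      {T | T.infiniteVertices r = S.infiniteVertices r} ∩ cyl S r := by
  ext T
  simp [spineHistory, cyl, and_comm]

theorem measurableSet_spineHistory (r : ℕ) (x : List (Multiset ℕ) × Finset ℕ) :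
    MeasurableSet (spineHistory r ⁻¹' {x}) := by
  rcases Set.eq_empty_or_nonempty (spineHistory r ⁻¹' {x}) with h | ⟨S, rfl⟩
  · rw [h]
    exact MeasurableSet.empty
  · rw [preimage_spineHistory]
    exact (measurableSet_infiniteVertices r _).inter (measurableSet_cyl S r)

theorem card_infiniteVertices_congr {S T : PlanarTree} {r s : ℕ}
    (h : spineHistory r T = spineHistory r S) (hs : s ≤ r) :
    (T.infiniteVertices s).card = (S.infiniteVertices s).card := by
  rw [infiniteVertices_eq_of_mem_cyl (S := S) (T := T) (Prod.mk.inj h).1 (Prod.mk.inj h).2 hs]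

theorem infiniteIncrement_congr {S T : PlanarTree} {r s : ℕ}
    (h : spineHistory r T = spineHistory r S) (hs : s < r) :
    infiniteIncrement s T = infiniteIncrement s S := by
  rw [infiniteIncrement, infiniteIncrement, card_infiniteVertices_congr h hs,
    card_infiniteVertices_congr h hs.le]

theorem measurable_card_infiniteVertices (r : ℕ) :
    Measurable fun T : PlanarTree => (T.infiniteVertices r).card :=
  measurable_to_countable' fun n => measurableSet_of_infiniteVertices r (·.card = n)

theorem measurable_infiniteIncrement (r : ℕ) : Measurable (infiniteIncrement r) := by
  have h := fun s => (Measurable.of_discrete (f := fun n : ℕ => (n : ℤ))).comp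
    (measurable_card_infiniteVertices s)
  exact (h (r + 1)).sub (h r)

theorem measurable_gen (r : ℕ) : Measurable fun T : PlanarTree => T.gen r :=
  measurable_to_countable' fun n => measurableSet_of_history (r := r) fun T T' h hT => by
    have hT' : T' ∈ cyl T r := h
    exact (gen_eq_of_mem_cyl hT' le_rfl).trans hT

theorem measurableSet_infinite : MeasurableSet {T : PlanarTree | T.size = ⊤} := by
  simp_rw [size_eq_top_iff, Set.ofPred_forall]
  exact MeasurableSet.iInter fun r => (measurable_gen r (MeasurableSet.singleton 0)).compl

/-- Each multiset of parents of the spine depends only on the parents and on two infinite sets of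
the tree, data with countably many values. -/
theorem measurable_spine : Measurable spine := by
  classical
  refine measurable_of_parents fun r m => ?_
  refine measurableSet_of_fibres (fun T : InfiniteTree =>
    (T.1.parents r, T.1.infiniteVertices r, T.1.infiniteVertices (r + 1))) ?_ ?_
  · rintro ⟨M, I, J⟩
    have h1 : MeasurableSet {T : PlanarTree | T.parents r = M} :=
      measurableSet_of_history (r := r + 1) fun T T' h hT =>
        (history_eq_iff.1 h r (Nat.lt_succ_self r)).trans hT
    have h2 := measurable_subtype_coe (p := fun T : PlanarTree => T.size = ⊤)
      (h1.inter ((measurableSet_infiniteVertices r I).inter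
        (measurableSet_infiniteVertices (r + 1) J)))
    convert! h2 using 1
    ext T
    simp
  · intro S T h hS
    simp only [Prod.mk.injEq] at h
    obtain ⟨h1, h2, h3⟩ := h
    have hp : T.1.parent r = S.1.parent r := by
      funext i
      rw [parent_eq_getD, parent_eq_getD, h1]
    have hg : T.1.gen (r + 1) = S.1.gen (r + 1) := by
      rw [← card_parents, ← card_parents, h1]
    have hI : ∀ s, T.1.infiniteVertices s = S.1.infiniteVertices s →
        T.1.InfiniteType s = S.1.InfiniteType s := by
      intro s hs
      funext i
      rw [← mem_infiniteVertices, ← mem_infiniteVertices, hs]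
    have hT : (spine T).parents r = (spine S).parents r := by
      simp only [parents, gen_spine, h3]
      refine Multiset.map_congr rfl fun i _ => ?_
      simp only [spine, hI r h2, hI (r + 1) h3, hp, hg]
    exact hT.trans hS

theorem measurable_rangeFactorization_spine : Measurable (Set.rangeFactorization spine) :=
  measurable_spine.subtype_mk

theorem measurable_increment (r : ℕ) : Measurable (increment r) := by
  have h := fun s => (Measurable.of_discrete (f := fun n : ℕ => (n : ℤ))).comp
    ((measurable_gen s).comp (measurable_subtype_coe (p := fun T => T ∈ Set.range spine)))
  exact (h (r + 1)).sub (h r)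

theorem increment_rangeFactorization_spine (r : ℕ) (T : InfiniteTree) :
    increment r (Set.rangeFactorization spine T) = infiniteIncrement r T.1 := by
  rw [increment, infiniteIncrement, ← gen_spine, ← gen_spine]
  rfl

section

variable {μ : ℝ} {ν : Measure PlanarTree}

/-- At r = 0 the cylinder is the whole space and the mass found above equals 1. This gives both
almost sure infiniteness and the starting value of the spine. -/
theorem ae_infiniteVertices_one (hμ : 0 < μ) (h : IsLocalLimit μ ν) :
    ∀ᵐ T ∂ν, T.infiniteVertices 1 = {0} := by
  have := h.1
  obtain ⟨S⟩ := (inferInstance : Nonempty PlanarTree)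
  have h1 := measure_infiniteVertices_eq hμ (fun S r => h.measure_cyl hμ S r) S 0 (I := {0})
    (by simp [S.gen_one])
  rw [cyl_one, Set.inter_univ] at h1
  refine (prob_compl_eq_zero_iff (measurableSet_infiniteVertices 1 {0})).2 (h1.trans ?_)
  simp [spineWeight, historyWeight, S.gen_one, infiniteWeight, sizeUpTo]

theorem ae_size_eq_top (hμ : 0 < μ) (h : IsLocalLimit μ ν) : ∀ᵐ T ∂ν, T.size = ⊤ := by
  filter_upwards [ae_infiniteVertices_one hμ h] with T hT
  rw [size_eq_top_iff]
  have h1 : T.InfiniteType 1 0 := by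
    rw [← mem_infiniteVertices, hT]
    exact mem_singleton_self 0
  rintro (_ | r)
  · rw [T.gen_zero]
    exact one_ne_zero
  · obtain ⟨j, hj, -⟩ := infiniteType_iff.1 h1 r
    rw [add_comm 1 r] at hj
    omega

/-- Transfers events of the spine to events of the tree; the passage to infinite trees loses only a
null set. -/
theorem spineMeasure_apply (hμ : 0 < μ) (h : IsLocalLimit μ ν) {B : Set SpineTree}
    (hB : MeasurableSet B) (A : Set PlanarTree)
    (hAB : ∀ T : InfiniteTree, Set.rangeFactorization spine T ∈ B ↔ T.1 ∈ A) :
    spineMeasure ν B = ν A := by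
  have hemb : MeasurableEmbedding (Subtype.val : InfiniteTree → PlanarTree) :=
    MeasurableEmbedding.subtype_coe measurableSet_infinite
  rw [spineMeasure, Measure.map_apply measurable_rangeFactorization_spine hB, hemb.comap_apply]
  refine measure_congr ?_
  filter_upwards [ae_size_eq_top hμ h] with T hT
  refine propext ⟨?_, fun hA => ⟨⟨T, hT⟩, (hAB _).2 hA, rfl⟩⟩
  rintro ⟨T, hTB, rfl⟩
  exact (hAB T).1 hTB

theorem isProbabilityMeasure_spineMeasure (hμ : 0 < μ) (h : IsLocalLimit μ ν) :
    IsProbabilityMeasure (spineMeasure ν) := by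
  have := h.1
  constructor
  rw [spineMeasure_apply hμ h MeasurableSet.univ Set.univ fun _ => Iff.rfl, measure_univ]

theorem measure_spineHistory_inter (hμ : 0 < μ) (h : IsLocalLimit μ ν) (r : ℕ) (z : ℤ)
    (S : PlanarTree) :
    ν (spineHistory (r + 1) ⁻¹' {spineHistory (r + 1) S} ∩ infiniteIncrement (r + 1) ⁻¹' {z}) =
      ν (spineHistory (r + 1) ⁻¹' {spineHistory (r + 1) S}) * ENNReal.ofReal (poissonWeight μ z) := by
  have hν : ∀ S r, ν (cyl S (r + 1)) = ENNReal.ofReal (cylWeight μ S r) :=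
    fun S r => h.measure_cyl hμ S r
  have hI := S.infiniteVertices_subset_range (r + 1)
  set I := S.infiniteVertices (r + 1) with hIdef
  rw [preimage_spineHistory]
  -- If |I| + z is negative the event is empty, and z < 0 has Poisson weight 0.
  rcases lt_or_ge ((I.card : ℤ) + z) 0 with hz | hz
  · rw [poissonWeight, if_neg (by omega), ENNReal.ofReal_zero, mul_zero]
    refine measure_mono_null (fun T hT => ?_) measure_empty
    have h1 : T.infiniteVertices (r + 1) = I := hT.1.1
    have h2 : infiniteIncrement (r + 1) T = z := hT.2
    rw [infiniteIncrement, h1] at h2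
    exfalso
    omega
  · obtain ⟨s, hs⟩ := Int.eq_ofNat_of_zero_le hz
    have h1 := measure_infiniteVertices_eq_inter_card hμ hν S r s hI
    rw [ENNReal.ofReal_mul (spineWeight_nonneg hμ S r _),
      ← measure_infiniteVertices_eq hμ hν S r hI, show (s : ℤ) - I.card = z by omega] at h1
    rw [← h1]
    congr 1
    ext T
    simp only [Set.mem_inter_iff, Set.mem_ofPred_eq, Set.mem_preimage, Set.mem_singleton_iff]
    constructor
    · rintro ⟨⟨h2, h3⟩, h4⟩
      change ((T.infiniteVertices (r + 2)).card : ℤ) - _ = z at h4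
      rw [h2] at h4
      refine ⟨h2, ?_, h3⟩
      have h5 : ((T.infiniteVertices (r + 2)).card : ℤ) = s := by rw [← hs, ← h4]; ring
      exact_mod_cast h5
    · rintro ⟨h2, h3, h4⟩
      refine ⟨⟨h2, h4⟩, ?_⟩
      rw [infiniteIncrement, h2, h3]
      omega

theorem measure_inter_infiniteIncrement_singleton (hμ : 0 < μ) (h : IsLocalLimit μ ν) (r : ℕ)
    {A : Set PlanarTree}
    (hA : ∀ S T, spineHistory (r + 1) T = spineHistory (r + 1) S → S ∈ A → T ∈ A) (z : ℤ) :
    ν (A ∩ infiniteIncrement (r + 1) ⁻¹' {z}) = ν A * ENNReal.ofReal (poissonWeight μ z) :=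
  measure_inter_of_fibres ν (spineHistory (r + 1)) (measurableSet_spineHistory (r + 1))
    (measurable_infiniteIncrement _ (MeasurableSet.singleton z)) hA
    (measure_spineHistory_inter hμ h r z)

theorem measure_infiniteIncrement_singleton (hμ : 0 < μ) (h : IsLocalLimit μ ν) (r : ℕ) (z : ℤ) :
    ν (infiniteIncrement (r + 1) ⁻¹' {z}) = ENNReal.ofReal (poissonWeight μ z) := by
  have := h.1
  have h1 := measure_inter_infiniteIncrement_singleton hμ h r (A := Set.univ)
    (fun _ _ _ _ => Set.mem_univ _) z
  rwa [Set.univ_inter, measure_univ, one_mul] at h1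

theorem measure_inter_infiniteIncrement (hμ : 0 < μ) (h : IsLocalLimit μ ν) (r : ℕ)
    {A : Set PlanarTree}
    (hA : ∀ S T, spineHistory (r + 1) T = spineHistory (r + 1) S → S ∈ A → T ∈ A) (B : Set ℤ) :
    ν (A ∩ infiniteIncrement (r + 1) ⁻¹' B) = ν A * ν (infiniteIncrement (r + 1) ⁻¹' B) := by
  have hAm := measurableSet_of_fibres _ (measurableSet_spineHistory (r + 1)) hA
  have h1 : infiniteIncrement (r + 1) ⁻¹' B = ⋃ z ∈ B, infiniteIncrement (r + 1) ⁻¹' {z} := by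
    ext T
    simp
  have hm : ∀ z, MeasurableSet (infiniteIncrement (r + 1) ⁻¹' {z}) := fun z =>
    measurable_infiniteIncrement _ (MeasurableSet.singleton z)
  have hdisj : B.PairwiseDisjoint fun z => infiniteIncrement (r + 1) ⁻¹' {z} := by
    intro x _ y _ hxy
    exact Set.disjoint_left.2 fun T hx hy => hxy (Eq.trans (Eq.symm hx) hy)
  rw [h1, Set.inter_iUnion₂, measure_biUnion (Set.to_countable _) hdisj fun z _ => hm z,
    measure_biUnion (Set.to_countable _)
      (fun x hx y hy hxy => (hdisj hx hy hxy).mono Set.inter_subset_right Set.inter_subset_right)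
      fun z _ => hAm.inter (hm z), ← ENNReal.tsum_mul_left]
  refine tsum_congr fun z => ?_
  rw [measure_inter_infiniteIncrement_singleton hμ h r hA,
    measure_infiniteIncrement_singleton hμ h]

/-- The largest index is split off: all smaller increments are functions of the spine history at
that height. -/
theorem measure_biInter_infiniteIncrement (hμ : 0 < μ) (h : IsLocalLimit μ ν)
    (J : Finset {r : ℕ // 1 ≤ r}) (B : {r : ℕ // 1 ≤ r} → Set ℤ) :
    ν (⋂ i ∈ J, infiniteIncrement i.1 ⁻¹' B i) = ∏ i ∈ J, ν (infiniteIncrement i.1 ⁻¹' B i) := by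
  have := h.1
  induction J using Finset.induction_on_max with
  | empty => simp
  | insert a J hJ ih =>
    have ha : a ∉ J := fun h => (hJ a h).false
    obtain ⟨r, hr⟩ := Nat.exists_eq_add_of_le' a.2
    rw [prod_insert ha, ← ih, Finset.set_biInter_insert, Set.inter_comm, hr,
      measure_inter_infiniteIncrement hμ h r, mul_comm]
    intro S T hST hS
    simp only [Set.mem_iInter, Set.mem_preimage] at hS ⊢
    intro i hi
    rw [infiniteIncrement_congr hST (by have := hJ i hi; rw [← hr]; exact this)]
    exact hS i hi

theorem iIndepFun_increment (hμ : 0 < μ) (h : IsLocalLimit μ ν) :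
    iIndepFun (fun r : {r : ℕ // 1 ≤ r} => increment r.1) (spineMeasure ν) := by
  rw [iIndepFun_iff_measure_inter_preimage_eq_mul]
  intro J B hB
  rw [spineMeasure_apply hμ h (Finset.measurableSet_biInter J fun i hi =>
      measurable_increment i.1 (hB i hi)) (⋂ i ∈ J, infiniteIncrement i.1 ⁻¹' B i),
    measure_biInter_infiniteIncrement hμ h]
  · refine prod_congr rfl fun i hi => (spineMeasure_apply hμ h
      (measurable_increment i.1 (hB i hi)) _ fun T => ?_).symm
    rw [Set.mem_preimage, Set.mem_preimage, increment_rangeFactorization_spine]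
  · intro T
    simp only [Set.mem_iInter, Set.mem_preimage, increment_rangeFactorization_spine]

theorem spineMeasure_increment (hμ : 0 < μ) (h : IsLocalLimit μ ν) {r : ℕ} (hr : 1 ≤ r) (n : ℕ) :
    spineMeasure ν {T | increment r T = (n : ℤ)} =
      ENNReal.ofReal (Real.exp (-μ) * (μ ^ n / (n.factorial : ℝ))) := by
  obtain ⟨r, rfl⟩ := Nat.exists_eq_add_of_le' hr
  refine (spineMeasure_apply hμ h
    (measurable_increment (r + 1) (MeasurableSet.singleton (n : ℤ)))
    (infiniteIncrement (r + 1) ⁻¹' {(n : ℤ)}) fun T => ?_).trans ?_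
  · rw [Set.mem_preimage, Set.mem_preimage, increment_rangeFactorization_spine]
  · rw [measure_infiniteIncrement_singleton hμ h]
    simp [poissonWeight]

theorem sum_range_pow_div_factorial (x y : ℝ) (n : ℕ) :
    ∑ i ∈ range (n + 1), x ^ i / i.factorial * (y ^ (n - i) / (n - i).factorial) =
      (x + y) ^ n / n.factorial := by
  rw [add_pow, sum_div]
  refine sum_congr rfl fun i hi => ?_
  rw [Nat.cast_choose ℝ (Nat.lt_succ_iff.1 (mem_range.1 hi))]
  have := n.factorial_ne_zero
  field_simp

/-- Starting from one infinite vertex at height 1, each generation convolves with Poisson(μ); the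
binomial theorem adds the means. The shift n - 1 accounts for the initial vertex. -/
theorem measure_card_infiniteVertices (hμ : 0 < μ) (h : IsLocalLimit μ ν) (r n : ℕ) :
    ν {T | (T.infiniteVertices (r + 1)).card = n} =
      ENNReal.ofReal (if n = 0 then 0 else
        Real.exp (-(r * μ)) * ((r * μ) ^ (n - 1) / ((n - 1).factorial : ℝ))) := by
  have := h.1
  induction r generalizing n with
  | zero =>
    have h1 : ν {T | (T.infiniteVertices (0 + 1)).card = n} = ν {_T | n = 1} := by
      refine measure_congr ?_
      filter_upwards [ae_infiniteVertices_one hμ h] with T hT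
      refine propext ?_
      change (T.infiniteVertices 1).card = n ↔ n = 1
      rw [hT, card_singleton, eq_comm]
    rw [h1]
    rcases n with _ | _ | n <;> simp
  | succ r ih =>
    have h1 : {T : PlanarTree | (T.infiniteVertices (r + 1 + 1)).card = n} =
        ⋃ k : ℕ, {T : PlanarTree | (T.infiniteVertices (r + 1)).card = k} ∩
          infiniteIncrement (r + 1) ⁻¹' {(n : ℤ) - k} := by
      ext T
      simp only [Set.mem_ofPred_eq, Set.mem_iUnion, Set.mem_inter_iff, Set.mem_preimage,
        Set.mem_singleton_iff, exists_eq_left', infiniteIncrement]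
      omega
    rw [h1, measure_iUnion]
    · have h2 : ∀ k : ℕ, ν ({T : PlanarTree | (T.infiniteVertices (r + 1)).card = k} ∩
          infiniteIncrement (r + 1) ⁻¹' {(n : ℤ) - k}) = ENNReal.ofReal ((if k = 0 then 0 else
            Real.exp (-(r * μ)) * ((r * μ) ^ (k - 1) / ((k - 1).factorial : ℝ))) *
              poissonWeight μ ((n : ℤ) - k)) := by
        intro k
        rw [measure_inter_infiniteIncrement_singleton hμ h r, ih, ENNReal.ofReal_mul]
        · split_ifs <;> positivity
        · intro S T hST hS
          exact (card_infiniteVertices_congr hST le_rfl).trans hS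
      simp_rw [h2]
      rw [tsum_eq_sum (s := range (n + 1)) fun k hk => by
        rw [poissonWeight_sub_of_lt (by simpa using hk), mul_zero, ENNReal.ofReal_zero],
        ← ENNReal.ofReal_sum_of_nonneg fun k _ => mul_nonneg (by split_ifs <;> positivity)
          (poissonWeight_nonneg hμ _), sum_range_succ']
      congr 1
      rcases n with _ | n
      · simp
      · simp only [Nat.add_eq_zero_iff, one_ne_zero, and_false, if_false, if_true, zero_mul,
          add_zero, Nat.add_sub_cancel]
        have h3 : ((r + 1 : ℕ) : ℝ) * μ = r * μ + μ := by
          push_cast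
          ring
        rw [h3, ← sum_range_pow_div_factorial, neg_add, Real.exp_add, mul_sum]
        refine sum_congr rfl fun k hk => ?_
        rw [poissonWeight_sub (by have := mem_range.1 hk; omega), Nat.add_sub_add_right]
        ring
    · exact fun k l hkl => Set.disjoint_left.2 fun T hk hl => hkl (Eq.trans (Eq.symm hk.1) hl.1)
    · exact fun k => (measurable_card_infiniteVertices (r + 1) (MeasurableSet.singleton k)).inter
        (measurable_infiniteIncrement _ (MeasurableSet.singleton _))

theorem spineMeasure_gen (hμ : 0 < μ) (h : IsLocalLimit μ ν) {r : ℕ} (hr : 1 ≤ r) {n : ℕ}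
    (hn : 1 ≤ n) : spineMeasure ν {T | T.1.gen r = n} =
      ENNReal.ofReal (Real.exp (-(((r : ℝ) - 1) * μ)) *
        ((((r : ℝ) - 1) * μ) ^ (n - 1) / ((n - 1).factorial : ℝ))) := by
  obtain ⟨r, rfl⟩ := Nat.exists_eq_add_of_le' hr
  have hm : MeasurableSet {T : SpineTree | T.1.gen (r + 1) = n} :=
    ((measurable_gen (r + 1)).comp measurable_subtype_coe) (MeasurableSet.singleton n)
  rw [spineMeasure_apply hμ h hm {T | (T.infiniteVertices (r + 1)).card = n} fun T => by
    change (spine T).gen (r + 1) = n ↔ _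
    rw [gen_spine]
    rfl, measure_card_infiniteVertices hμ h, if_neg (by omega)]
  simp

end

end PlanarTree

theorem mainTheorem7 (μ : ℝ) (hμ : 0 < μ) :
    (∃! ν : MeasureTheory.Measure PlanarTree, PlanarTree.IsLocalLimit μ ν) ∧
    ∀ ν : MeasureTheory.Measure PlanarTree, PlanarTree.IsLocalLimit μ ν →
      MeasureTheory.IsProbabilityMeasure (PlanarTree.spineMeasure ν) ∧
      (∀ r : ℕ, 1 ≤ r → Measurable (PlanarTree.increment r)) ∧
      ProbabilityTheory.iIndepFun
        (fun r : {r : ℕ // 1 ≤ r} => PlanarTree.increment r.1) (PlanarTree.spineMeasure ν) ∧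
      (∀ r : ℕ, 1 ≤ r → ∀ n : ℕ,
        PlanarTree.spineMeasure ν {T | PlanarTree.increment r T = (n : ℤ)} =
          ENNReal.ofReal (Real.exp (-μ) * (μ ^ n / (n.factorial : ℝ)))) ∧
      (∀ r : ℕ, 2 ≤ r → ∀ R : ℕ, 1 ≤ R →
        PlanarTree.spineMeasure ν {T | T.1.gen r = R} =
          ENNReal.ofReal (Real.exp (-(((r : ℝ) - 1) * μ)) *
            ((((r : ℝ) - 1) * μ) ^ (R - 1) / ((R - 1).factorial : ℝ)))) :=
  ⟨PlanarTree.existsUnique_isLocalLimit hμ, fun _ h =>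
    ⟨PlanarTree.isProbabilityMeasure_spineMeasure hμ h,
      fun r _ => PlanarTree.measurable_increment r, PlanarTree.iIndepFun_increment hμ h,
      fun _ hr n => PlanarTree.spineMeasure_increment hμ h hr n,
      fun _ hr _ hR => PlanarTree.spineMeasure_gen hμ h (by omega) hR⟩⟩
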